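/- **Setting.** For a formal power series in $d$ with coefficients in $\mathbb C[u]$ and a power series $T$ in $d$ with coefficients in $\mathbb C[u]$, let $Z(d,T)=\sum_n Z_n(T)\,d^n$ if $Z(d,u)=\sum_n Z_n(u)\,d^n$. Let $$T^{\pm}=\frac{u\pm\tanh d}{1\pm u\tanh d},\qquad T^{\pm\frac12}=\frac{u\pm\tanh (d/2)}{1\pm u\tanh (d/2)},\qquad \mathcal S(Z)(d,u)=\tfrac12\bigl(Z(d,T^{+\frac12})-Z(d,T^{-\frac12})\bigr).$$ Let $\varepsilon=2\sinh(d/2)$ and let $A(d,u)=\sum_{n\ge1}A_{2n-1}(u)\,d^{2n}$, with odd polynomials $A_{2n-1}$ of degree at most $2n-1$, be the formal solution of the discretized pendulum equation $$\frac{A(d,T^+)}{\cosh d+u\sinh d}+\frac{A(d,T^-)}{\cosh d-u\sinh d}-2A(d,u)=\varepsilon^2\Bigl(2u\cos\bigl(A\sqrt{1-u^2}\bigr)+\frac{2u^2-1}{\sqrt{1-u^2}}\sin\bigl(A\sqrt{1-u^2}\bigr)\Bigr)-\sum_{n\ge1}I_{2n-1}(u)\,d^{2n},$$ where the polynomials $I_{2n-1}$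 are given by $\frac{2}{(2n)!}\bigl(\frac{d}{dz}\bigr)^{2n}\bigl(4\arctan(e^{-z})\bigr)=\sqrt{1-u^2}\;I_{2n-1}(u)$ with $u=\tanh z$. Put $$U=-\tfrac14u\,d^2+\bigl(\tfrac{91}{864}u^3-\tfrac{47}{576}u\bigr)d^4+\bigl(-\tfrac{319}{2880}u^5+\tfrac{185}{1152}u^3-\tfrac{3703}{69120}u\bigr)d^6,$$ $$Q=1+\tfrac14(1-u^2)d^2+\bigl(\tfrac{91}{432}u^4-\tfrac{13}{48}u^2+\tfrac{13}{216}\bigr)d^4+\bigl(-\tfrac{319}{960}u^6+\tfrac{1079}{1728}u^4-\tfrac{937}{2880}u^2+\tfrac{287}{8640}\bigr)d^6,$$ $$Q_1=(u^2-1)d^2+\tfrac14(1-u^4)d^4-\tfrac5{48}(1-u^2)\bigl(\tfrac49u^4+u^2+1\bigr)d^6+(1-u^2)\bigl(-\tfrac{367}{2160}u^6+\tfrac{185}{432}u^4-\tfrac{997}{4320}u^2\bigr)d^8,$$ and define the series $G$ by $A=U+Q\,G$. Let $\tau_0=1$, $\tau_1=u$, $\tau_{n+1}=\frac1n(1-u^2)\tau_n'$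 for $n\ge1$; then $\tau_n$ has degree $n$. For a polynomial $p=\sum_{i=0}^na_i\tau_i$ of degree at most $n$ put $\|p\|_n=\sum_{i=0}^n|a_i|\left(\frac\pi2\right)^{n-i}$, and for a series $E=\sum_nE_n(u)\,d^n$ with $\deg E_n\le n$ put $\|E\|_n=\|E_n\|_n$. **Lemma 5.2.** The series $\mathcal S(Q_1\,\mathcal S(G))$ is divisible by $d$, the coefficient of $d^n$ in $\frac1d\,\mathcal S(Q_1\,\mathcal S(G))$ is a polynomial in $u$ of degree at most $n$ for every $n$, and $$\left\|\frac1d\,\mathcal S(Q_1\,\mathcal S(G))\right\|_n=\mathcal O\bigl((n-8)!\,(2\pi)^{-n}\bigr)\qquad\text{as } n\to\infty.$$ -/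

import Mathlib

open Filter Asymptotics

noncomputable section

namespace DiscretePendulum

open Polynomial

/-! ### Polynomials in `u`, the basis `τ_n` and the norms -/

/-- The operator `D = (1 - u²) ∂/∂u` on polynomials in `u`. -/
def D (p : ℂ[X]) : ℂ[X] := (1 - Polynomial.X ^ 2) * derivative p

/-- `τ_0 = 1`, `τ_1 = u`, `τ_{n+1} = (1/n) D τ_n` for `n ≥ 1`. -/
def tau : ℕ → ℂ[X]
  | 0 => 1
  | 1 => Polynomial.X
  | n + 2 => Polynomial.C (1 / ((n : ℂ) + 1)) * D (tau (n + 1))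

theorem natDegree_tau_and_leadingCoeff (n : ℕ) :
    (tau (n + 1)).natDegree = n + 1 ∧ (tau (n + 1)).leadingCoeff = (-1) ^ n := by
  induction n with
  | zero => simp [tau]
  | succ n ih =>
    obtain ⟨h1, h2⟩ := ih
    have hn : ((n : ℂ) + 1) ≠ 0 := by exact_mod_cast Nat.succ_ne_zero n
    have hd : (derivative (tau (n + 1))).natDegree = n := by
      rw [natDegree_derivative, h1]; simp
    have hl : (derivative (tau (n + 1))).leadingCoeff = (-1) ^ n * ((n : ℂ) + 1) := by
      have h2' : (tau (n + 1)).coeff (n + 1) = (-1) ^ n := by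
        rw [← h2, leadingCoeff, h1]
      rw [leadingCoeff, hd, Polynomial.coeff_derivative, h2']
    have hX : (1 - Polynomial.X ^ 2 : ℂ[X]) = -(Polynomial.X ^ 2 - Polynomial.C 1) := by simp
    have hq : (1 - Polynomial.X ^ 2 : ℂ[X]).natDegree = 2 := by
      rw [hX, natDegree_neg, natDegree_X_pow_sub_C]
    have hql : (1 - Polynomial.X ^ 2 : ℂ[X]).leadingCoeff = -1 := by
      rw [hX, leadingCoeff_neg, leadingCoeff_X_pow_sub_C (by norm_num)]
    have hL : (tau (n + 2)).leadingCoeff = (-1) ^ (n + 1) := by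
      rw [tau, D, leadingCoeff_mul, leadingCoeff_mul, hql, hl, leadingCoeff_C]
      field_simp
      ring
    refine ⟨?_, hL⟩
    have hd0 : derivative (tau (n + 1)) ≠ 0 := by
      rw [← leadingCoeff_ne_zero, hl]
      exact mul_ne_zero (pow_ne_zero _ (by norm_num)) hn
    have hq0 : (1 - Polynomial.X ^ 2 : ℂ[X]) ≠ 0 := by
      rw [← leadingCoeff_ne_zero, hql]; norm_num
    rw [tau, D, natDegree_C_mul (by simpa using hn), natDegree_mul hq0 hd0, hq, hd]
    ring

/-- `τ_n` has exactly degree `n`. -/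
theorem degree_tau (n : ℕ) : (tau n).degree = n := by
  cases n with
  | zero => simp [tau]
  | succ n =>
    obtain ⟨h1, h2⟩ := natDegree_tau_and_leadingCoeff n
    have h0 : tau (n + 1) ≠ 0 := by
      rw [← leadingCoeff_ne_zero, h2]
      exact pow_ne_zero _ (by norm_num)
    rw [degree_eq_natDegree h0, h1]

/-- The sequence `τ_0, τ_1, …` as a sequence of polynomials of degrees `0, 1, …`. -/
def tauSeq : Polynomial.Sequence ℂ := ⟨tau, degree_tau⟩

theorem isUnit_leadingCoeff_tauSeq (n : ℕ) : IsUnit (tauSeq n).leadingCoeff :=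
  isUnit_iff_ne_zero.mpr (leadingCoeff_ne_zero.mpr (tauSeq.ne_zero n))

/-- The basis `(τ_n)` of the space of all polynomials. -/
def tauBasis : Module.Basis ℕ ℂ ℂ[X] := tauSeq.basis isUnit_leadingCoeff_tauSeq

/-- `‖p‖_n = ∑_{i ≤ n} |a_i| (π/2)^{n-i}` for `p = ∑_{i ≤ n} a_i τ_i`, a polynomial of degree at
most `n`. -/
def tauNorm (n : ℕ) (p : ℂ[X]) : ℝ :=
  ∑ i ∈ Finset.range (n + 1), ‖tauBasis.repr p i‖ * (Real.pi / 2) ^ (n - i)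

/-! ### Formal power series in `d` whose coefficients are polynomials in `u` -/

/-- Formal power series in `d` with coefficients in `ℂ[u]`. -/
abbrev PSeries : Type := PowerSeries ℂ[X]

/-- The indeterminate `d`. -/
def d : PSeries := PowerSeries.X

/-- The polynomial `p(u)`, as a series that is constant in `d`. -/
abbrev pol (p : ℂ[X]) : PSeries := PowerSeries.C p

/-- The variable `u`. -/
def u : PSeries := pol Polynomial.X

/-- A complex number as a constant series. -/
abbrev num (c : ℂ) : PSeries := pol (Polynomial.C c)

/-- `exp(θ d)`. -/
def expS (θ : ℂ) : PSeries :=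
  PowerSeries.map Polynomial.C (PowerSeries.rescale θ (PowerSeries.exp ℂ))

/-- `cosh(θ d)`. -/
def coshS (θ : ℂ) : PSeries := num (1 / 2) * (expS θ + expS (-θ))

/-- `sinh(θ d)`. -/
def sinhS (θ : ℂ) : PSeries := num (1 / 2) * (expS θ - expS (-θ))

/-- The inverse of a series whose coefficient of `d ^ 0` is the polynomial `1`. -/
def inv (V : PSeries) : PSeries := PowerSeries.invOfUnit V 1

theorem mul_inv (V : PSeries) (h : PowerSeries.constantCoeff V = 1) : V * inv V = 1 :=
  PowerSeries.mul_invOfUnit V 1 (by simpa using h)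

/-- `tanh(θ d)`. -/
def tanhS (θ : ℂ) : PSeries := sinhS θ * inv (coshS θ)

/-- `T(θ) = (u + tanh(θ d)) / (1 + u tanh(θ d))`; thus `T⁺ = T(1)`, `T⁻ = T(-1)`,
`T^{+1/2} = T(1/2)` and `T^{-1/2} = T(-1/2)`. -/
def T (θ : ℂ) : PSeries := (u + tanhS θ) * inv (1 + u * tanhS θ)

/-- `Z(d, T)`: in `Z(d, u) = ∑ Z_n(u) d^n`, the variable `u` is replaced by the series `T`, that is,
`Z(d, T) = ∑ Z_n(T) d^n`. -/
def substU (Z T : PSeries) : PSeries :=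
  PowerSeries.mk fun m => ∑ k ∈ Finset.HasAntidiagonal.antidiagonal m,
    PowerSeries.coeff k.2 (Polynomial.aeval T (PowerSeries.coeff k.1 Z))

/-- `𝒮(Z)(d, u) = (Z(d, T^{+1/2}) - Z(d, T^{-1/2})) / 2`. -/
def S (Z : PSeries) : PSeries :=
  num (1 / 2) * (substU Z (T (1 / 2)) - substU Z (T (-(1 / 2))))

/-! ### The formal solution of the discretized pendulum equation -/

/-- `ε = 2 sinh(d/2)`. -/
def eps : PSeries := num 2 * sinhS (1 / 2)

/-- If `u = tanh z`, then `d/dz (√(1-u²) p(u)) = √(1-u²) (L p)(u)` with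
`L p = (1 - u²) p' - u p`. -/
def L (p : ℂ[X]) : ℂ[X] := D p - Polynomial.X * p

/-- The odd polynomial `I_{m-1}(u)`, for even `m ≥ 2`, for which
`(2 / m!) (d/dz)^m (4 arctan (exp (-z))) = √(1-u²) I_{m-1}(u)`, where `u = tanh z`.
As `d/dz (4 arctan (exp (-z))) = -2 / cosh z = -2 √(1-u²)`, it is `-(4 / m!) L^{m-1} 1`. -/
def sepPoly (m : ℕ) : ℂ[X] := Polynomial.C (-4 / (m.factorial : ℂ)) * L^[m - 1] 1

/-- `∑_{n ≥ 1} I_{2n-1}(u) d^{2n}`. -/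
def sepSeries : PSeries := PowerSeries.mk fun m => if Even m ∧ 0 < m then sepPoly m else 0

/-- The series `∑ (-1)^k w^k / (2k)!`, that is `cos √w`. -/
def cosSqrt : PowerSeries ℂ := PowerSeries.mk fun k => (-1) ^ k / ((2 * k).factorial : ℂ)

/-- The series `∑ (-1)^k w^k / (2k+1)!`, that is `sin √w / √w`. -/
def sincSqrt : PowerSeries ℂ := PowerSeries.mk fun k => (-1) ^ k / ((2 * k + 1).factorial : ℂ)

/-- `cos (A √(1-u²))`, for `A` without constant term. -/
def cosA (A : PSeries) : PSeries := PowerSeries.subst ((1 - u ^ 2) * A ^ 2) cosSqrt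

/-- `sin (A √(1-u²)) / √(1-u²)`, for `A` without constant term. -/
def sinA (A : PSeries) : PSeries := A * PowerSeries.subst ((1 - u ^ 2) * A ^ 2) sincSqrt

/-- `f(ε, u, A) = ε² (2u cos (A √(1-u²)) + (2u²-1) sin (A √(1-u²)) / √(1-u²)) - ∑ I_{2n-1} d^{2n}`. -/
def rhs (A : PSeries) : PSeries :=
  eps ^ 2 * (2 * u * cosA A + (2 * u ^ 2 - 1) * sinA A) - sepSeries

/-- `A` is a formal solution, with `ε = 2 sinh(d/2)`, of
`A(T⁺) / (cosh d + u sinh d) + A(T⁻) / (cosh d - u sinh d) - 2 A(u) = f(ε, u, A(u))`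
of the form `A = ∑_{n ≥ 1} A_{2n-1}(u) d^{2n}`, where `A_{2n-1}` is an odd polynomial of degree at
most `2n-1`. -/
structure IsFormalSolution (A : PSeries) : Prop where
  coeff_zero : PowerSeries.coeff 0 A = 0
  coeff_odd : ∀ n : ℕ, PowerSeries.coeff (2 * n + 1) A = 0
  natDegree_le : ∀ n : ℕ, 1 ≤ n → (PowerSeries.coeff (2 * n) A).natDegree ≤ 2 * n - 1
  odd : ∀ n : ℕ, (PowerSeries.coeff (2 * n) A).comp (-Polynomial.X) = -PowerSeries.coeff (2 * n) A
  equation : substU A (T 1) * inv (coshS 1 + u * sinhS 1)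
      + substU A (T (-1)) * inv (coshS 1 - u * sinhS 1) - 2 * A = rhs A

/-! ### The series `U`, `Q`, `Q₁`, and `F`, `G` -/

/-- The terms of the formal solution of order at most `6` in `d`. -/
def U : PSeries :=
  num (-1 / 4) * u * d ^ 2
    + (num (91 / 864) * u ^ 3 - num (47 / 576) * u) * d ^ 4
    + (num (-319 / 2880) * u ^ 5 + num (185 / 1152) * u ^ 3 - num (3703 / 69120) * u) * d ^ 6

/-- The series `Q(d, u)` in the factorization `F = Q G`. -/
def Q : PSeries :=
  1 + num (1 / 4) * (1 - u ^ 2) * d ^ 2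
    + (num (91 / 432) * u ^ 4 - num (13 / 48) * u ^ 2 + num (13 / 216)) * d ^ 4
    + (num (-319 / 960) * u ^ 6 + num (1079 / 1728) * u ^ 4 - num (937 / 2880) * u ^ 2
        + num (287 / 8640)) * d ^ 6

/-- The series `Q₁(d, u)`. -/
def Q₁ : PSeries :=
  (u ^ 2 - 1) * d ^ 2
    + num (1 / 4) * (1 - u ^ 4) * d ^ 4
    - num (5 / 48) * (1 - u ^ 2) * (num (4 / 9) * u ^ 4 + u ^ 2 + 1) * d ^ 6
    + (1 - u ^ 2) * (num (-367 / 2160) * u ^ 6 + num (185 / 432) * u ^ 4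
        - num (997 / 4320) * u ^ 2) * d ^ 8

/-- `F`, where `A = U + F`. -/
def F (A : PSeries) : PSeries := A - U

/-- `G`, where `F = Q G`. -/
def G (A : PSeries) : PSeries := F A * inv Q

theorem Q_mul_G (A : PSeries) : Q * G A = F A := by
  have h : PowerSeries.constantCoeff Q = 1 := by simp [Q, d]
  rw [G, mul_left_comm, mul_inv Q h, mul_one]

end DiscretePendulum

end

open Filter Asymptotics

noncomputable section

namespace DiscretePendulum

open Polynomial

open Finset.HasAntidiagonal (antidiagonal)


/-! ### Power series in `d D` acting on series -/

/-! Put D = (1 - u²) ∂/∂u. The substitution u ↦ T(θ) is the operator exp(θ d D) (`substU_T`), so 𝒮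
is sinh(d D / 2). Since D τ_i = i τ_{i+1}, powers of D are explicit in the basis τ_n, and the norms
are adapted to this: products are bounded up to a constant (`exists_tauNorm_mul_le`), division by 1
- u² is bounded (`tauNorm_le_of_mul`), and 𝒮 is inverted on series without τ_0-component by x / (2
sinh(x/2)), whose coefficients are O((2π)^{-k}) (`exists_nu_le_nu_S`). This inverse is the source of
the factor (2π)^{-n} and of the factorials.

Write A = U + F with F = Q G. Expanding the nonlinearity at U by the addition theorems and
multiplying the equation by d² μ (1 - u²) Q gives the identity `four_mul_S_mul_S_G`: 4 𝒮(Q₁ 𝒮(G)) is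
a sum of small multiples of G(T⁺), G(T⁻) and G, of an explicit series of geometric growth, and of
terms at least quadratic in F. The explicit polynomials are such that the linear defects vanish
below d^10 (`coeff_delta`, `coeff_lambda`) and the residual of U vanishes below d^9
(`coeff_residual`); the latter forces F to begin at d^8 (`d_pow_dvd_F`).

Divide by d, put g = G / d, and let e_n and g_n be the norms of 𝒮(Q₁ 𝒮(g)) and g scaled by (2π)^n;
they obey the inequalities `NormRecursion`. Two inversions of 𝒮 with a division by Q₁ in between
give g_n ≤ C (n+2)! ∑_{m ≤ n+4} m e_m / (m-1)! (`factorial_bound_of_two_inversions`). Conversely g_n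
= O((n+2)!) makes the defects of order 10 contribute O((n-8)!) to e_n, and the nonlinear terms no
more (`exists_nonlinear_le`). With e_m of size (m-8)! the sum converges, so the loop does not
amplify. To enter the loop, a bound α B^n (n+2)! with small α and large B is proved by induction; it
linearizes the quadratic terms, and a discrete Gronwall argument then halves the rate B
(`halve_bound`). Finitely many halvings reach rate 1, and one more use of the identity yields e_n =
O((n-8)!). -/

theorem sum_antidiagonal_assoc {M : Type*} [AddCommMonoid M] (f : ℕ → ℕ → ℕ → M) (n : ℕ) :
    ∑ x ∈ antidiagonal n, ∑ y ∈ antidiagonal x.1, f y.1 y.2 x.2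
      = ∑ x ∈ antidiagonal n, ∑ y ∈ antidiagonal x.2, f x.1 y.1 y.2 := by
  rw [Finset.sum_sigma', Finset.sum_sigma']
  refine Finset.sum_nbij' (fun ⟨(_, j), (k, l)⟩ => ⟨(k, l + j), (l, j)⟩)
    (fun ⟨(i, _), (k, l)⟩ => ⟨(i + k, l), (i, k)⟩) ?_ ?_ ?_ ?_ ?_
  all_goals
    rintro ⟨⟨i, j⟩, ⟨k, l⟩⟩ h
    simp only [Finset.mem_sigma, Finset.HasAntidiagonal.mem_antidiagonal] at h ⊢
  · refine ⟨?_, ?_⟩ <;> first | omega | simp_all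
  · refine ⟨?_, ?_⟩ <;> first | omega | simp_all
  · obtain ⟨h1, rfl⟩ := h
    rfl
  · obtain ⟨h1, rfl⟩ := h
    rfl

/-- `D` as a linear map. -/
def DL : ℂ[X] →ₗ[ℂ] ℂ[X] where
  toFun := D
  map_add' p q := by simp [D]; ring
  map_smul' c p := by simp [D]

theorem DL_apply (p : ℂ[X]) : DL p = D p := rfl

theorem D_mul (p q : ℂ[X]) : D (p * q) = D p * q + p * D q := by
  simp [D]; ring

/-- The operator `f(d D)` on series. -/
def op (f : PowerSeries ℂ) (Z : PSeries) : PSeries :=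
  PowerSeries.mk fun n => ∑ x ∈ antidiagonal n,
    PowerSeries.coeff x.1 f • (DL ^ x.1) (PowerSeries.coeff x.2 Z)

theorem coeff_op (f : PowerSeries ℂ) (Z : PSeries) (n : ℕ) :
    PowerSeries.coeff n (op f Z) = ∑ x ∈ antidiagonal n,
      PowerSeries.coeff x.1 f • (DL ^ x.1) (PowerSeries.coeff x.2 Z) := by
  simp [op]

theorem op_add (f : PowerSeries ℂ) (Y Z : PSeries) : op f (Y + Z) = op f Y + op f Z := by
  ext1 n
  simp [coeff_op, Finset.sum_add_distrib]

theorem op_sub (f : PowerSeries ℂ) (Y Z : PSeries) : op f (Y - Z) = op f Y - op f Z := by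
  ext1 n
  simp [coeff_op, smul_sub]

theorem sub_op (f g : PowerSeries ℂ) (Z : PSeries) : op (f - g) Z = op f Z - op g Z := by
  ext1 n
  simp [coeff_op, sub_smul]

theorem num_mul_op (c : ℂ) (f : PowerSeries ℂ) (Z : PSeries) :
    num c * op f Z = op (PowerSeries.C c * f) Z := by
  ext1 n
  simp [coeff_op, Finset.mul_sum, mul_smul, Polynomial.smul_eq_C_mul]

theorem op_mul (f g : PowerSeries ℂ) (Z : PSeries) : op (f * g) Z = op f (op g Z) := by
  ext1 n
  simp only [coeff_op, PowerSeries.coeff_mul, map_sum, Finset.sum_smul, Finset.smul_sum]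
  have h := sum_antidiagonal_assoc (fun i j k =>
    (PowerSeries.coeff i f * PowerSeries.coeff j g) • (DL ^ (i + j)) (PowerSeries.coeff k Z)) n
  refine Eq.trans ?_ (h.trans ?_)
  · refine Finset.sum_congr rfl fun x _ => Finset.sum_congr rfl fun y hy => ?_
    rw [Finset.HasAntidiagonal.mem_antidiagonal.mp hy]
  · refine Finset.sum_congr rfl fun x _ => Finset.sum_congr rfl fun y _ => ?_
    rw [map_smul, smul_smul, pow_add, Module.End.mul_apply]

theorem op_one (Z : PSeries) : op 1 Z = Z := by
  ext1 n
  rw [coeff_op, Finset.sum_eq_single (0, n)]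
  · simp
  · rintro ⟨a, b⟩ hab hne
    have ha : a ≠ 0 := by
      rintro rfl
      simp at hab
      simp [hab] at hne
    simp [PowerSeries.coeff_one, ha]
  · simp

theorem coeff_d_mul (Z : PSeries) (n : ℕ) :
    PowerSeries.coeff (n + 1) (d * Z) = PowerSeries.coeff n Z := by
  rw [d, PowerSeries.coeff_succ_X_mul]

theorem coeff_zero_d_mul (Z : PSeries) : PowerSeries.coeff 0 (d * Z) = 0 := by
  simp [d]

theorem op_d_mul (f : PowerSeries ℂ) (Z : PSeries) : op f (d * Z) = d * op f Z := by
  ext1 n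
  cases n with
  | zero => simp [coeff_op, coeff_zero_d_mul]
  | succ n =>
    rw [coeff_d_mul, coeff_op, coeff_op, Finset.Nat.sum_antidiagonal_succ']
    simp only [coeff_d_mul, coeff_zero_d_mul]
    simp

theorem coeff_op_X_mul (f : PowerSeries ℂ) (Z : PSeries) (n : ℕ) :
    PowerSeries.coeff (n + 1) (op (PowerSeries.X * f) Z) = D (PowerSeries.coeff n (op f Z)) := by
  rw [← DL_apply, coeff_op, coeff_op, Finset.Nat.sum_antidiagonal_succ, map_sum]
  simp [PowerSeries.coeff_succ_X_mul, pow_succ']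

/-! ### The derivative with respect to `d` -/

/-- The derivative with respect to `d`. -/
def der (Z : PSeries) : PSeries := PowerSeries.derivative ℂ[X] Z

theorem coeff_der (Z : PSeries) (n : ℕ) :
    PowerSeries.coeff n (der Z) = PowerSeries.coeff (n + 1) Z * ((n : ℂ[X]) + 1) :=
  PowerSeries.coeff_derivative Z n

theorem der_add (Y Z : PSeries) : der (Y + Z) = der Y + der Z := by
  ext1 n
  simp [coeff_der, add_mul]

theorem der_sub (Y Z : PSeries) : der (Y - Z) = der Y - der Z := by
  ext1 n
  simp [coeff_der, sub_mul]

theorem derivative_mul_aux {R : Type*} [CommRing R] (f g : PowerSeries R) :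
    PowerSeries.derivative R (f * g)
      = f * PowerSeries.derivative R g + g * PowerSeries.derivative R f := by
  rw [Derivation.leibniz, smul_eq_mul, smul_eq_mul]

theorem der_mul (Y Z : PSeries) : der (Y * Z) = Y * der Z + Z * der Y :=
  derivative_mul_aux Y Z

theorem der_C (p : ℂ[X]) : der (pol p) = 0 := PowerSeries.derivative_C

theorem der_one : der 1 = 0 := by
  rw [← map_one (PowerSeries.C (R := ℂ[X])), der_C]

theorem der_pow (Z : PSeries) (n : ℕ) : der (Z ^ n) = n * Z ^ (n - 1) * der Z := by
  induction n with
  | zero => simp [der_one]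
  | succ n ih =>
    rw [pow_succ, der_mul, ih]
    cases n with
    | zero => simp
    | succ n =>
      simp only [Nat.add_sub_cancel]
      push_cast
      ring

/-! ### The substitution `u ↦ T(θ)` -/

/-- The exponential series of `θ x` over `ℂ`. -/
def ex (θ : ℂ) : PowerSeries ℂ := PowerSeries.rescale θ (PowerSeries.exp ℂ)

theorem coeff_ex (θ : ℂ) (n : ℕ) : PowerSeries.coeff n (ex θ) = θ ^ n / n.factorial := by
  simp [ex, PowerSeries.coeff_rescale, PowerSeries.coeff_exp, div_eq_mul_inv]

theorem ex_mul (a b : ℂ) : ex a * ex b = ex (a + b) := PowerSeries.exp_mul_exp_eq_exp_add a b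

theorem ex_zero : ex 0 = 1 := by
  ext n
  rw [coeff_ex, PowerSeries.coeff_one]
  cases n <;> simp

theorem expS_eq (θ : ℂ) : expS θ = PowerSeries.map Polynomial.C (ex θ) := rfl

theorem expS_mul (a b : ℂ) : expS a * expS b = expS (a + b) := by
  rw [expS_eq, expS_eq, expS_eq, ← map_mul, ex_mul]

theorem expS_zero : expS 0 = 1 := by rw [expS_eq, ex_zero, map_one]

theorem derivative_expS (θ : ℂ) : der (expS θ) = num θ * expS θ := by
  ext1 n
  rw [coeff_der, expS_eq, PowerSeries.coeff_C_mul, PowerSeries.coeff_map,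
    PowerSeries.coeff_map, coeff_ex, coeff_ex, ← Polynomial.C_mul]
  have : ((n : ℂ[X]) + 1) = Polynomial.C ((n : ℂ) + 1) := by simp
  rw [this, ← Polynomial.C_mul]
  congr 1
  rw [Nat.factorial_succ]
  push_cast
  have h1 : ((n : ℂ) + 1) ≠ 0 := by exact_mod_cast Nat.succ_ne_zero n
  have h2 : (n.factorial : ℂ) ≠ 0 := by exact_mod_cast n.factorial_ne_zero
  field_simp
  ring

theorem constantCoeff_expS (θ : ℂ) : PowerSeries.constantCoeff (expS θ) = 1 := by
  rw [← PowerSeries.coeff_zero_eq_constantCoeff_apply, expS_eq, PowerSeries.coeff_map, coeff_ex]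
  simp

theorem constantCoeff_coshS (θ : ℂ) : PowerSeries.constantCoeff (coshS θ) = 1 := by
  rw [coshS, map_mul, map_add, constantCoeff_expS, constantCoeff_expS, PowerSeries.constantCoeff_C]
  rw [show (1 : ℂ[X]) + 1 = Polynomial.C 2 by rw [map_ofNat]; norm_num, ← Polynomial.C_mul]
  norm_num

theorem constantCoeff_sinhS (θ : ℂ) : PowerSeries.constantCoeff (sinhS θ) = 0 := by
  rw [sinhS, map_mul, map_sub, constantCoeff_expS, constantCoeff_expS]
  simp

theorem num_add (a b : ℂ) : num a + num b = num (a + b) := by simp [num, pol]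
theorem num_mul (a b : ℂ) : num a * num b = num (a * b) := by simp [num, pol]
theorem num_one : num 1 = 1 := by simp [num, pol]
theorem num_neg (a : ℂ) : num (-a) = -num a := by simp [num, pol]

theorem two_mul_num_half : 2 * num (1 / 2) = 1 := by
  rw [two_mul, num_add, ← num_one]; norm_num

theorem derivative_coshS (θ : ℂ) : der (coshS θ) = num θ * sinhS θ := by
  rw [coshS, sinhS, der_mul, der_add, derivative_expS, derivative_expS]
  simp only [der_C, num_neg]
  ring

theorem derivative_sinhS (θ : ℂ) : der (sinhS θ) = num θ * coshS θ := by
  rw [coshS, sinhS, der_mul, der_sub, derivative_expS, derivative_expS]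
  simp only [der_C, num_neg]
  ring

theorem cosh_add_sinh (θ : ℂ) : coshS θ + sinhS θ = expS θ := by
  rw [coshS, sinhS]
  linear_combination (expS θ) * two_mul_num_half

theorem cosh_sub_sinh (θ : ℂ) : coshS θ - sinhS θ = expS (-θ) := by
  rw [coshS, sinhS]
  linear_combination (expS (-θ)) * two_mul_num_half

theorem cosh_sq_sub_sinh_sq (θ : ℂ) : coshS θ ^ 2 - sinhS θ ^ 2 = 1 := by
  have h : coshS θ ^ 2 - sinhS θ ^ 2 = (coshS θ + sinhS θ) * (coshS θ - sinhS θ) := by ring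
  rw [h, cosh_add_sinh, cosh_sub_sinh, expS_mul, add_neg_cancel, expS_zero]

/-- `cosh(θ d) + u sinh(θ d)`. -/
def den (θ : ℂ) : PSeries := coshS θ + u * sinhS θ

theorem constantCoeff_den (θ : ℂ) : PowerSeries.constantCoeff (den θ) = 1 := by
  simp [den, constantCoeff_coshS, constantCoeff_sinhS]

theorem den_mul_inv (θ : ℂ) : den θ * inv (den θ) = 1 := mul_inv _ (constantCoeff_den θ)

/-- `T(θ) (cosh(θ d) + u sinh(θ d)) = u cosh(θ d) + sinh(θ d)`. -/
theorem T_mul_den (θ : ℂ) : T θ * den θ = u * coshS θ + sinhS θ := by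
  have h1 : coshS θ * inv (coshS θ) = 1 := mul_inv _ (constantCoeff_coshS θ)
  have h2 : (1 + u * tanhS θ) * inv (1 + u * tanhS θ) = 1 :=
    mul_inv _ (by simp [tanhS, constantCoeff_sinhS])
  have h3 : den θ = coshS θ * (1 + u * tanhS θ) := by
    rw [den, tanhS]; linear_combination (-u * sinhS θ) * h1
  have h4 : coshS θ * tanhS θ = sinhS θ := by
    rw [tanhS]; linear_combination (sinhS θ) * h1
  rw [h3, T]
  linear_combination (coshS θ * (u + tanhS θ)) * h2 + h4

theorem constantCoeff_T (θ : ℂ) : PowerSeries.constantCoeff (T θ) = Polynomial.X := by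
  have h := congrArg PowerSeries.constantCoeff (T_mul_den θ)
  simpa [constantCoeff_den, constantCoeff_coshS, constantCoeff_sinhS, u] using h

theorem derivative_u : der u = 0 := der_C _

theorem derivative_den (θ : ℂ) :
    der (den θ) = num θ * (sinhS θ + u * coshS θ) := by
  rw [den, der_add, der_mul, derivative_coshS, derivative_sinhS, derivative_u]
  ring

/-- The Riccati equation satisfied by `T(θ)`. -/
theorem derivative_T (θ : ℂ) : der (T θ) = num θ * (1 - T θ ^ 2) := by
  have h := congrArg (der) (T_mul_den θ)
  rw [der_add, der_mul, der_mul, derivative_den, derivative_coshS,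
    derivative_sinhS, derivative_u] at h
  have hT := T_mul_den θ
  have hd : den θ = coshS θ + u * sinhS θ := rfl
  linear_combination (inv (den θ)) * h - (der (T θ)) * den_mul_inv θ +
    (num θ * (1 - T θ ^ 2)) * den_mul_inv θ + inv (den θ) * num θ * T θ * hT
      - inv (den θ) * num θ * hd

/-- Taylor's formula. By the Riccati equation the d-derivative of p(T(θ)) is θ (D p)(T(θ));
iterating and setting d = 0, where T(θ) = u, produces θ^k D^k p / k!. -/
theorem coeff_aeval_T (θ : ℂ) (k : ℕ) (p : ℂ[X]) :
    PowerSeries.coeff k (Polynomial.aeval (T θ) p)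
      = PowerSeries.coeff k (ex θ) • (DL ^ k) p := by
  have hder : ∀ p : ℂ[X], der (Polynomial.aeval (T θ) p)
      = num θ * Polynomial.aeval (T θ) (D p) := by
    intro p
    induction p using Polynomial.induction_on' with
    | add p q hp hq =>
      rw [map_add, der_add, hp, hq, ← DL_apply, ← DL_apply, ← DL_apply, map_add, map_add]
      ring
    | monomial n a =>
      rw [← Polynomial.C_mul_X_pow_eq_monomial, map_mul, map_pow, Polynomial.aeval_C,
        Polynomial.aeval_X, der_mul, der_pow, derivative_T]
      have : (algebraMap ℂ PSeries) a = num a := by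
        rw [PowerSeries.algebraMap_apply]; rfl
      rw [this]
      simp only [der_C, D, map_mul, map_sub, map_one, map_pow, Polynomial.aeval_X,
        Polynomial.derivative_mul, Polynomial.derivative_C, Polynomial.derivative_X_pow,
        Polynomial.aeval_C, this, map_natCast, zero_mul, zero_add]
      ring
  induction k generalizing p with
  | zero =>
    have h0 : PowerSeries.constantCoeff (Polynomial.aeval (T θ) p) = p := by
      induction p using Polynomial.induction_on' with
      | add p q hp hq => rw [map_add, map_add, hp, hq]
      | monomial n a =>
        rw [← Polynomial.C_mul_X_pow_eq_monomial, map_mul, map_pow, Polynomial.aeval_C,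
          Polynomial.aeval_X, map_mul, map_pow, constantCoeff_T]
        rfl
    rw [PowerSeries.coeff_zero_eq_constantCoeff_apply, h0, coeff_ex]
    simp
  | succ k ih =>
    have h := congrArg (PowerSeries.coeff k) (hder p)
    rw [coeff_der, PowerSeries.coeff_C_mul, ih] at h
    have h1 : ((k : ℂ) + 1) ≠ 0 := by exact_mod_cast Nat.succ_ne_zero k
    have h2 : (k.factorial : ℂ) ≠ 0 := by exact_mod_cast k.factorial_ne_zero
    have h3 : ((k : ℂ[X]) + 1) = Polynomial.C ((k : ℂ) + 1) := by simp
    rw [h3, mul_comm, ← Polynomial.smul_eq_C_mul, ← Polynomial.smul_eq_C_mul, smul_smul] at h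
    rw [← inv_smul_smul₀ h1 (PowerSeries.coeff (k + 1) _), h, smul_smul, coeff_ex, coeff_ex,
      pow_succ DL, Module.End.mul_apply, DL_apply, Nat.factorial_succ]
    congr 1
    push_cast
    field_simp
    ring

/-- Turns each shift into a power series in d D, so that shifts compose and are inverted by
multiplying scalar power series. -/
theorem substU_T (Z : PSeries) (θ : ℂ) : substU Z (T θ) = op (ex θ) Z := by
  ext1 n
  rw [coeff_op, substU, PowerSeries.coeff_mk, ← Finset.Nat.sum_antidiagonal_swap]
  exact Finset.sum_congr rfl fun x _ => coeff_aeval_T θ x.1 _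

/-- A shift is multiplicative because p ↦ p(T(θ)) is a ring homomorphism; the rest regroups the four
summation indices. -/
theorem op_ex_mul (θ : ℂ) (Y Z : PSeries) : op (ex θ) (Y * Z) = op (ex θ) Y * op (ex θ) Z := by
  ext1 n
  have e1 : ∀ W : PSeries, ∀ n, PowerSeries.coeff n (op (ex θ) W) = ∑ x ∈ antidiagonal n,
      PowerSeries.coeff x.1 (Polynomial.aeval (T θ) (PowerSeries.coeff x.2 W)) := by
    intro W n
    rw [coeff_op]
    exact Finset.sum_congr rfl fun x _ => (coeff_aeval_T θ x.1 _).symm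
  rw [PowerSeries.coeff_mul]
  simp only [e1, PowerSeries.coeff_mul, map_sum, map_mul, Finset.sum_mul_sum]
  simp only [Finset.sum_sigma']
  refine Finset.sum_nbij'
    (fun ⟨(_, _), ⟨(c, e), (i, j)⟩⟩ => ⟨(i + c, j + e), ⟨(i, c), (j, e)⟩⟩)
    (fun ⟨(_, _), ⟨(i, c), (j, e)⟩⟩ => ⟨(i + j, c + e), ⟨(c, e), (i, j)⟩⟩) ?_ ?_ ?_ ?_ ?_
  all_goals
    rintro ⟨⟨a, b⟩, ⟨⟨i, j⟩, ⟨k, l⟩⟩⟩ h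
    simp only [Finset.mem_sigma, Finset.HasAntidiagonal.mem_antidiagonal] at h ⊢
  · refine ⟨?_, ?_, ?_⟩ <;> first | omega | simp_all
  · refine ⟨?_, ?_, ?_⟩ <;> first | omega | simp_all
  · obtain ⟨h1, rfl, rfl⟩ := h
    rfl
  · obtain ⟨h1, rfl, rfl⟩ := h
    rfl

/-- The operator form sinh(d D / 2) of 𝒮. -/
theorem S_eq (Z : PSeries) :
    S Z = op (PowerSeries.C (1 / 2) * (ex (1 / 2) - ex (-(1 / 2)))) Z := by
  rw [S, substU_T, substU_T, ← sub_op, num_mul_op]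

/-! ### Coordinates in the basis `τ_n` -/

theorem tauBasis_apply (i : ℕ) : tauBasis i = tau i :=
  Polynomial.Sequence.basis_eq_self tauSeq isUnit_leadingCoeff_tauSeq i

theorem repr_tau (i : ℕ) : tauBasis.repr (tau i) = Finsupp.single i 1 := by
  rw [← tauBasis_apply, Module.Basis.repr_self]

theorem natDegree_tau (i : ℕ) : (tau i).natDegree = i :=
  natDegree_eq_of_degree_eq_some (degree_tau i)

theorem repr_eq_zero_of_natDegree_lt {p : ℂ[X]} {n : ℕ} (hp : p.natDegree ≤ n) {i : ℕ}
    (hi : n < i) : tauBasis.repr p i = 0 := by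
  have h : p ∈ Polynomial.degreeLE ℂ n :=
    Polynomial.mem_degreeLE.mpr (Polynomial.natDegree_le_iff_degree_le.mp hp)
  rw [← Polynomial.Sequence.span_degreeLE tauSeq fun i _ => isUnit_leadingCoeff_tauSeq i] at h
  clear hp
  induction h using Submodule.span_induction with
  | mem x hx =>
    obtain ⟨j, hj, rfl⟩ := hx
    have : j ≠ i := by
      have : j ≤ n := hj
      omega
    change tauBasis.repr (tau j) i = 0
    rw [repr_tau, Finsupp.single_eq_of_ne this.symm]
  | zero => simp
  | add x y _ _ hx hy => simp_all
  | smul a x _ hx => simp_all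

theorem eq_sum_repr {p : ℂ[X]} {n : ℕ} (hp : p.natDegree ≤ n) :
    p = ∑ i ∈ Finset.range (n + 1), tauBasis.repr p i • tau i := by
  conv_lhs => rw [← tauBasis.linearCombination_repr p]
  rw [Finsupp.linearCombination_apply, Finsupp.sum_of_support_subset (s := Finset.range (n + 1))]
  · exact Finset.sum_congr rfl fun i _ => by rw [tauBasis_apply]
  · intro i hi
    by_contra h
    rw [Finsupp.mem_support_iff] at hi
    exact hi (repr_eq_zero_of_natDegree_lt hp (by simpa using h))
  · simp

theorem D_tau (i : ℕ) : D (tau i) = (i : ℂ) • tau (i + 1) := by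
  cases i with
  | zero => simp [tau, D]
  | succ i =>
    have h : ((i : ℂ) + 1) ≠ 0 := by exact_mod_cast Nat.succ_ne_zero i
    rw [tau, Polynomial.smul_eq_C_mul, ← mul_assoc, ← Polynomial.C_mul]
    push_cast
    rw [mul_one_div_cancel h, Polynomial.C_1, one_mul]

theorem repr_D_succ (p : ℂ[X]) (i : ℕ) :
    tauBasis.repr (DL p) (i + 1) = i * tauBasis.repr p i := by
  have h : (Finsupp.lapply (i + 1) ∘ₗ tauBasis.repr.toLinearMap ∘ₗ DL : ℂ[X] →ₗ[ℂ] ℂ)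
      = (i : ℂ) • (Finsupp.lapply i ∘ₗ tauBasis.repr.toLinearMap) := by
    refine tauBasis.ext fun j => ?_
    simp only [LinearMap.comp_apply, LinearMap.smul_apply, LinearEquiv.coe_coe,
      Finsupp.lapply_apply, tauBasis_apply, DL_apply, D_tau, map_smul, repr_tau]
    by_cases hij : i = j
    · subst hij
      simp
    · simp [Ne.symm hij]
  exact congrArg (fun f => f p) h

theorem repr_D_zero (p : ℂ[X]) : tauBasis.repr (DL p) 0 = 0 := by
  have h : (Finsupp.lapply 0 ∘ₗ tauBasis.repr.toLinearMap ∘ₗ DL : ℂ[X] →ₗ[ℂ] ℂ) = 0 := by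
    refine tauBasis.ext fun j => ?_
    simp [tauBasis_apply, DL_apply, D_tau, map_smul, repr_tau]
  exact congrArg (fun f => f p) h

/-- Iterates D τ_i = i τ_{i+1}. Here `i.ascFactorial k` is i (i+1) ⋯ (i+k-1), starting at i itself,
so it vanishes for i = 0 < k. -/
theorem repr_DL_pow_add (p : ℂ[X]) (k i : ℕ) :
    tauBasis.repr ((DL ^ k) p) (i + k) = (i.ascFactorial k : ℂ) * tauBasis.repr p i := by
  induction k with
  | zero => simp
  | succ k ih =>
    rw [pow_succ', Module.End.mul_apply, ← add_assoc, repr_D_succ, ih, Nat.ascFactorial_succ]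
    push_cast
    ring

theorem repr_DL_pow_lt (p : ℂ[X]) (k i : ℕ) (h : i < k) :
    tauBasis.repr ((DL ^ k) p) i = 0 := by
  induction k generalizing i with
  | zero => omega
  | succ k ih =>
    rw [pow_succ', Module.End.mul_apply]
    cases i with
    | zero => rw [repr_D_zero]
    | succ i => rw [repr_D_succ, ih i (by omega), mul_zero]

theorem natDegree_D_le {p : ℂ[X]} {n : ℕ} (hp : p.natDegree ≤ n) : (D p).natDegree ≤ n + 1 := by
  rw [eq_sum_repr hp, ← DL_apply, map_sum]
  refine Polynomial.natDegree_sum_le_of_forall_le _ _ fun i hi => ?_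
  rw [map_smul, DL_apply, D_tau]
  refine (Polynomial.natDegree_smul_le _ _).trans ((Polynomial.natDegree_smul_le _ _).trans ?_)
  rw [natDegree_tau]
  simp at hi
  omega

theorem natDegree_DL_pow_le {p : ℂ[X]} {n : ℕ} (hp : p.natDegree ≤ n) (k : ℕ) :
    ((DL ^ k) p).natDegree ≤ n + k := by
  induction k with
  | zero => simpa
  | succ k ih =>
    rw [pow_succ', Module.End.mul_apply, DL_apply]
    exact natDegree_D_le ih

/-! ### The norms -/

theorem tauNorm_nonneg (n : ℕ) (p : ℂ[X]) : 0 ≤ tauNorm n p :=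
  Finset.sum_nonneg fun _ _ => by positivity

theorem tauNorm_zero (n : ℕ) : tauNorm n 0 = 0 := by simp [tauNorm]

theorem tauNorm_add_le (n : ℕ) (p q : ℂ[X]) : tauNorm n (p + q) ≤ tauNorm n p + tauNorm n q := by
  rw [tauNorm, tauNorm, tauNorm, ← Finset.sum_add_distrib]
  refine Finset.sum_le_sum fun i _ => ?_
  rw [← add_mul, map_add, Finsupp.add_apply]
  gcongr
  exact norm_add_le _ _

theorem tauNorm_smul (n : ℕ) (c : ℂ) (p : ℂ[X]) : tauNorm n (c • p) = ‖c‖ * tauNorm n p := by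
  rw [tauNorm, tauNorm, Finset.mul_sum]
  refine Finset.sum_congr rfl fun i _ => ?_
  simp [mul_assoc]

theorem tauNorm_neg (n : ℕ) (p : ℂ[X]) : tauNorm n (-p) = tauNorm n p := by
  rw [← neg_one_smul ℂ p, tauNorm_smul]; simp

theorem tauNorm_sum_le {ι : Type*} (n : ℕ) (s : Finset ι) (f : ι → ℂ[X]) :
    tauNorm n (∑ i ∈ s, f i) ≤ ∑ i ∈ s, tauNorm n (f i) :=
  Finset.le_sum_of_subadditive (tauNorm n) (tauNorm_zero n).le (tauNorm_add_le n) s f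

theorem tauNorm_tau {i n : ℕ} (h : i ≤ n) : tauNorm n (tau i) = (Real.pi / 2) ^ (n - i) := by
  rw [tauNorm, Finset.sum_eq_single i]
  · simp [repr_tau]
  · intro j _ hj
    simp [repr_tau, hj.symm]
  · intro hi
    simp at hi
    omega

theorem tauNorm_add_index {p : ℂ[X]} {n : ℕ} (hp : p.natDegree ≤ n) (k : ℕ) :
    tauNorm (n + k) p = (Real.pi / 2) ^ k * tauNorm n p := by
  rw [tauNorm, tauNorm, Finset.mul_sum]
  symm
  refine Finset.sum_subset_zero_on_sdiff (by intro x; simp; omega) ?_ ?_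
  · intro i hi
    simp at hi
    rw [repr_eq_zero_of_natDegree_lt hp (by omega)]
    simp
  · intro i hi
    simp at hi
    rw [show n + k - i = k + (n - i) by omega, pow_add]
    ring

/-- A linear map that is bounded on the basis is bounded. -/
theorem tauNorm_map_le (Φ : ℂ[X] →ₗ[ℂ] ℂ[X]) {m n : ℕ} {K : ℝ}
    (h : ∀ i ≤ n, tauNorm m (Φ (tau i)) ≤ K * (Real.pi / 2) ^ (n - i)) {p : ℂ[X]}
    (hp : p.natDegree ≤ n) : tauNorm m (Φ p) ≤ K * tauNorm n p := by
  conv_lhs => rw [eq_sum_repr hp]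
  rw [map_sum, show tauNorm n p = ∑ i ∈ Finset.range (n + 1),
    ‖tauBasis.repr p i‖ * (Real.pi / 2) ^ (n - i) from rfl, Finset.mul_sum]
  refine (tauNorm_sum_le _ _ _).trans (Finset.sum_le_sum fun i hi => ?_)
  rw [map_smul, tauNorm_smul]
  simp at hi
  calc _ ≤ ‖tauBasis.repr p i‖ * (K * (Real.pi / 2) ^ (n - i)) := by
        gcongr
        exact h i (by omega)
    _ = _ := by ring

/-- Bilinearity: `tauNorm_map_le` is applied in one factor and then in the other, which leaves only
products of basis elements to estimate. -/
theorem tauNorm_mul_le_of_tau {K : ℝ}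
    (h : ∀ i j, tauNorm (i + j) (tau i * tau j) ≤ K) {p q : ℂ[X]} {m n : ℕ}
    (hp : p.natDegree ≤ m) (hq : q.natDegree ≤ n) :
    tauNorm (m + n) (p * q) ≤ K * tauNorm m p * tauNorm n q := by
  have h2 : tauNorm (m + n) (LinearMap.mulRight ℂ q p) ≤ (K * tauNorm n q) * tauNorm m p := by
    refine tauNorm_map_le _ (fun i hi => ?_) hp
    have h3 : tauNorm (m + n) (LinearMap.mulLeft ℂ (tau i) q)
        ≤ (K * (Real.pi / 2) ^ (m - i)) * tauNorm n q := by
      refine tauNorm_map_le _ (fun j hj => ?_) hq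
      have hd : (tau i * tau j).natDegree ≤ i + j :=
        Polynomial.natDegree_mul_le.trans (by rw [natDegree_tau, natDegree_tau])
      have h4 := tauNorm_add_index hd (m - i + (n - j))
      rw [show i + j + (m - i + (n - j)) = m + n by omega] at h4
      rw [LinearMap.mulLeft_apply, h4, pow_add, mul_assoc]
      calc _ ≤ (Real.pi / 2) ^ (m - i) * ((Real.pi / 2) ^ (n - j) * K) := by
            gcongr
            exact h i j
        _ = _ := by ring
    rw [LinearMap.mulRight_apply]
    rw [LinearMap.mulLeft_apply] at h3
    linarith
  rw [LinearMap.mulRight_apply] at h2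
  linarith

theorem ascFactorial_mono (k : ℕ) {i n : ℕ} (h : i ≤ n) :
    i.ascFactorial k ≤ n.ascFactorial k := by
  induction k with
  | zero => simp
  | succ k ih =>
    rw [Nat.ascFactorial_succ, Nat.ascFactorial_succ]
    gcongr

/-- Both the degree index and the basis index move by k, so the weights (π/2)^{n-i} are unchanged
and the largest factor is the one at i = n. -/
theorem tauNorm_DL_pow_le (p : ℂ[X]) (n k : ℕ) :
    tauNorm (n + k) ((DL ^ k) p) ≤ n.ascFactorial k * tauNorm n p := by
  rw [tauNorm, tauNorm, Finset.mul_sum, show n + k + 1 = k + (n + 1) by ring,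
    Finset.sum_range_add, Finset.sum_eq_zero, zero_add]
  · refine Finset.sum_le_sum fun i hi => ?_
    rw [add_comm k i, repr_DL_pow_add, norm_mul, show n + k - (i + k) = n - i by omega,
      Complex.norm_natCast, mul_assoc]
    have : i.ascFactorial k ≤ n.ascFactorial k := ascFactorial_mono k (by simp at hi; omega)
    gcongr
  · intro i hi
    rw [repr_DL_pow_lt p k i (by simpa using hi)]
    simp

/-! ### Bernoulli numbers -/

/-- For even k ≥ 2 this is Euler's formula for ζ(k) together with ζ(k) ≤ ζ(2); among the odd indices
only k = 1 contributes. -/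
theorem bernoulli_div_factorial_le :
    ∃ K : ℝ, 0 < K ∧ ∀ k : ℕ, |(_root_.bernoulli k : ℝ) / k.factorial| ≤ K * ((2 * Real.pi) ^ k)⁻¹ := by
  have hpi := Real.pi_pos
  set Z : ℝ := ∑' n : ℕ, 1 / (n : ℝ) ^ 2 with hZ
  have hs : Summable fun n : ℕ => 1 / (n : ℝ) ^ 2 := Real.summable_one_div_nat_pow.mpr (by norm_num)
  have hZ0 : 0 ≤ Z := tsum_nonneg fun n => by positivity
  -- The summand 2 Z serves the even k ≥ 2, the summand 1 serves k = 0, and π serves k = 1, where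
  -- |B_1| · 2π = π.
  refine ⟨2 * Z + 1 + Real.pi, by positivity, fun k => ?_⟩
  have hpow : (0 : ℝ) < (2 * Real.pi) ^ k := by positivity
  rw [← div_eq_mul_inv, le_div_iff₀ hpow]
  rcases Nat.even_or_odd k with he | ho
  · obtain ⟨j, rfl⟩ := he
    rw [← two_mul]
    rcases Nat.eq_zero_or_pos j with rfl | hj
    · simp
      linarith
    · have h := hasSum_zeta_nat hj.ne'
      have hle : (∑' n : ℕ, 1 / (n : ℝ) ^ (2 * j)) ≤ Z := by
        refine Summable.tsum_le_tsum (fun n => ?_) h.summable hs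
        rcases Nat.eq_zero_or_pos n with rfl | hn
        · simp [hj.ne']
        · have hn1 : (1 : ℝ) ≤ n := by exact_mod_cast hn
          exact one_div_le_one_div_of_le (by positivity) (pow_le_pow_right₀ hn1 (by omega))
      have h0 : 0 ≤ ∑' n : ℕ, 1 / (n : ℝ) ^ (2 * j) := tsum_nonneg fun n => by positivity
      have habs := abs_of_nonneg h0
      rw [h.tsum_eq] at hle habs
      rw [← habs] at hle
      have h2 : (2 : ℝ) ^ (2 * j) = 2 * 2 ^ (2 * j - 1) := by
        rw [← pow_succ']
        congr 1
        omega
      have e : |(-1 : ℝ) ^ (j + 1) * 2 ^ (2 * j - 1) * Real.pi ^ (2 * j) * (_root_.bernoulli (2 * j) : ℝ)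
          / (2 * j).factorial| = 2 ^ (2 * j - 1) * Real.pi ^ (2 * j)
            * |(_root_.bernoulli (2 * j) : ℝ) / (2 * j).factorial| := by
        rw [mul_div_assoc, abs_mul, abs_mul, abs_mul, abs_pow, abs_neg, abs_one, one_pow, one_mul,
          abs_of_nonneg (a := (2 : ℝ) ^ (2 * j - 1)) (by positivity),
          abs_of_nonneg (a := Real.pi ^ (2 * j)) (by positivity)]
      rw [e] at hle
      rw [mul_pow, h2]
      nlinarith
  · rcases eq_or_ne k 1 with rfl | hk
    · rw [_root_.bernoulli_one]
      norm_num
      linarith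
    · rw [bernoulli_eq_zero_of_odd ho (by have := ho.pos; omega)]
      simp
      positivity

/-- The exponential generating series of the Bernoulli numbers, `x / (exp x - 1)`. -/
def bern : PowerSeries ℂ := bernoulliPowerSeries ℂ

theorem bern_mul : bern * (ex 1 - 1) = PowerSeries.X := by
  have : ex 1 = PowerSeries.exp ℂ := by simp [ex]
  rw [this]
  exact bernoulliPowerSeries_mul_exp_sub_one ℂ

theorem norm_coeff_bern_le :
    ∃ K : ℝ, 0 < K ∧ ∀ k : ℕ, ‖PowerSeries.coeff k bern‖ ≤ K * ((2 * Real.pi) ^ k)⁻¹ := by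
  obtain ⟨K, hK, h⟩ := bernoulli_div_factorial_le
  refine ⟨K, hK, fun k => ?_⟩
  refine le_trans (le_of_eq ?_) (h k)
  rw [bern, bernoulliPowerSeries, PowerSeries.coeff_mk]
  have : (algebraMap ℚ ℂ) (_root_.bernoulli k / k.factorial)
      = (((_root_.bernoulli k : ℝ) / k.factorial : ℝ) : ℂ) := by
    push_cast
    simp
  rw [this, Complex.norm_real, Real.norm_eq_abs]

/-- The series `t coth t`. -/
def chi : PowerSeries ℂ := PowerSeries.X + PowerSeries.rescale 2 bern

theorem rescale_X (c : ℂ) :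
    PowerSeries.rescale c (PowerSeries.X : PowerSeries ℂ) = PowerSeries.C c * PowerSeries.X := by
  ext n
  rw [PowerSeries.coeff_rescale, PowerSeries.coeff_C_mul, PowerSeries.coeff_X]
  split_ifs with h <;> simp [h]

theorem rescale_ex (c a : ℂ) : PowerSeries.rescale c (ex a) = ex (c * a) := by
  ext n
  rw [PowerSeries.coeff_rescale, coeff_ex, coeff_ex, mul_pow, mul_div_assoc]

/-- Uses t coth t = t + 2t / (e^{2t} - 1); the rescaling by 2 turns the decay (2π)^{-k} of the
Bernoulli coefficients into π^{-k}. -/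
theorem chi_mul_sinh : chi * (ex 1 - ex (-1)) = PowerSeries.X * (ex 1 + ex (-1)) := by
  have h := congrArg (PowerSeries.rescale (2 : ℂ)) bern_mul
  rw [map_mul, map_sub, rescale_ex, rescale_X, map_one] at h
  have h1 : ex 1 * ex (-1) = 1 := by rw [ex_mul, add_neg_cancel, ex_zero]
  have h2 : ex (2 * 1) = ex 1 * ex 1 := by rw [ex_mul]; norm_num
  rw [h2, map_ofNat] at h
  rw [chi]
  linear_combination ex (-1) * h + (PowerSeries.rescale 2 bern) * (- ex 1) * h1

theorem norm_coeff_chi_le :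
    ∃ K : ℝ, 0 < K ∧ ∀ k : ℕ, ‖PowerSeries.coeff k chi‖ ≤ K * (Real.pi ^ k)⁻¹ := by
  obtain ⟨K, hK, h⟩ := norm_coeff_bern_le
  have hpi := Real.pi_pos
  refine ⟨K + Real.pi, by positivity, fun k => ?_⟩
  rw [chi, map_add, PowerSeries.coeff_rescale, add_mul, add_comm]
  refine (norm_add_le _ _).trans (add_le_add ?_ ?_)
  · rw [norm_mul, norm_pow, Complex.norm_ofNat]
    calc _ ≤ (2 : ℝ) ^ k * (K * ((2 * Real.pi) ^ k)⁻¹) := by gcongr; exact h k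
      _ = _ := by rw [mul_pow]; field_simp
  · rw [PowerSeries.coeff_X]
    split_ifs with hk
    · subst hk
      rw [norm_one, pow_one, mul_inv_cancel₀ hpi.ne']
    · rw [norm_zero]; positivity

theorem coeff_chi_odd (m : ℕ) : PowerSeries.coeff (2 * m + 1) chi = 0 := by
  rw [chi, map_add, PowerSeries.coeff_rescale, bern, bernoulliPowerSeries, PowerSeries.coeff_mk,
    PowerSeries.coeff_X]
  rcases Nat.eq_zero_or_pos m with rfl | hm
  · norm_num [_root_.bernoulli_one]
  · rw [bernoulli_eq_zero_of_odd ⟨m, rfl⟩ (by omega)]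
    simp
    omega

theorem coeff_chi_zero : PowerSeries.coeff 0 chi = 1 := by
  rw [chi, map_add, PowerSeries.coeff_rescale, bern, bernoulliPowerSeries, PowerSeries.coeff_mk]
  simp

/-! ### The generating series of the `τ_n` and products -/

/-- T(1) is the generating series of the τ_n because D^n u = n! τ_{n+1}. Functional equations of
T(1) thereby become identities for the τ_n. -/
theorem coeff_T_one (n : ℕ) : PowerSeries.coeff n (T 1) = tau (n + 1) := by
  have h := coeff_aeval_T 1 n Polynomial.X
  rw [Polynomial.aeval_X] at h
  rw [h, coeff_ex]
  have h2 : (DL ^ n) (Polynomial.X : ℂ[X]) = (n.factorial : ℂ) • tau (n + 1) := by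
    clear h
    induction n with
    | zero => simp [tau]
    | succ n ih =>
      rw [pow_succ', Module.End.mul_apply, ih, map_smul, DL_apply, D_tau, smul_smul,
        Nat.factorial_succ]
      congr 1
      push_cast
      ring
  rw [h2, smul_smul, one_pow, one_div_mul_cancel (by exact_mod_cast n.factorial_ne_zero), one_smul]

theorem map_C_X : PowerSeries.map (Polynomial.C : ℂ →+* ℂ[X]) PowerSeries.X = d :=
  PowerSeries.map_X _

theorem chi_mul_sinhS : PowerSeries.map Polynomial.C chi * sinhS 1 = d * coshS 1 := by
  have h := congrArg (PowerSeries.map (Polynomial.C : ℂ →+* ℂ[X])) chi_mul_sinh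
  rw [map_mul, map_mul, map_add, map_sub, map_C_X, ← expS_eq, ← expS_eq] at h
  rw [sinhS, coshS]
  linear_combination num (1 / 2) * h

/-- The addition theorem of tanh, with the denominator cleared and multiplied by d coth d. -/
theorem chi_add_mul_T :
    (PowerSeries.map Polynomial.C chi + u * d) * T 1 = u * PowerSeries.map Polynomial.C chi + d := by
  have h := T_mul_den 1
  have hc : coshS 1 * inv (coshS 1) = 1 := mul_inv _ (constantCoeff_coshS 1)
  have hd : den 1 = coshS 1 + u * sinhS 1 := rfl
  rw [hd] at h
  linear_combination inv (coshS 1) * (PowerSeries.map Polynomial.C chi) * h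
    - ((PowerSeries.map Polynomial.C chi + u * d) * T 1
      - u * PowerSeries.map Polynomial.C chi - d) * hc
    + inv (coshS 1) * (1 - u * T 1) * chi_mul_sinhS

/-- Coefficient of d^{p+1} in `chi_add_mul_T`. For x.2 ≤ p the binomial (x.2 choose p) is nonzero
only at x.2 = p; that summand encodes the right-hand term u χ, and its sign is harmless because the
odd coefficients of χ vanish. -/
theorem X_mul_tau (p : ℕ) : tau (p + 1) * Polynomial.X = (if p = 0 then 1 else 0) - tau (p + 2)
    - ∑ x ∈ antidiagonal p, (PowerSeries.coeff (x.2 + 1) chi * (1 + (-1) ^ p * (x.2.choose p)))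
      • tau (x.1 + 1) := by
  have h := congrArg (PowerSeries.coeff (p + 1)) chi_add_mul_T
  rw [add_mul, map_add, map_add, PowerSeries.coeff_mul, Finset.Nat.sum_antidiagonal_succ, u,
    mul_assoc, PowerSeries.coeff_C_mul, PowerSeries.coeff_C_mul, coeff_d_mul, d,
    PowerSeries.coeff_X] at h
  simp only [PowerSeries.coeff_map, coeff_T_one, coeff_chi_zero, map_one, one_mul,
    ← Polynomial.smul_eq_C_mul] at h
  rw [← Finset.Nat.sum_antidiagonal_swap] at h
  simp only [Prod.fst_swap, Prod.snd_swap] at h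
  have h1 : ∑ x ∈ antidiagonal p, (PowerSeries.coeff (x.2 + 1) chi *
      (1 + (-1) ^ p * (x.2.choose p))) • tau (x.1 + 1)
      = ∑ x ∈ antidiagonal p, PowerSeries.coeff (x.2 + 1) chi • tau (x.1 + 1)
        + (PowerSeries.coeff (p + 1) chi * (-1) ^ p) • tau 1 := by
    have h2 : ∑ x ∈ antidiagonal p, (PowerSeries.coeff (x.2 + 1) chi *
        ((-1) ^ p * (x.2.choose p))) • tau (x.1 + 1)
        = (PowerSeries.coeff (p + 1) chi * (-1) ^ p) • tau 1 := by
      rw [Finset.sum_eq_single (0, p)]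
      · simp
      · rintro ⟨a, b⟩ hab hne
        rw [Finset.HasAntidiagonal.mem_antidiagonal] at hab
        have hb : b < p := by
          rcases Nat.eq_zero_or_pos a with rfl | ha
          · exact absurd (by simpa using hab) hne
          · simp at hab
            omega
        simp [Nat.choose_eq_zero_of_lt hb]
      · simp
    rw [← h2, ← Finset.sum_add_distrib]
    refine Finset.sum_congr rfl fun x _ => ?_
    rw [← add_smul]
    congr 1
    ring
  have h3 : (PowerSeries.coeff (p + 1) chi * (-1) ^ p) • tau 1
      = -(Polynomial.X * Polynomial.C (PowerSeries.coeff (p + 1) chi)) := by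
    rcases Nat.even_or_odd p with he | ho
    · obtain ⟨j, rfl⟩ := he
      rw [← two_mul, coeff_chi_odd]
      simp
    · rw [ho.neg_one_pow, Polynomial.smul_eq_C_mul, tau]
      simp
  have h4 : (if p + 1 = 1 then (1 : ℂ[X]) else 0) = if p = 0 then 1 else 0 := by simp
  rw [h1, h3, ← h4]
  linear_combination h

theorem succ_mul_choose_succ (m k : ℕ) :
    ((k : ℂ) + 1) * (m.choose (k + 1)) = (m - k) * m.choose k := by
  rcases le_or_gt k m with h | h
  · have h1 := Nat.choose_succ_right_eq m k
    have h2 : ((m.choose (k + 1) * (k + 1) : ℕ) : ℂ) = (m.choose k * (m - k) : ℕ) := by rw [h1]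
    push_cast [h] at h2
    linear_combination h2
  · rw [Nat.choose_eq_zero_of_lt h, Nat.choose_eq_zero_of_lt (by omega)]
    simp

theorem D_sum_smul_tau (c : ℕ → ℂ) (n : ℕ) :
    DL (∑ x ∈ antidiagonal n, c x.2 • tau (x.1 + 1))
      = ∑ x ∈ antidiagonal (n + 1), (x.1 * c x.2) • tau (x.1 + 1) := by
  rw [Finset.Nat.sum_antidiagonal_succ, map_sum]
  simp only [Nat.cast_zero, zero_mul, zero_smul, zero_add]
  refine Finset.sum_congr rfl fun x _ => ?_
  rw [map_smul, DL_apply, D_tau, smul_smul, mul_comm]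

/-- Induction on q. Apply D to the formula for (p, q); by the product rule this involves (p+1)
τ_{p+2} τ_{q+1} and (q+1) τ_{p+1} τ_{q+2}, and the first is known from (p+1, q). The coefficients
match by (k+1) C(m, k+1) = (m-k) C(m, k). -/
theorem tau_mul_tau (p q : ℕ) : tau (p + 1) * tau (q + 1)
    = (if p = 0 ∧ q = 0 then 1 else 0) - tau (p + q + 2)
      - ∑ x ∈ antidiagonal (p + q), (PowerSeries.coeff (x.2 + 1) chi *
          ((-1) ^ q * (x.2.choose q) + (-1) ^ p * (x.2.choose p))) • tau (x.1 + 1) := by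
  induction q generalizing p with
  | zero =>
    have h := X_mul_tau p
    simp only [zero_add, add_zero, pow_zero, Nat.choose_zero_right, Nat.cast_one, mul_one, and_true]
    simpa [tau] using h
  | succ q ih =>
    have h1 := congrArg D (ih p)
    have h2 := ih (p + 1)
    have hq : ((q : ℂ) + 1) ≠ 0 := by exact_mod_cast Nat.succ_ne_zero q
    rw [D_mul, ← DL_apply (_ - _), map_sub, map_sub,
      D_sum_smul_tau (fun m => PowerSeries.coeff (m + 1) chi *
        ((-1) ^ q * (m.choose q) + (-1) ^ p * (m.choose p))), D_tau, D_tau, DL_apply,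
      DL_apply, D_tau] at h1
    have h3 : D (if p = 0 ∧ q = 0 then 1 else 0) = 0 := by split_ifs <;> simp [D]
    have h4 : ∑ x ∈ antidiagonal (p + q + 1), ((q + 1 : ℂ) * (PowerSeries.coeff (x.2 + 1) chi *
        ((-1) ^ (q + 1) * (x.2.choose (q + 1)) + (-1) ^ p * (x.2.choose p)))) • tau (x.1 + 1)
        = ∑ x ∈ antidiagonal (p + q + 1), (x.1 * (PowerSeries.coeff (x.2 + 1) chi *
          ((-1) ^ q * (x.2.choose q) + (-1) ^ p * (x.2.choose p)))) • tau (x.1 + 1)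
        - (p + 1 : ℂ) • ∑ x ∈ antidiagonal (p + q + 1), (PowerSeries.coeff (x.2 + 1) chi *
          ((-1) ^ q * (x.2.choose q) + (-1) ^ (p + 1) * (x.2.choose (p + 1)))) • tau (x.1 + 1) := by
      rw [Finset.smul_sum, ← Finset.sum_sub_distrib]
      refine Finset.sum_congr rfl fun x hx => ?_
      rw [smul_smul, ← sub_smul]
      congr 1
      rw [Finset.HasAntidiagonal.mem_antidiagonal] at hx
      have hx' : (x.1 : ℂ) = p + q + 1 - x.2 := by
        have : ((x.1 + x.2 : ℕ) : ℂ) = (p + q + 1 : ℕ) := by rw [hx]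
        push_cast at this
        linear_combination this
      rw [hx', pow_succ, pow_succ]
      linear_combination (-PowerSeries.coeff (x.2 + 1) chi * (-1) ^ q) * succ_mul_choose_succ x.2 q
        - (PowerSeries.coeff (x.2 + 1) chi * (-1) ^ p) * succ_mul_choose_succ x.2 p
    rw [show p + 1 + q = p + q + 1 by ring] at h2
    have h5 : (Polynomial.C ((q : ℂ) + 1)) ≠ 0 := Polynomial.C_ne_zero.mpr hq
    refine mul_left_cancel₀ h5 ?_
    simp only [← add_assoc]
    rw [mul_sub, ← Polynomial.smul_eq_C_mul (p := Finset.sum _ _), Finset.smul_sum]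
    simp only [smul_smul]
    rw [h4]
    simp only [Nat.succ_ne_zero, false_and, and_false, if_false, h3] at h1 h2 ⊢
    simp only [Polynomial.smul_eq_C_mul, map_add, map_one, Nat.cast_add, Nat.cast_one,
      Nat.cast_ofNat, map_ofNat] at h1 h2 ⊢
    linear_combination h1 - (Polynomial.C (p : ℂ) + 1) * h2

/-- Partial sums of the negative binomial series at 1/2, whose total is exactly 1 for every q. -/
theorem sum_choose_mul_half_pow_le (q n : ℕ) :
    ∑ m ∈ Finset.range (n + 1), (m.choose q : ℝ) * (1 / 2) ^ (m + 1) ≤ 1 := by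
  have h := hasSum_choose_mul_geometric_of_norm_lt_one (𝕜 := ℝ) q (r := 1 / 2) (by norm_num)
  have h2 : HasSum (fun m : ℕ => ((m + q).choose q : ℝ) * (1 / 2) ^ (m + q + 1)) 1 := by
    have h3 := h.mul_right ((1 / 2 : ℝ) ^ (q + 1))
    have e : 1 / (1 - (1 / 2 : ℝ)) ^ (q + 1) * (1 / 2) ^ (q + 1) = 1 := by
      norm_num [← mul_pow]
    rw [e] at h3
    refine h3.congr_fun fun m => ?_
    ring
  have h0 : ∀ m ∈ Finset.range q, (m.choose q : ℝ) * (1 / 2) ^ (m + 1) = 0 := by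
    intro m hm
    rw [Nat.choose_eq_zero_of_lt (by simpa using hm)]
    simp
  calc _ ≤ ∑ m ∈ Finset.range (q + (n + 1)), (m.choose q : ℝ) * (1 / 2) ^ (m + 1) :=
        Finset.sum_le_sum_of_subset_of_nonneg (Finset.range_mono (by omega))
          fun _ _ _ => by positivity
    _ = ∑ m ∈ Finset.range (n + 1), ((m + q).choose q : ℝ) * (1 / 2) ^ (m + q + 1) := by
        rw [Finset.sum_range_add, Finset.sum_eq_zero h0, zero_add]
        exact Finset.sum_congr rfl fun m _ => by rw [add_comm q m]
    _ ≤ 1 := sum_le_hasSum _ (fun _ _ => by positivity) h2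

theorem sum_antidiagonal_snd {M : Type*} [AddCommMonoid M] (f : ℕ → M) (n : ℕ) :
    ∑ x ∈ antidiagonal n, f x.2 = ∑ m ∈ Finset.range (n + 1), f m := by
  rw [← Finset.Nat.sum_antidiagonal_swap]
  exact Finset.Nat.sum_antidiagonal_eq_sum_range_succ_mk (fun x => f x.1) n

theorem half_pi_pos : 0 < Real.pi / 2 := by positivity

theorem one_le_half_pi : 1 ≤ Real.pi / 2 := by linarith [Real.pi_gt_three]

/-- The norms are submultiplicative up to a constant. -/
theorem exists_tauNorm_mul_le : ∃ K : ℝ, 1 ≤ K ∧ ∀ (m n : ℕ) (p q : ℂ[X]), p.natDegree ≤ m →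
    q.natDegree ≤ n → tauNorm (m + n) (p * q) ≤ K * tauNorm m p * tauNorm n q := by
  obtain ⟨K, hK, hchi⟩ := norm_coeff_chi_le
  have hpi := Real.pi_pos
  -- The three summands bound the constant term, the term τ_{p+q+2}, and the two binomial sums of
  -- `tau_mul_tau`.
  refine ⟨(Real.pi / 2) ^ 2 + 1 + 2 * K, by nlinarith [sq_nonneg (Real.pi / 2)], fun m n p q hp hq =>
    tauNorm_mul_le_of_tau (fun i j => ?_) hp hq⟩
  have hbig : 1 ≤ (Real.pi / 2) ^ 2 + 1 + 2 * K := by nlinarith [sq_nonneg (Real.pi / 2)]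
  rcases i with _ | p
  · rw [tau, one_mul, tauNorm_tau (by omega)]
    simpa using hbig
  rcases j with _ | q
  · rw [show tau 0 = 1 from rfl, mul_one, tauNorm_tau (by omega)]
    simpa using hbig
  rw [tau_mul_tau, sub_eq_add_neg, sub_eq_add_neg]
  have h1 : tauNorm (p + 1 + (q + 1)) (if p = 0 ∧ q = 0 then 1 else 0) ≤ (Real.pi / 2) ^ 2 := by
    split_ifs with h
    · obtain ⟨rfl, rfl⟩ := h
      rw [show (1 : ℂ[X]) = tau 0 from rfl, tauNorm_tau (by omega)]
    · rw [tauNorm_zero]; positivity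
  have h2 : tauNorm (p + 1 + (q + 1)) (-tau (p + q + 2)) ≤ 1 := by
    rw [tauNorm_neg, tauNorm_tau (by omega), show p + 1 + (q + 1) - (p + q + 2) = 0 by omega,
      pow_zero]
  have h3 : tauNorm (p + 1 + (q + 1)) (-∑ x ∈ antidiagonal (p + q),
      (PowerSeries.coeff (x.2 + 1) chi * ((-1) ^ q * (x.2.choose q) + (-1) ^ p * (x.2.choose p)))
        • tau (x.1 + 1)) ≤ 2 * K := by
    rw [tauNorm_neg]
    refine (tauNorm_sum_le _ _ _).trans ?_
    have h4 : ∀ x ∈ antidiagonal (p + q), tauNorm (p + 1 + (q + 1))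
        ((PowerSeries.coeff (x.2 + 1) chi * ((-1) ^ q * (x.2.choose q) + (-1) ^ p * (x.2.choose p)))
        • tau (x.1 + 1)) ≤ K * ((x.2.choose q) * (1 / 2) ^ (x.2 + 1))
          + K * ((x.2.choose p) * (1 / 2) ^ (x.2 + 1)) := by
      intro x hx
      rw [Finset.HasAntidiagonal.mem_antidiagonal] at hx
      rw [tauNorm_smul, tauNorm_tau (by omega), norm_mul,
        show p + 1 + (q + 1) - (x.1 + 1) = x.2 + 1 by omega]
      have h5 : ‖((-1 : ℂ) ^ q * (x.2.choose q) + (-1) ^ p * (x.2.choose p))‖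
          ≤ x.2.choose q + x.2.choose p := by
        refine (norm_add_le _ _).trans ?_
        simp
      -- This is where the weight π/2 matters: the decay π^{-k} of the coefficients of t coth t
      -- times (π/2)^k leaves 2^{-k}, at which the binomial sums are bounded uniformly.
      calc _ ≤ (K * (Real.pi ^ (x.2 + 1))⁻¹) * (x.2.choose q + x.2.choose p)
              * (Real.pi / 2) ^ (x.2 + 1) := by
            gcongr
            exact hchi _
        _ = _ := by
            rw [div_pow, div_pow, one_pow]
            field_simp
    refine (Finset.sum_le_sum h4).trans ?_
    rw [Finset.sum_add_distrib, ← Finset.mul_sum, ← Finset.mul_sum,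
      sum_antidiagonal_snd (fun m => (m.choose q : ℝ) * (1 / 2) ^ (m + 1)),
      sum_antidiagonal_snd (fun m => (m.choose p : ℝ) * (1 / 2) ^ (m + 1))]
    nlinarith [sum_choose_mul_half_pow_le q (p + q), sum_choose_mul_half_pow_le p (p + q)]
  exact (tauNorm_add_le _ _ _).trans (add_le_add ((tauNorm_add_le _ _ _).trans (add_le_add h1 h2)) h3)

/-! ### Division by `1 - u²` -/

/-- The quotient of `(n + 1) τ_{n+2}` by `1 - u²`. -/
def divTau (n : ℕ) : ℂ[X] :=
  PowerSeries.coeff n (PowerSeries.C (1 / 2) * (ex 2 + ex (-2))) • 1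
    - ∑ x ∈ antidiagonal n,
      PowerSeries.coeff x.2 (PowerSeries.C (1 / 2) * (ex 2 - ex (-2))) • tau (x.1 + 1)
    - ∑ x ∈ antidiagonal n, (PowerSeries.coeff x.2 (PowerSeries.C (1 / 2) *
        (PowerSeries.C (1 / 2) * (ex 2 + ex (-2)) - 1)) * ((x.1 : ℂ) + 1)) • tau (x.1 + 2)

/-- Put T = T(1). Then T' = 1 - T² = (1 - u²) / (cosh d + u sinh d)² and 1 / (cosh d + u sinh d) =
cosh d - T sinh d. Squaring, and replacing T² by 1 - T', gives T' = (1 - u²)(cosh 2d - T sinh 2d -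
T' sinh² d), whose coefficients are compared. -/
theorem mul_divTau (n : ℕ) : (1 - Polynomial.X ^ 2) * divTau n = ((n : ℂ) + 1) • tau (n + 2) := by
  have hR := derivative_T 1
  have hT := T_mul_den 1
  have hdi := den_mul_inv 1
  have hd : den 1 = coshS 1 + u * sinhS 1 := rfl
  have hcs := cosh_sq_sub_sinh_sq 1
  rw [num_one, one_mul] at hR
  set a : PSeries := PowerSeries.map Polynomial.C (PowerSeries.C (1 / 2) * (ex 2 + ex (-2))) with ha
  set b : PSeries := PowerSeries.map Polynomial.C (PowerSeries.C (1 / 2) * (ex 2 - ex (-2))) with hb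
  set e : PSeries := PowerSeries.map Polynomial.C (PowerSeries.C (1 / 2) *
        (PowerSeries.C (1 / 2) * (ex 2 + ex (-2)) - 1)) with he
  have h2 : expS 2 = (coshS 1 + sinhS 1) ^ 2 := by
    rw [cosh_add_sinh, sq, expS_mul]; norm_num
  have h2' : expS (-2) = (coshS 1 - sinhS 1) ^ 2 := by
    rw [cosh_sub_sinh, sq, expS_mul]; norm_num
  have hh := two_mul_num_half
  have ha' : a = coshS 1 ^ 2 + sinhS 1 ^ 2 := by
    rw [ha, map_mul, map_add, ← expS_eq, ← expS_eq, h2, h2', PowerSeries.map_C]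
    change num (1 / 2) * _ = _
    linear_combination (coshS 1 ^ 2 + sinhS 1 ^ 2) * hh
  have hb' : b = 2 * coshS 1 * sinhS 1 := by
    rw [hb, map_mul, map_sub, ← expS_eq, ← expS_eq, h2, h2', PowerSeries.map_C]
    change num (1 / 2) * _ = _
    linear_combination (2 * coshS 1 * sinhS 1) * hh
  have he' : e = sinhS 1 ^ 2 := by
    have : e = num (1 / 2) * (a - 1) := by
      rw [he, ha, map_mul, map_sub, map_one, PowerSeries.map_C]
    rw [this, ha']
    linear_combination (sinhS 1 ^ 2) * hh + num (1 / 2) * hcs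
  have h3 : coshS 1 - sinhS 1 * T 1 = inv (den 1) := by
    linear_combination (-(coshS 1 - sinhS 1 * T 1)) * hdi - inv (den 1) * sinhS 1 * hT
      + inv (den 1) * coshS 1 * hd + inv (den 1) * hcs
  have h4 : 1 - T 1 ^ 2 = (1 - u ^ 2) * inv (den 1) ^ 2 := by
    linear_combination (-(1 - T 1 ^ 2) * (den 1 * inv (den 1) + 1)) * hdi
      - inv (den 1) ^ 2 * (T 1 * den 1 + (u * coshS 1 + sinhS 1)) * hT
      + inv (den 1) ^ 2 * (den 1 + coshS 1 + u * sinhS 1) * hd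
      + inv (den 1) ^ 2 * (1 - u ^ 2) * hcs
  have key : der (T 1) = (1 - u ^ 2) * (a - b * T 1 - e * der (T 1)) := by
    rw [ha', hb', he', hR]
    rw [← h3] at h4
    linear_combination h4
  have hu : (1 - u ^ 2 : PSeries) = pol (1 - Polynomial.X ^ 2) := by simp [u]
  have hc := congrArg (PowerSeries.coeff n) key
  rw [hu, PowerSeries.coeff_C_mul, coeff_der, coeff_T_one, map_sub, map_sub, PowerSeries.coeff_mul,
    PowerSeries.coeff_mul] at hc
  have e1 : ((n : ℂ[X]) + 1) = Polynomial.C ((n : ℂ) + 1) := by simp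
  rw [Polynomial.smul_eq_C_mul, ← e1, mul_comm _ (tau (n + 2)), hc, divTau,
    ← Finset.Nat.sum_antidiagonal_swap]
  rw [← Finset.Nat.sum_antidiagonal_swap (f := fun x => (PowerSeries.coeff x.1) e * _)]
  congr 1
  refine congrArg₂ _ (congrArg₂ _ ?_ (Finset.sum_congr rfl fun x _ => ?_))
    (Finset.sum_congr rfl fun x _ => ?_)
  · rw [ha, PowerSeries.coeff_map, Polynomial.smul_eq_C_mul, mul_one]
  · rw [hb, Prod.fst_swap, Prod.snd_swap, PowerSeries.coeff_map, coeff_T_one,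
      Polynomial.smul_eq_C_mul]
  · rw [he, Prod.fst_swap, Prod.snd_swap, PowerSeries.coeff_map, coeff_der, coeff_T_one,
      Polynomial.smul_eq_C_mul, Polynomial.C_mul]
    simp
    ring

theorem one_sub_X_sq_ne_zero : (1 - Polynomial.X ^ 2 : ℂ[X]) ≠ 0 := by
  intro h
  have := congrArg (Polynomial.eval 0) h
  simp at this

theorem natDegree_one_sub_X_sq : (1 - Polynomial.X ^ 2 : ℂ[X]).natDegree = 2 := by
  have h : (1 - Polynomial.X ^ 2 : ℂ[X]) = tau 2 := by simp [tau, D]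
  rw [h, natDegree_tau]

theorem natDegree_divTau (n : ℕ) : (divTau n).natDegree ≤ n := by
  have h := congrArg Polynomial.natDegree (mul_divTau n)
  by_cases h0 : divTau n = 0
  · simp [h0]
  · rw [Polynomial.natDegree_mul one_sub_X_sq_ne_zero h0, natDegree_one_sub_X_sq] at h
    have := Polynomial.natDegree_smul_le ((n : ℂ) + 1) (tau (n + 2))
    rw [natDegree_tau] at this
    omega

theorem norm_coeff_cosh_le (n : ℕ) :
    ‖PowerSeries.coeff n (PowerSeries.C (1 / 2) * (ex 2 + ex (-2)))‖ ≤ 2 ^ n / n.factorial := by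
  rw [PowerSeries.coeff_C_mul, map_add, coeff_ex, coeff_ex, norm_mul]
  have h := norm_add_le ((2 : ℂ) ^ n / n.factorial) ((-2) ^ n / n.factorial)
  simp only [norm_div, norm_pow, norm_neg, Complex.norm_ofNat, Complex.norm_natCast] at h
  norm_num
  linarith

theorem norm_coeff_sinh_le (n : ℕ) :
    ‖PowerSeries.coeff n (PowerSeries.C (1 / 2) * (ex 2 - ex (-2)))‖ ≤ 2 ^ n / n.factorial := by
  rw [PowerSeries.coeff_C_mul, map_sub, coeff_ex, coeff_ex, norm_mul]
  have h := norm_sub_le ((2 : ℂ) ^ n / n.factorial) ((-2) ^ n / n.factorial)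
  simp only [norm_div, norm_pow, norm_neg, Complex.norm_ofNat, Complex.norm_natCast] at h
  norm_num
  linarith

/-- Since sinh² d starts at d², the summands of `divTau n` whose τ-index would exceed n drop out. -/
theorem coeff_sinh_sq_lt_two {n : ℕ} (h : n < 2) : PowerSeries.coeff n (PowerSeries.C (1 / 2) *
    (PowerSeries.C (1 / 2) * (ex 2 + ex (-2)) - 1)) = 0 := by
  rw [PowerSeries.coeff_C_mul, map_sub, PowerSeries.coeff_C_mul, map_add, coeff_ex, coeff_ex,
    PowerSeries.coeff_one]
  interval_cases n <;> norm_num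

theorem norm_coeff_sinh_sq_le (n : ℕ) : ‖PowerSeries.coeff n (PowerSeries.C (1 / 2) *
    (PowerSeries.C (1 / 2) * (ex 2 + ex (-2)) - 1))‖ ≤ 2 ^ n / n.factorial := by
  rcases lt_or_ge n 2 with h | h
  · rw [coeff_sinh_sq_lt_two h, norm_zero]
    positivity
  · rw [PowerSeries.coeff_C_mul, map_sub, PowerSeries.coeff_one, if_neg (by omega), sub_zero,
      norm_mul]
    have h1 := norm_coeff_cosh_le n
    have h2 : (0 : ℝ) ≤ 2 ^ n / n.factorial := by positivity
    norm_num at h1 ⊢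
    linarith

theorem sum_pow_div_factorial_le {x : ℝ} (hx : 0 ≤ x) (n : ℕ) :
    ∑ m ∈ Finset.range n, x ^ m / m.factorial ≤ Real.exp x :=
  Real.sum_le_exp_of_nonneg hx n

/-- The scalar coefficients are at most 2^m / m!, so with the weights (π/2)^m they sum to at most
e^π. The factor n + 1 stems from T' in the last sum and is cancelled by the normalization in `divL`.
-/
theorem tauNorm_divTau_le (n : ℕ) :
    tauNorm n (divTau n) ≤ ((n : ℝ) + 1) * (3 * Real.exp Real.pi) := by
  have hpi := Real.pi_pos
  have h1p := one_le_half_pi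
  have hsum := sum_pow_div_factorial_le Real.pi_pos.le (n + 1)
  have hn : (1 : ℝ) ≤ (n : ℝ) + 1 := by linarith [n.cast_nonneg (α := ℝ)]
  have hexp := Real.exp_pos Real.pi
  have hmul : ∀ m : ℕ, (2 : ℝ) ^ m / m.factorial * (Real.pi / 2) ^ m = Real.pi ^ m / m.factorial := by
    intro m
    rw [div_pow]
    field_simp
  have h1 : tauNorm n (PowerSeries.coeff n (PowerSeries.C (1 / 2) * (ex 2 + ex (-2))) • 1)
      ≤ ((n : ℝ) + 1) * Real.exp Real.pi := by
    rw [tauNorm_smul, show (1 : ℂ[X]) = tau 0 from rfl, tauNorm_tau (by omega)]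
    calc _ ≤ (2 : ℝ) ^ n / n.factorial * (Real.pi / 2) ^ n := by
          gcongr
          · exact norm_coeff_cosh_le n
          · omega
      _ = Real.pi ^ n / n.factorial := hmul n
      _ ≤ ∑ m ∈ Finset.range (n + 1), Real.pi ^ m / m.factorial :=
          Finset.single_le_sum (f := fun m => Real.pi ^ m / (m.factorial : ℝ))
            (fun _ _ => by positivity) (by simp)
      _ ≤ Real.exp Real.pi := hsum
      _ ≤ _ := le_mul_of_one_le_left hexp.le hn
  have h2 : tauNorm n (∑ x ∈ antidiagonal n,
      PowerSeries.coeff x.2 (PowerSeries.C (1 / 2) * (ex 2 - ex (-2))) • tau (x.1 + 1))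
      ≤ ((n : ℝ) + 1) * Real.exp Real.pi := by
    refine (tauNorm_sum_le _ _ _).trans ?_
    have h : ∀ x ∈ antidiagonal n, tauNorm n (PowerSeries.coeff x.2
        (PowerSeries.C (1 / 2) * (ex 2 - ex (-2))) • tau (x.1 + 1))
        ≤ Real.pi ^ x.2 / x.2.factorial := by
      intro x hx
      rw [Finset.HasAntidiagonal.mem_antidiagonal] at hx
      rw [tauNorm_smul]
      rcases Nat.eq_zero_or_pos x.2 with h0 | h0
      · rw [h0, PowerSeries.coeff_C_mul, map_sub, coeff_ex, coeff_ex]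
        simp
      · rw [tauNorm_tau (by omega), ← hmul]
        gcongr
        · exact norm_coeff_sinh_le _
        · omega
    refine (Finset.sum_le_sum h).trans ?_
    rw [sum_antidiagonal_snd (fun m => Real.pi ^ m / (m.factorial : ℝ))]
    exact hsum.trans (le_mul_of_one_le_left hexp.le hn)
  have h3 : tauNorm n (∑ x ∈ antidiagonal n, (PowerSeries.coeff x.2 (PowerSeries.C (1 / 2) *
        (PowerSeries.C (1 / 2) * (ex 2 + ex (-2)) - 1)) * ((x.1 : ℂ) + 1)) • tau (x.1 + 2))
      ≤ ((n : ℝ) + 1) * Real.exp Real.pi := by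
    refine (tauNorm_sum_le _ _ _).trans ?_
    have h : ∀ x ∈ antidiagonal n, tauNorm n ((PowerSeries.coeff x.2 (PowerSeries.C (1 / 2) *
        (PowerSeries.C (1 / 2) * (ex 2 + ex (-2)) - 1)) * ((x.1 : ℂ) + 1)) • tau (x.1 + 2))
        ≤ ((n : ℝ) + 1) * (Real.pi ^ x.2 / x.2.factorial) := by
      intro x hx
      rw [Finset.HasAntidiagonal.mem_antidiagonal] at hx
      rw [tauNorm_smul]
      rcases lt_or_ge x.2 2 with h0 | h0
      · rw [coeff_sinh_sq_lt_two h0]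
        simp
        positivity
      · rw [tauNorm_tau (by omega), ← hmul, norm_mul]
        have h5 : ‖(x.1 : ℂ) + 1‖ ≤ (n : ℝ) + 1 := by
          refine (norm_add_le _ _).trans ?_
          simp
          omega
        calc _ ≤ (2 : ℝ) ^ x.2 / x.2.factorial * ((n : ℝ) + 1) * (Real.pi / 2) ^ x.2 := by
              gcongr
              · exact norm_coeff_sinh_sq_le _
              · omega
          _ = _ := by ring
    refine (Finset.sum_le_sum h).trans ?_
    rw [← Finset.mul_sum, sum_antidiagonal_snd (fun m => Real.pi ^ m / (m.factorial : ℝ))]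
    gcongr
  rw [divTau, sub_eq_add_neg, sub_eq_add_neg]
  refine (tauNorm_add_le _ _ _).trans ((add_le_add (tauNorm_add_le _ _ _) le_rfl).trans ?_)
  rw [tauNorm_neg, tauNorm_neg]
  linarith

/-- Division by `1 - u²` on the span of the `τ_n`, `n ≥ 2`. -/
def divL : ℂ[X] →ₗ[ℂ] ℂ[X] :=
  tauBasis.constr ℂ fun
    | 0 => 0
    | 1 => 0
    | n + 2 => (((n : ℂ) + 1)⁻¹) • divTau n

theorem divL_tau_add_two (n : ℕ) : divL (tau (n + 2)) = (((n : ℂ) + 1)⁻¹) • divTau n := by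
  rw [← tauBasis_apply, divL, Module.Basis.constr_basis]

theorem divL_tau_lt_two {n : ℕ} (h : n < 2) : divL (tau n) = 0 := by
  rw [← tauBasis_apply, divL, Module.Basis.constr_basis]
  interval_cases n <;> rfl

theorem mul_divL (p : ℂ[X]) : (1 - Polynomial.X ^ 2) * divL p
    = p - tauBasis.repr p 0 • 1 - tauBasis.repr p 1 • Polynomial.X := by
  have h : LinearMap.mulLeft ℂ (1 - Polynomial.X ^ 2) ∘ₗ divL = LinearMap.id
      - (Finsupp.lapply 0 ∘ₗ tauBasis.repr.toLinearMap).smulRight 1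
      - (Finsupp.lapply 1 ∘ₗ tauBasis.repr.toLinearMap).smulRight Polynomial.X := by
    refine tauBasis.ext fun j => ?_
    rw [tauBasis_apply]
    rcases j with _ | _ | j
    · simp [divL_tau_lt_two, repr_tau]
      simp [tau]
    · simp [divL_tau_lt_two, repr_tau]
      simp [tau]
    · have hj : ((j : ℂ) + 1) ≠ 0 := by exact_mod_cast Nat.succ_ne_zero j
      simp [divL_tau_add_two, repr_tau, mul_divTau, smul_smul, hj]
  exact congrArg (fun f => f p) h

/-- Every τ_n with n ≥ 2 vanishes at ±1, so the values of p at ±1 determine its τ_0- and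
τ_1-components. -/
theorem repr_zero_add_repr_one (p : ℂ[X]) :
    tauBasis.repr p 0 + tauBasis.repr p 1 = p.eval 1 := by
  have h : Finsupp.lapply 0 ∘ₗ tauBasis.repr.toLinearMap
      + Finsupp.lapply 1 ∘ₗ tauBasis.repr.toLinearMap = Polynomial.leval (1 : ℂ) := by
    refine tauBasis.ext fun j => ?_
    rw [tauBasis_apply]
    rcases j with _ | _ | j <;> simp [repr_tau] <;> simp [tau, D]
  exact congrArg (fun f => f p) h

theorem repr_zero_sub_repr_one (p : ℂ[X]) :
    tauBasis.repr p 0 - tauBasis.repr p 1 = p.eval (-1) := by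
  have h : Finsupp.lapply 0 ∘ₗ tauBasis.repr.toLinearMap
      - Finsupp.lapply 1 ∘ₗ tauBasis.repr.toLinearMap = Polynomial.leval (-1 : ℂ) := by
    refine tauBasis.ext fun j => ?_
    rw [tauBasis_apply]
    rcases j with _ | _ | j <;> simp [repr_tau] <;> simp [tau, D]
  exact congrArg (fun f => f p) h

theorem repr_zero_eq_zero {p : ℂ[X]} (h : p.eval 1 + p.eval (-1) = 0) :
    tauBasis.repr p 0 = 0 := by
  have h1 := repr_zero_add_repr_one p
  have h2 := repr_zero_sub_repr_one p
  have : 2 * tauBasis.repr p 0 = 0 := by linear_combination h1 + h2 + h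
  simpa using this

theorem divL_mul (p : ℂ[X]) : divL ((1 - Polynomial.X ^ 2) * p) = p := by
  refine mul_left_cancel₀ one_sub_X_sq_ne_zero ?_
  have h0 : tauBasis.repr ((1 - Polynomial.X ^ 2) * p) 0 = 0 := repr_zero_eq_zero (by simp)
  have h1 := repr_zero_add_repr_one ((1 - Polynomial.X ^ 2) * p)
  rw [h0] at h1
  have h1' : tauBasis.repr ((1 - Polynomial.X ^ 2) * p) 1 = 0 := by simpa using h1
  rw [mul_divL, h0, h1']
  simp

/-- `divL` is a left inverse of multiplication by 1 - u² and is bounded on the basis, hence on all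
polynomials by `tauNorm_map_le`. -/
theorem tauNorm_le_of_mul {p : ℂ[X]} {n : ℕ} (hp : p.natDegree ≤ n) :
    tauNorm n p ≤ 3 * Real.exp Real.pi * tauNorm (n + 2) ((1 - Polynomial.X ^ 2) * p) := by
  have hd : ((1 - Polynomial.X ^ 2) * p).natDegree ≤ n + 2 := by
    refine Polynomial.natDegree_mul_le.trans ?_
    rw [natDegree_one_sub_X_sq]
    omega
  have hpi := Real.pi_pos
  conv_lhs => rw [← divL_mul p]
  refine tauNorm_map_le divL (fun i hi => ?_) hd
  rcases lt_or_ge i 2 with h | h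
  · rw [divL_tau_lt_two h, tauNorm_zero]
    positivity
  · obtain ⟨j, rfl⟩ := Nat.exists_eq_add_of_le' h
    have h1 : ‖((j : ℂ) + 1)⁻¹‖ = ((j : ℝ) + 1)⁻¹ := by
      rw [norm_inv]
      norm_cast
    have h2 := tauNorm_add_index (natDegree_divTau j) (n - j)
    rw [show j + (n - j) = n by omega] at h2
    rw [divL_tau_add_two, tauNorm_smul, h1, h2, show n + 2 - (j + 2) = n - j by omega]
    have hj : (0 : ℝ) < (j : ℝ) + 1 := by positivity
    calc _ ≤ ((j : ℝ) + 1)⁻¹ * ((Real.pi / 2) ^ (n - j) * (((j : ℝ) + 1) * (3 * Real.exp Real.pi))) := by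
          gcongr
          exact tauNorm_divTau_le j
      _ = _ := by field_simp

/-! ### Graded series -/

/-- The coefficient of `d ^ n` has degree at most `n`. -/
def Gr (Z : PSeries) : Prop := ∀ n, (PowerSeries.coeff n Z).natDegree ≤ n

/-- `‖Z‖_n`. -/
def nu (n : ℕ) (Z : PSeries) : ℝ := tauNorm n (PowerSeries.coeff n Z)

theorem nu_nonneg (n : ℕ) (Z : PSeries) : 0 ≤ nu n Z := tauNorm_nonneg _ _

theorem Gr.add {Y Z : PSeries} (hY : Gr Y) (hZ : Gr Z) : Gr (Y + Z) := fun n => by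
  rw [map_add]
  exact (Polynomial.natDegree_add_le _ _).trans (max_le (hY n) (hZ n))

theorem Gr.sub {Y Z : PSeries} (hY : Gr Y) (hZ : Gr Z) : Gr (Y - Z) := fun n => by
  rw [map_sub]
  exact (Polynomial.natDegree_sub_le _ _).trans (max_le (hY n) (hZ n))

theorem Gr.mul {Y Z : PSeries} (hY : Gr Y) (hZ : Gr Z) : Gr (Y * Z) := fun n => by
  rw [PowerSeries.coeff_mul]
  refine Polynomial.natDegree_sum_le_of_forall_le _ _ fun x hx => ?_
  rw [Finset.HasAntidiagonal.mem_antidiagonal] at hx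
  exact Polynomial.natDegree_mul_le.trans (hx ▸ add_le_add (hY _) (hZ _))

theorem Gr.op {Z : PSeries} (hZ : Gr Z) (f : PowerSeries ℂ) : Gr (op f Z) := fun n => by
  rw [coeff_op]
  refine Polynomial.natDegree_sum_le_of_forall_le _ _ fun x hx => ?_
  rw [Finset.HasAntidiagonal.mem_antidiagonal] at hx
  refine (Polynomial.natDegree_smul_le _ _).trans ((natDegree_DL_pow_le (hZ _) _).trans ?_)
  omega

theorem Gr.S {Z : PSeries} (hZ : Gr Z) : Gr (S Z) := by
  rw [S_eq]
  exact hZ.op _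

theorem nu_add_le (n : ℕ) (Y Z : PSeries) : nu n (Y + Z) ≤ nu n Y + nu n Z := by
  rw [nu, map_add]
  exact tauNorm_add_le _ _ _

theorem nu_neg (n : ℕ) (Z : PSeries) : nu n (-Z) = nu n Z := by
  rw [nu, map_neg, tauNorm_neg, nu]

theorem nu_sub_le (n : ℕ) (Y Z : PSeries) : nu n (Y - Z) ≤ nu n Y + nu n Z := by
  rw [sub_eq_add_neg]
  exact (nu_add_le _ _ _).trans (by rw [nu_neg])

theorem nu_num_mul (n : ℕ) (c : ℂ) (Z : PSeries) : nu n (num c * Z) = ‖c‖ * nu n Z := by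
  rw [nu, PowerSeries.coeff_C_mul, ← Polynomial.smul_eq_C_mul, tauNorm_smul, nu]

/-- The constant in the product estimate. -/
def mulK : ℝ := exists_tauNorm_mul_le.choose

theorem one_le_mulK : 1 ≤ mulK := exists_tauNorm_mul_le.choose_spec.1

theorem tauNorm_mul_le {m n : ℕ} {p q : ℂ[X]} (hp : p.natDegree ≤ m) (hq : q.natDegree ≤ n) :
    tauNorm (m + n) (p * q) ≤ mulK * tauNorm m p * tauNorm n q :=
  exists_tauNorm_mul_le.choose_spec.2 m n p q hp hq

theorem nu_mul_le {Y Z : PSeries} (hY : Gr Y) (hZ : Gr Z) (n : ℕ) :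
    nu n (Y * Z) ≤ mulK * ∑ x ∈ antidiagonal n, nu x.1 Y * nu x.2 Z := by
  rw [nu, PowerSeries.coeff_mul, Finset.mul_sum]
  refine (tauNorm_sum_le _ _ _).trans (Finset.sum_le_sum fun x hx => ?_)
  rw [Finset.HasAntidiagonal.mem_antidiagonal] at hx
  rw [← mul_assoc, ← hx]
  exact tauNorm_mul_le (hY _) (hZ _)

theorem nu_op_le (f : PowerSeries ℂ) (Z : PSeries) (n : ℕ) :
    nu n (op f Z) ≤ ∑ x ∈ antidiagonal n,
      ‖PowerSeries.coeff x.1 f‖ * (x.2.ascFactorial x.1 * nu x.2 Z) := by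
  rw [nu, coeff_op]
  refine (tauNorm_sum_le _ _ _).trans (Finset.sum_le_sum fun x hx => ?_)
  rw [Finset.HasAntidiagonal.mem_antidiagonal] at hx
  rw [tauNorm_smul, ← hx, add_comm x.1]
  gcongr
  exact tauNorm_DL_pow_le _ _ _

/-! ### Series of geometric growth -/

/-- `Z` is graded and `‖Z‖_n` grows at most geometrically. -/
def Geo (Z : PSeries) : Prop := Gr Z ∧ ∃ K ρ : ℝ, 1 ≤ K ∧ 1 ≤ ρ ∧ ∀ n, nu n Z ≤ K * ρ ^ n

theorem Geo.add {Y Z : PSeries} (hY : Geo Y) (hZ : Geo Z) : Geo (Y + Z) := by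
  obtain ⟨gY, K, ρ, hK, hρ, h⟩ := hY
  obtain ⟨gZ, K', ρ', hK', hρ', h'⟩ := hZ
  refine ⟨gY.add gZ, K + K', max ρ ρ', by linarith, le_max_of_le_left hρ, fun n => ?_⟩
  refine (nu_add_le _ _ _).trans ?_
  rw [add_mul]
  refine add_le_add ((h n).trans ?_) ((h' n).trans ?_)
  · gcongr; exact le_max_left _ _
  · gcongr; exact le_max_right _ _

theorem Geo.mul {Y Z : PSeries} (hY : Geo Y) (hZ : Geo Z) : Geo (Y * Z) := by
  obtain ⟨gY, K, ρ, hK, hρ, h⟩ := hY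
  obtain ⟨gZ, K', ρ', hK', hρ', h'⟩ := hZ
  have hm := one_le_mulK
  have h1 : 1 ≤ max ρ ρ' := le_max_of_le_left hρ
  refine ⟨gY.mul gZ, mulK * (K * K'), 2 * max ρ ρ', ?_, by linarith, fun n => ?_⟩
  · exact one_le_mul_of_one_le_of_one_le hm (one_le_mul_of_one_le_of_one_le hK hK')
  · refine (nu_mul_le gY gZ n).trans ?_
    rw [mul_assoc]
    refine mul_le_mul_of_nonneg_left ?_ (by linarith)
    have h2 : ∀ x ∈ antidiagonal n, nu x.1 Y * nu x.2 Z ≤ K * K' * (max ρ ρ') ^ n := by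
      intro x hx
      rw [Finset.HasAntidiagonal.mem_antidiagonal] at hx
      calc _ ≤ (K * ρ ^ x.1) * (K' * ρ' ^ x.2) :=
            mul_le_mul (h _) (h' _) (nu_nonneg _ _) (by positivity)
        _ ≤ (K * (max ρ ρ') ^ x.1) * (K' * (max ρ ρ') ^ x.2) := by
            gcongr
            · exact le_max_left _ _
            · exact le_max_right _ _
        _ = _ := by rw [← hx, pow_add]; ring
    refine (Finset.sum_le_card_nsmul _ _ _ h2).trans ?_
    rw [Finset.Nat.card_antidiagonal, nsmul_eq_mul, mul_pow]
    have h3 : ((n + 1 : ℕ) : ℝ) ≤ 2 ^ n := by exact_mod_cast Nat.lt_two_pow_self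
    calc _ ≤ (2 : ℝ) ^ n * (K * K' * (max ρ ρ') ^ n) := by gcongr
      _ = _ := by ring

theorem geo_of_coeff_C {Z : PSeries} {c : ℕ → ℂ}
    (hc : ∀ n, PowerSeries.coeff n Z = Polynomial.C (c n)) {K ρ : ℝ} (hK : 0 ≤ K) (hρ : 0 ≤ ρ)
    (h : ∀ n, ‖c n‖ ≤ K * ρ ^ n) : Geo Z := by
  have h1 := one_le_half_pi
  refine ⟨fun n => by simp [hc], K + 1, (ρ + 1) * (Real.pi / 2), by linarith, by nlinarith,
    fun n => ?_⟩
  have h2 : Polynomial.C (c n) = c n • tau 0 := by simp [tau, Polynomial.smul_eq_C_mul]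
  rw [nu, hc, h2, tauNorm_smul, tauNorm_tau (by omega), mul_pow, ← mul_assoc]
  gcongr
  · calc _ ≤ K * ρ ^ n := h n
      _ ≤ _ := by gcongr <;> linarith
  · omega

theorem geo_num (c : ℂ) : Geo (num c) := by
  refine geo_of_coeff_C (c := fun n => if n = 0 then c else 0) (fun n => ?_)
    (K := ‖c‖) (ρ := 1) (norm_nonneg _) zero_le_one fun n => ?_
  · rw [PowerSeries.coeff_C]
    split_ifs <;> simp
  · split_ifs <;> simp

theorem geo_one : Geo 1 := by
  rw [← num_one]
  exact geo_num 1

theorem Geo.neg {Z : PSeries} (hZ : Geo Z) : Geo (-Z) := by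
  have := (geo_num (-1)).mul hZ
  rwa [num_neg, num_one, neg_one_mul] at this

theorem Geo.sub {Y Z : PSeries} (hY : Geo Y) (hZ : Geo Z) : Geo (Y - Z) := by
  rw [sub_eq_add_neg]
  exact hY.add hZ.neg

theorem geo_pol_mul_d_pow {p : ℂ[X]} {k : ℕ} (hp : p.natDegree ≤ k) : Geo (pol p * d ^ k) := by
  have hc : ∀ n, PowerSeries.coeff n (pol p * d ^ k) = if n = k then p else 0 := by
    intro n
    rw [PowerSeries.coeff_C_mul, d, PowerSeries.coeff_X_pow]
    split_ifs <;> simp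
  refine ⟨fun n => ?_, tauNorm k p + 1, 1, by linarith [tauNorm_nonneg k p], le_rfl, fun n => ?_⟩
  · rw [hc]
    split_ifs with h
    · rw [h]; exact hp
    · simp
  · rw [nu, hc]
    split_ifs with h
    · rw [h]; simp
    · rw [tauNorm_zero]
      have := tauNorm_nonneg k p
      positivity

theorem geo_d : Geo d := by
  have := geo_pol_mul_d_pow (p := 1) (k := 1) (by simp)
  simpa using this

/-- The series u alone is not graded, having degree 1 at d^0. Explicit series are therefore
rewritten in terms of u d and d. -/
theorem geo_u_mul_d : Geo (u * d) := by
  have := geo_pol_mul_d_pow (p := Polynomial.X) (k := 1) (by simp)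
  simpa [u] using this

theorem Geo.pow {Z : PSeries} (hZ : Geo Z) (k : ℕ) : Geo (Z ^ k) := by
  induction k with
  | zero => simpa using geo_one
  | succ k ih => rw [pow_succ]; exact ih.mul hZ

theorem geo_omega : Geo ((1 - u ^ 2) * d ^ 2) := by
  have h := (geo_d.pow 2).sub (geo_u_mul_d.pow 2)
  convert h using 1
  ring

theorem geo_expS (θ : ℂ) : Geo (expS θ) := by
  refine geo_of_coeff_C (c := fun n => θ ^ n / n.factorial) (fun n => ?_)
    (K := 1) (ρ := ‖θ‖) zero_le_one (norm_nonneg _) fun n => ?_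
  · rw [expS_eq, PowerSeries.coeff_map, coeff_ex]
  · rw [norm_div, norm_pow, Complex.norm_natCast, one_mul]
    exact div_le_self (by positivity) (by exact_mod_cast Nat.one_le_iff_ne_zero.mpr n.factorial_ne_zero)

theorem geo_coshS (θ : ℂ) : Geo (coshS θ) := (geo_num _).mul ((geo_expS _).add (geo_expS _))

/-- `sinh(θ d) / d`. -/
def sinhcS (θ : ℂ) : PSeries := PowerSeries.mk fun n => PowerSeries.coeff (n + 1) (sinhS θ)

theorem d_mul_sinhcS (θ : ℂ) : d * sinhcS θ = sinhS θ := by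
  ext1 n
  cases n with
  | zero =>
    rw [coeff_zero_d_mul, PowerSeries.coeff_zero_eq_constantCoeff_apply, constantCoeff_sinhS]
  | succ n => rw [coeff_d_mul, sinhcS, PowerSeries.coeff_mk]

theorem geo_sinhcS (θ : ℂ) : Geo (sinhcS θ) := by
  refine geo_of_coeff_C (c := fun n => 1 / 2 * (θ ^ (n + 1) / (n + 1).factorial
    - (-θ) ^ (n + 1) / (n + 1).factorial)) (fun n => ?_)
    (K := ‖θ‖) (ρ := ‖θ‖) (norm_nonneg _) (norm_nonneg _) fun n => ?_
  · rw [sinhcS, PowerSeries.coeff_mk, sinhS, PowerSeries.coeff_C_mul, map_sub, expS_eq, expS_eq,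
      PowerSeries.coeff_map, PowerSeries.coeff_map, coeff_ex, coeff_ex, ← Polynomial.C_sub,
      ← Polynomial.C_mul]
  · have h : ∀ z : ℂ, ‖z ^ (n + 1) / ((n + 1).factorial : ℂ)‖ ≤ ‖z‖ ^ (n + 1) := fun z => by
      rw [norm_div, norm_pow, Complex.norm_natCast]
      exact div_le_self (by positivity)
        (by exact_mod_cast Nat.one_le_iff_ne_zero.mpr (n + 1).factorial_ne_zero)
    have h1 := norm_sub_le (θ ^ (n + 1) / ((n + 1).factorial : ℂ))
      ((-θ) ^ (n + 1) / ((n + 1).factorial : ℂ))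
    have h2 := h θ
    have h3 := h (-θ)
    rw [norm_neg] at h3
    rw [norm_mul, ← pow_succ']
    norm_num at h1 h2 h3 ⊢
    linarith

theorem geo_den (θ : ℂ) : Geo (den θ) := by
  have : den θ = coshS θ + (u * d) * sinhcS θ := by
    rw [den, ← d_mul_sinhcS]; ring
  rw [this]
  exact (geo_coshS θ).add (geo_u_mul_d.mul (geo_sinhcS θ))

/-- Linear recursions with geometric coefficients have geometric solutions. -/
theorem geometric_of_recursion {x : ℕ → ℝ} {K ρ : ℝ} (hK : 0 ≤ K) (hρ : 0 < ρ) {B : ℝ}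
    (hB : 0 ≤ B) (h0 : x 0 ≤ B)
    (h : ∀ n, x (n + 1) ≤ K * ∑ j ∈ Finset.range (n + 1), ρ ^ (n + 1 - j) * x j) (n : ℕ) :
    x n ≤ B * (ρ * (1 + K)) ^ n := by
  induction n using Nat.strong_induction_on with
  | _ n ih =>
    rcases n with _ | n
    · simpa using h0
    · refine (h n).trans ?_
      have h1 : ∀ j ∈ Finset.range (n + 1), ρ ^ (n + 1 - j) * x j
          ≤ B * ρ ^ (n + 1) * (1 + K) ^ j := by
        intro j hj
        have hj' : j < n + 1 := by simpa using hj
        calc _ ≤ ρ ^ (n + 1 - j) * (B * (ρ * (1 + K)) ^ j) := by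
              gcongr
              exact ih j hj'
          _ = B * (ρ ^ (n + 1 - j) * ρ ^ j) * (1 + K) ^ j := by rw [mul_pow]; ring
          _ = _ := by rw [← pow_add, Nat.sub_add_cancel hj'.le]
      have h2 := geom_sum_mul (1 + K) (n + 1)
      rw [add_sub_cancel_left] at h2
      refine (mul_le_mul_of_nonneg_left (Finset.sum_le_sum h1) hK).trans ?_
      rw [← Finset.mul_sum, mul_pow]
      have h3 : 0 ≤ B * ρ ^ (n + 1) := by positivity
      calc _ = B * ρ ^ (n + 1) * ((∑ i ∈ Finset.range (n + 1), (1 + K) ^ i) * K) := by ring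
        _ = B * ρ ^ (n + 1) * ((1 + K) ^ (n + 1) - 1) := by rw [h2]
        _ ≤ _ := by linarith

/-- Comparing coefficients in V · V⁻¹ = 1 gives a linear recursion with geometric kernel, to which
`geometric_of_recursion` applies. -/
theorem geo_inv {V : PSeries} (hV : Geo V) (h1 : PowerSeries.constantCoeff V = 1) :
    Geo (inv V) := by
  obtain ⟨gV, K, ρ, hK, hρ, h⟩ := hV
  have hm := mul_inv V h1
  have hV0 : PowerSeries.coeff 0 V = 1 := by simpa using h1
  have h0 : PowerSeries.coeff 0 (inv V) = 1 := by
    have := congrArg PowerSeries.constantCoeff hm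
    rw [map_mul, h1, one_mul, map_one] at this
    simpa using this
  have hrec : ∀ n, PowerSeries.coeff (n + 1) (inv V) = -∑ x ∈ antidiagonal n,
      PowerSeries.coeff (x.1 + 1) V * PowerSeries.coeff x.2 (inv V) := by
    intro n
    have := congrArg (PowerSeries.coeff (n + 1)) hm
    rw [PowerSeries.coeff_mul, Finset.Nat.sum_antidiagonal_succ, PowerSeries.coeff_one,
      if_neg (Nat.succ_ne_zero n), hV0, one_mul] at this
    exact eq_neg_of_add_eq_zero_left this
  have gI : Gr (inv V) := by
    intro n
    induction n using Nat.strong_induction_on with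
    | _ n ih =>
      rcases n with _ | n
      · simp [h0]
      · rw [hrec, Polynomial.natDegree_neg]
        refine Polynomial.natDegree_sum_le_of_forall_le _ _ fun x hx => ?_
        rw [Finset.HasAntidiagonal.mem_antidiagonal] at hx
        have := Polynomial.natDegree_mul_le.trans
          (add_le_add (gV (x.1 + 1)) (ih x.2 (by omega)))
        omega
  have hmK := one_le_mulK
  refine ⟨gI, tauNorm 0 1 + 1, ρ * (1 + mulK * K), by linarith [tauNorm_nonneg 0 1], ?_, ?_⟩
  · nlinarith [mul_nonneg (by linarith : (0 : ℝ) ≤ mulK) (by linarith : (0 : ℝ) ≤ K)]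
  · refine geometric_of_recursion (x := fun n => nu n (inv V)) (by positivity)
      (by linarith) (by linarith [tauNorm_nonneg 0 1]) ?_ fun n => ?_
    · simp only [nu, h0]
      linarith
    · simp only [nu]
      rw [hrec, tauNorm_neg]
      refine (tauNorm_sum_le _ _ _).trans ?_
      have e := Finset.Nat.sum_antidiagonal_eq_sum_range_succ_mk (fun x : ℕ × ℕ =>
        tauNorm (n + 1) (PowerSeries.coeff (x.2 + 1) V * PowerSeries.coeff x.1 (inv V))) n
      rw [← Finset.Nat.sum_antidiagonal_swap]
      simp only [Prod.fst_swap, Prod.snd_swap]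
      rw [e, Finset.mul_sum]
      refine Finset.sum_le_sum fun j hj => ?_
      have hj' : j < n + 1 := by simpa using hj
      have h5 := tauNorm_mul_le (gV (n - j + 1)) (gI j)
      rw [show n - j + 1 + j = n + 1 by omega] at h5
      refine h5.trans ?_
      have h6 := h (n - j + 1)
      rw [nu] at h6
      have h7 := tauNorm_nonneg j (PowerSeries.coeff j (inv V))
      rw [show n + 1 - j = n - j + 1 by omega]
      calc _ ≤ mulK * (K * ρ ^ (n - j + 1)) * tauNorm j (PowerSeries.coeff j (inv V)) := by
            gcongr
        _ = _ := by ring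

theorem ascFactorial_le (m k : ℕ) : (m.ascFactorial k : ℝ) ≤ k.factorial * 2 ^ (m + k) := by
  have h : m.ascFactorial k ≤ k.factorial * 2 ^ (m + k) := by
    refine (ascFactorial_mono k (Nat.le_succ m)).trans ?_
    rw [Nat.succ_eq_add_one, Nat.ascFactorial_eq_factorial_mul_choose]
    gcongr
    exact Nat.choose_le_two_pow _ _
  exact_mod_cast h

/-- D^k costs at most k! 2^{m+k} on degree m, and the k! cancels against the exponential coefficient
θ^k / k!. -/
theorem Geo.op_ex {Z : PSeries} (hZ : Geo Z) (θ : ℂ) : Geo (op (ex θ) Z) := by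
  obtain ⟨gZ, K, ρ, hK, hρ, h⟩ := hZ
  have h1 : (0 : ℝ) ≤ ‖θ‖ := norm_nonneg _
  refine ⟨gZ.op _, K, 2 * (2 * ((‖θ‖ + 1) * ρ)), hK, by nlinarith, fun n => ?_⟩
  refine (nu_op_le _ _ _).trans ?_
  have h2 : ∀ x ∈ antidiagonal n, ‖PowerSeries.coeff x.1 (ex θ)‖
      * (x.2.ascFactorial x.1 * nu x.2 Z) ≤ K * (2 * ((‖θ‖ + 1) * ρ)) ^ n := by
    intro x hx
    rw [Finset.HasAntidiagonal.mem_antidiagonal] at hx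
    rw [coeff_ex, norm_div, norm_pow, Complex.norm_natCast]
    have hf : (0 : ℝ) < x.1.factorial := by exact_mod_cast x.1.factorial_pos
    calc _ ≤ ‖θ‖ ^ x.1 / x.1.factorial * (x.1.factorial * 2 ^ (x.2 + x.1) * (K * ρ ^ x.2)) := by
          gcongr
          · exact nu_nonneg _ _
          · exact ascFactorial_le _ _
          · exact h _
      _ = K * 2 ^ n * (‖θ‖ ^ x.1 * ρ ^ x.2) := by rw [add_comm x.2, hx]; field_simp
      _ ≤ K * 2 ^ n * ((‖θ‖ + 1) ^ n * ρ ^ n) := by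
          gcongr
          · calc ‖θ‖ ^ x.1 ≤ (‖θ‖ + 1) ^ x.1 := by gcongr; linarith
              _ ≤ _ := pow_le_pow_right₀ (by linarith) (by omega)
          · omega
      _ = _ := by rw [mul_pow, mul_pow]; ring
  refine (Finset.sum_le_card_nsmul _ _ _ h2).trans ?_
  rw [Finset.Nat.card_antidiagonal, nsmul_eq_mul, mul_pow 2 (2 * _)]
  have h3 : ((n + 1 : ℕ) : ℝ) ≤ 2 ^ n := by exact_mod_cast Nat.lt_two_pow_self
  calc _ ≤ (2 : ℝ) ^ n * (K * (2 * ((‖θ‖ + 1) * ρ)) ^ n) := by gcongr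
    _ = _ := by ring

/-! ### Inversion of `𝒮` -/

/-- The series `x / (2 sinh (x / 2))`. -/
def invSinh : PowerSeries ℂ := 2 * PowerSeries.rescale (1 / 2) bern - bern

/-- Partial fractions: x / (e^{x/2} - 1) - x / (e^x - 1) = x / (2 sinh(x/2)). Bounds for its
coefficients follow from those for the Bernoulli numbers. -/
theorem invSinh_mul : invSinh * (ex (1 / 2) - ex (-(1 / 2))) = PowerSeries.X := by
  have h := congrArg (PowerSeries.rescale (1 / 2 : ℂ)) bern_mul
  rw [map_mul, map_sub, rescale_ex, rescale_X, map_one, mul_one] at h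
  have h1 : ex (1 / 2) * ex (-(1 / 2)) = 1 := by rw [ex_mul, add_neg_cancel, ex_zero]
  have h2 : ex 1 = ex (1 / 2) * ex (1 / 2) := by rw [ex_mul]; norm_num
  have h3 := bern_mul
  have h4 : 2 * PowerSeries.C (1 / 2 : ℂ) = 1 := by
    rw [← map_ofNat PowerSeries.C, ← map_mul]; norm_num
  rw [h2] at h3
  rw [invSinh]
  linear_combination (2 * (ex (1 / 2) + 1) * ex (-(1 / 2))) * h - ex (-(1 / 2)) * h3
    + (PowerSeries.X * (ex (1 / 2) + 1) * ex (-(1 / 2))) * h4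
    + (PowerSeries.X - (2 * PowerSeries.rescale (1 / 2) bern - bern) * ex (1 / 2)) * h1

theorem norm_coeff_invSinh_le :
    ∃ K : ℝ, 0 < K ∧ ∀ k : ℕ, ‖PowerSeries.coeff k invSinh‖ ≤ K * ((2 * Real.pi) ^ k)⁻¹ := by
  obtain ⟨K, hK, h⟩ := norm_coeff_bern_le
  refine ⟨3 * K, by positivity, fun k => ?_⟩
  have h2 : (2 : PowerSeries ℂ) = PowerSeries.C 2 := (map_ofNat _ _).symm
  rw [invSinh, map_sub, h2, PowerSeries.coeff_C_mul, PowerSeries.coeff_rescale]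
  have h3 : ‖(1 / 2 : ℂ) ^ k‖ ≤ 1 := by
    rw [norm_pow]
    exact pow_le_one₀ (norm_nonneg _) (by norm_num)
  calc _ ≤ ‖(2 : ℂ) * ((1 / 2) ^ k * PowerSeries.coeff k bern)‖ + ‖PowerSeries.coeff k bern‖ :=
        norm_sub_le _ _
    _ ≤ 2 * (1 * ‖PowerSeries.coeff k bern‖) + ‖PowerSeries.coeff k bern‖ := by
        rw [norm_mul, norm_mul, Complex.norm_ofNat]
        gcongr
    _ ≤ _ := by linarith [h k]

/-- The right inverse of `D` on the span of the `τ_n`, `n ≥ 1`. -/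
def antiD : ℂ[X] →ₗ[ℂ] ℂ[X] :=
  tauBasis.constr ℂ fun
    | 0 => 0
    | 1 => 0
    | n + 2 => (((n : ℂ) + 1)⁻¹) • tau (n + 1)

theorem antiD_tau_add_two (n : ℕ) : antiD (tau (n + 2)) = (((n : ℂ) + 1)⁻¹) • tau (n + 1) := by
  rw [← tauBasis_apply, antiD, Module.Basis.constr_basis]

theorem antiD_tau_lt_two {n : ℕ} (h : n < 2) : antiD (tau n) = 0 := by
  rw [← tauBasis_apply, antiD, Module.Basis.constr_basis]
  interval_cases n <;> rfl

theorem antiD_D {p : ℂ[X]} (hp : tauBasis.repr p 0 = 0) : antiD (DL p) = p := by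
  have h : antiD ∘ₗ DL = LinearMap.id
      - (Finsupp.lapply 0 ∘ₗ tauBasis.repr.toLinearMap).smulRight 1 := by
    refine tauBasis.ext fun j => ?_
    rw [tauBasis_apply, LinearMap.comp_apply, DL_apply, D_tau, map_smul]
    rcases j with _ | j
    · simp [repr_tau]
      simp [tau]
    · have hj : ((j : ℂ) + 1) ≠ 0 := by exact_mod_cast Nat.succ_ne_zero j
      rw [antiD_tau_add_two]
      simp [repr_tau, smul_smul, hj]
  have h2 := congrArg (fun f => f p) h
  simpa [hp] using h2

theorem DL_pow_tau (k i : ℕ) : (DL ^ k) (tau i) = (i.ascFactorial k : ℂ) • tau (i + k) := by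
  induction k with
  | zero => simp
  | succ k ih =>
    rw [pow_succ', Module.End.mul_apply, ih, map_smul, DL_apply, D_tau, smul_smul, add_assoc,
      Nat.ascFactorial_succ]
    congr 1
    push_cast
    ring

theorem zero_ascFactorial_succ (k : ℕ) : (0 : ℕ).ascFactorial (k + 1) = 0 := by
  induction k with
  | zero => rfl
  | succ k ih => rw [Nat.ascFactorial_succ, ih, mul_zero]

theorem tauNorm_antiD_le {p : ℂ[X]} {n : ℕ} (hp : p.natDegree ≤ n + 1) :
    tauNorm n (antiD p) ≤ tauNorm (n + 1) p := by
  rw [← one_mul (tauNorm (n + 1) p)]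
  refine tauNorm_map_le antiD (fun i hi => ?_) hp
  rcases lt_or_ge i 2 with h | h
  · rw [antiD_tau_lt_two h, tauNorm_zero]
    positivity
  · obtain ⟨j, rfl⟩ := Nat.exists_eq_add_of_le' h
    rw [antiD_tau_add_two, tauNorm_smul, tauNorm_tau (by omega), norm_inv,
      show n + 1 - (j + 2) = n - (j + 1) by omega]
    gcongr
    refine inv_le_one_of_one_le₀ ?_
    norm_cast
    simp

/-- For i ≥ 1, `antiD` undoes one derivative, so that τ_i goes to i (i+1) ⋯ (i+k-1) τ_{i+k}. The
largest case i = n - k gives (n-1)(n-2) ⋯ (n-k). -/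
theorem tauNorm_antiD_DL_pow_le {p : ℂ[X]} {n k : ℕ} (hk : k < n) (hp : p.natDegree ≤ n - k) :
    tauNorm n (antiD ((DL ^ (k + 1)) p)) ≤ (n - 1).descFactorial k * tauNorm (n - k) p := by
  refine tauNorm_map_le (antiD ∘ₗ (DL ^ (k + 1))) (fun i hi => ?_) hp
  rw [LinearMap.comp_apply, DL_pow_tau, map_smul]
  rcases i with _ | i
  · rw [zero_ascFactorial_succ]
    simp only [Nat.cast_zero, zero_smul, tauNorm_zero]
    have := half_pi_pos
    positivity
  · have h1 : (i + 1).ascFactorial (k + 1) = (i + k + 1) * (i + k).descFactorial k := by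
      rw [← Nat.add_descFactorial_eq_ascFactorial, ← add_assoc, Nat.succ_descFactorial_succ]
    have h2 : ((i + k : ℕ) : ℂ) + 1 ≠ 0 := by exact_mod_cast Nat.succ_ne_zero (i + k)
    rw [show i + 1 + (k + 1) = (i + k) + 2 by ring, antiD_tau_add_two, smul_smul, tauNorm_smul, h1]
    push_cast
    rw [mul_right_comm, show (i : ℂ) + k + 1 = ((i + k : ℕ) : ℂ) + 1 by push_cast; ring,
      mul_inv_cancel₀ h2, one_mul, Complex.norm_natCast, tauNorm_tau (by omega),
      show n - (i + k + 1) = n - k - (i + 1) by omega]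
    have h3 : (i + k).descFactorial k ≤ (n - 1).descFactorial k :=
      Nat.descFactorial_le _ (by omega)
    gcongr

/-- A series without `τ_0`-component is controlled by its image under `𝒮`. -/
theorem exists_nu_le_nu_S : ∃ K : ℝ, 0 < K ∧ ∀ Z : PSeries, Gr Z →
    (∀ n, tauBasis.repr (PowerSeries.coeff n Z) 0 = 0) → ∀ n, nu n Z ≤ K * (nu (n + 1) (S Z)
      + ∑ k ∈ Finset.range n, ((2 * Real.pi) ^ (k + 1))⁻¹ *
        ((n - 1).descFactorial k * nu (n - k) (S Z))) := by
  obtain ⟨K, hK, hb⟩ := norm_coeff_invSinh_le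
  refine ⟨2 * K, by positivity, fun Z hZ h0 n => ?_⟩
  -- Applying x / (2 sinh(x/2)) at x = d D to 𝒮(Z) leaves d D Z / 2. Its coefficient at d^{n+1} is D
  -- Z_n / 2, from which `antiD` recovers Z_n.
  have h1 : op invSinh (S Z) = num (1 / 2) * op PowerSeries.X Z := by
    rw [S_eq, ← op_mul, num_mul_op, mul_left_comm, invSinh_mul]
  have h2 : PowerSeries.coeff (n + 1) (op invSinh (S Z))
      = (1 / 2 : ℂ) • DL (PowerSeries.coeff n Z) := by
    have := coeff_op_X_mul 1 Z n
    rw [mul_one, op_one] at this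
    rw [h1, PowerSeries.coeff_C_mul, this, Polynomial.smul_eq_C_mul, DL_apply]
  have h3 : PowerSeries.coeff n Z = (2 : ℂ) • antiD (PowerSeries.coeff (n + 1) (op invSinh (S Z))) := by
    rw [h2, map_smul, antiD_D (h0 n), smul_smul]
    norm_num
  have hS := hZ.S
  rw [nu, h3, tauNorm_smul, coeff_op, map_sum, Complex.norm_ofNat, mul_assoc]
  refine mul_le_mul_of_nonneg_left ?_ zero_le_two
  refine (tauNorm_sum_le _ _ _).trans ?_
  rw [Finset.Nat.sum_antidiagonal_eq_sum_range_succ_mk, Finset.sum_range_succ', mul_add, add_comm,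
    Finset.sum_range_succ]
  simp only [map_smul, tauNorm_smul]
  -- The last summand is a derivative of the constant polynomial 𝒮(Z)_0, which explains the range k
  -- < n in the claim.
  have hlast : antiD ((DL ^ (n + 1)) (PowerSeries.coeff (n + 1 - (n + 1)) (S Z))) = 0 := by
    rw [Nat.sub_self]
    have h5 := eq_sum_repr (hS 0)
    rw [h5, map_sum, map_sum]
    refine Finset.sum_eq_zero fun i hi => ?_
    have : i = 0 := by simpa using hi
    subst this
    rw [map_smul, DL_pow_tau, zero_ascFactorial_succ]
    simp
  rw [hlast, tauNorm_zero, mul_zero, add_zero]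
  refine add_le_add ?_ ?_
  · have h6 := hb 0
    rw [pow_zero, inv_one, mul_one] at h6
    have h7 : tauNorm n (antiD (PowerSeries.coeff (n + 1) (S Z))) ≤ nu (n + 1) (S Z) :=
      tauNorm_antiD_le (hS _)
    simp only [pow_zero, Nat.sub_zero, Module.End.one_apply]
    exact mul_le_mul h6 h7 (tauNorm_nonneg _ _) hK.le
  · rw [Finset.mul_sum]
    refine Finset.sum_le_sum fun k hk => ?_
    have hk' : k < n := by simpa using hk
    have h8 := tauNorm_antiD_DL_pow_le hk' (hS (n - k))
    rw [show n + 1 - (k + 1) = n - k by omega, ← mul_assoc K]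
    exact mul_le_mul (hb _) h8 (tauNorm_nonneg _ _) (by positivity)

/-! ### Division by `1 - u²` -/

theorem nu_le_of_omega_mul {Y Z : PSeries} (hY : Gr Y) (h : Z = (1 - u ^ 2) * d ^ 2 * Y) (n : ℕ) :
    nu n Y ≤ 3 * Real.exp Real.pi * nu (n + 2) Z := by
  have h1 : PowerSeries.coeff (n + 2) Z = (1 - Polynomial.X ^ 2) * PowerSeries.coeff n Y := by
    have hu : (1 - u ^ 2 : PSeries) = pol (1 - Polynomial.X ^ 2) := by simp [u]
    rw [h, hu, mul_assoc, PowerSeries.coeff_C_mul, sq d, mul_assoc, coeff_d_mul, coeff_d_mul]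
  rw [nu, nu, h1]
  exact tauNorm_le_of_mul (hY n)

/-! ### Trigonometric functions of series -/

theorem subst_eq_subst_map {w : PSeries} (hw : PowerSeries.HasSubst w) (f : PowerSeries ℂ) :
    PowerSeries.subst w f = PowerSeries.subst w (PowerSeries.map (Polynomial.C : ℂ →+* ℂ[X]) f) := by
  ext1 n
  rw [PowerSeries.coeff_subst' hw, PowerSeries.coeff_subst' hw]
  refine finsum_congr fun k => ?_
  rw [PowerSeries.coeff_map, Polynomial.smul_eq_C_mul, smul_eq_mul]

theorem der_subst {w : PSeries} (hw : PowerSeries.HasSubst w) (f : PowerSeries ℂ) :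
    der (PowerSeries.subst w f) = PowerSeries.subst w (PowerSeries.derivative ℂ f) * der w := by
  have h : PowerSeries.derivative ℂ[X] (PowerSeries.map (Polynomial.C : ℂ →+* ℂ[X]) f)
      = PowerSeries.map (Polynomial.C : ℂ →+* ℂ[X]) (PowerSeries.derivative ℂ f) := by
    ext1 n
    simp [PowerSeries.coeff_derivative]
  rw [subst_eq_subst_map hw f, subst_eq_subst_map hw (PowerSeries.derivative ℂ f), ← h]
  exact PowerSeries.derivative_subst hw

theorem derivative_cosSqrt :
    PowerSeries.derivative ℂ cosSqrt = PowerSeries.C (-(1 / 2)) * sincSqrt := by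
  ext n
  rw [PowerSeries.coeff_derivative, PowerSeries.coeff_C_mul, cosSqrt, sincSqrt,
    PowerSeries.coeff_mk, PowerSeries.coeff_mk, show 2 * (n + 1) = (2 * n + 1) + 1 by ring,
    Nat.factorial_succ (2 * n + 1)]
  have h1 : ((2 * n + 1).factorial : ℂ) ≠ 0 := by exact_mod_cast Nat.factorial_ne_zero _
  have h2 : ((n : ℂ) + 1) ≠ 0 := by exact_mod_cast Nat.succ_ne_zero n
  have h3 : ((2 * n + 1 + 1 : ℕ) : ℂ) = 2 * (n + 1) := by push_cast; ring
  rw [Nat.cast_mul, h3]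
  field_simp
  ring

theorem derivative_sincSqrt :
    2 * (PowerSeries.X * PowerSeries.derivative ℂ sincSqrt) = cosSqrt - sincSqrt := by
  have h2 : (2 : PowerSeries ℂ) = PowerSeries.C 2 := (map_ofNat _ _).symm
  ext n
  rw [h2, PowerSeries.coeff_C_mul, map_sub, cosSqrt, sincSqrt, PowerSeries.coeff_mk,
    PowerSeries.coeff_mk]
  have h1 : ((2 * n).factorial : ℂ) ≠ 0 := by exact_mod_cast Nat.factorial_ne_zero _
  have h3 : ((2 * n : ℂ) + 1) ≠ 0 := by exact_mod_cast Nat.succ_ne_zero (2 * n)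
  have h4 : ((2 * n + 1).factorial : ℂ) = (2 * n + 1) * (2 * n).factorial := by
    rw [Nat.factorial_succ]; push_cast; ring
  cases n with
  | zero => simp
  | succ n =>
    rw [PowerSeries.coeff_succ_X_mul, PowerSeries.coeff_derivative, PowerSeries.coeff_mk, h4]
    push_cast at h3 ⊢
    field_simp
    ring

theorem hasSubst_sq {A : PSeries} (hA : PowerSeries.constantCoeff A = 0) :
    PowerSeries.HasSubst ((1 - u ^ 2) * A ^ 2) :=
  PowerSeries.HasSubst.of_constantCoeff_zero' (by simp [hA])

theorem der_omega_mul_sq (A : PSeries) :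
    der ((1 - u ^ 2) * A ^ 2) = 2 * ((1 - u ^ 2) * A * der A) := by
  rw [der_mul, der_sub, der_pow, der_pow, derivative_u, der_one]
  push_cast
  ring

/-- Chain rule in w = (1 - u²) A². Working with cos √w and sin √w / √w keeps all coefficients
polynomial in u. -/
theorem der_cosA {A : PSeries} (hA : PowerSeries.constantCoeff A = 0) :
    der (cosA A) = -((1 - u ^ 2) * sinA A * der A) := by
  have hw := hasSubst_sq hA
  have hh := two_mul_num_half
  have hc : PowerSeries.subst ((1 - u ^ 2) * A ^ 2) (PowerSeries.C (-(1 / 2) : ℂ))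
      = num (-(1 / 2)) := by
    rw [subst_eq_subst_map hw, PowerSeries.map_C]
    exact PowerSeries.subst_C _
  rw [cosA, der_subst hw, derivative_cosSqrt, PowerSeries.subst_mul hw, hc, der_omega_mul_sq A,
    sinA, num_neg]
  linear_combination (-((1 - u ^ 2) * A * der A) *
    PowerSeries.subst ((1 - u ^ 2) * A ^ 2) sincSqrt) * hh

theorem der_sinA {A : PSeries} (hA : PowerSeries.constantCoeff A = 0) :
    der (sinA A) = cosA A * der A := by
  have hw := hasSubst_sq hA
  have h := congrArg (PowerSeries.subst ((1 - u ^ 2) * A ^ 2)) derivative_sincSqrt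
  have h2 : (2 : PowerSeries ℂ) = PowerSeries.C 2 := (map_ofNat _ _).symm
  have hc : PowerSeries.subst ((1 - u ^ 2) * A ^ 2) (PowerSeries.C (2 : ℂ)) = 2 := by
    rw [subst_eq_subst_map hw, PowerSeries.map_C]
    refine (PowerSeries.subst_C _).trans ?_
    exact (map_ofNat (PowerSeries.C (R := ℂ[X]).comp Polynomial.C) 2)
  rw [PowerSeries.subst_sub hw, h2, PowerSeries.subst_mul hw, PowerSeries.subst_mul hw, hc,
    PowerSeries.subst_X hw] at h
  rw [sinA, der_mul, der_subst hw, der_omega_mul_sq A, cosA]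
  linear_combination der A * h

theorem constantCoeff_cosA {A : PSeries} (hA : PowerSeries.constantCoeff A = 0) :
    PowerSeries.constantCoeff (cosA A) = 1 := by
  have hw := hasSubst_sq hA
  have h := PowerSeries.sub_const_eq_X_mul_shift cosSqrt
  have h0 : PowerSeries.constantCoeff cosSqrt = 1 := by
    rw [← PowerSeries.coeff_zero_eq_constantCoeff_apply, cosSqrt, PowerSeries.coeff_mk]
    simp
  rw [h0, map_one, sub_eq_iff_eq_add] at h
  have h1 : PowerSeries.subst ((1 - u ^ 2) * A ^ 2) (1 : PowerSeries ℂ) = 1 := by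
    rw [← PowerSeries.coe_substAlgHom hw, map_one]
  rw [cosA, h, PowerSeries.subst_add hw, PowerSeries.subst_mul hw, PowerSeries.subst_X hw, h1]
  simp [hA]

theorem constantCoeff_sinA {A : PSeries} (hA : PowerSeries.constantCoeff A = 0) :
    PowerSeries.constantCoeff (sinA A) = 0 := by
  rw [sinA, map_mul, hA, zero_mul]

theorem eq_of_der_eq {Y Z : PSeries} (h : der Y = der Z)
    (h0 : PowerSeries.constantCoeff Y = PowerSeries.constantCoeff Z) : Y = Z := by
  ext1 n
  cases n with
  | zero => simpa using h0
  | succ n =>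
    have h1 := congrArg (PowerSeries.coeff n) h
    rw [coeff_der, coeff_der] at h1
    exact mul_right_cancel₀ (by exact_mod_cast Nat.succ_ne_zero n) h1

theorem der_omega : der (1 - u ^ 2) = 0 := by
  rw [der_sub, der_pow, derivative_u, der_one]
  simp

theorem cosA_sq_add {A : PSeries} (hA : PowerSeries.constantCoeff A = 0) :
    cosA A ^ 2 + (1 - u ^ 2) * sinA A ^ 2 = 1 := by
  refine eq_of_der_eq ?_ ?_
  · rw [der_add, der_mul, der_pow, der_pow, der_omega, der_one, der_cosA hA, der_sinA hA]
    push_cast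
    ring
  · simp [constantCoeff_cosA hA, constantCoeff_sinA hA]

/-- `cos ((A - B) √(1-u²))` by the addition theorem. -/
def cosDiff (A B : PSeries) : PSeries := cosA B * cosA A + (1 - u ^ 2) * (sinA B * sinA A)

/-- `sin ((A - B) √(1-u²)) / √(1-u²)` by the addition theorem. -/
def sinDiff (A B : PSeries) : PSeries := cosA B * sinA A - sinA B * cosA A

/-- The addition theorem for A = B + (A - B). With B = U it separates the known part of the solution
from F. -/
theorem cosA_eq {A B : PSeries} (hB : PowerSeries.constantCoeff B = 0) :
    cosA A = cosA B * cosDiff A B - (1 - u ^ 2) * (sinA B * sinDiff A B) := by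
  rw [cosDiff, sinDiff]
  linear_combination (-cosA A) * cosA_sq_add hB

theorem sinA_eq {A B : PSeries} (hB : PowerSeries.constantCoeff B = 0) :
    sinA A = sinA B * cosDiff A B + cosA B * sinDiff A B := by
  rw [cosDiff, sinDiff]
  linear_combination (-sinA A) * cosA_sq_add hB

theorem der_cosDiff {A B : PSeries} (hA : PowerSeries.constantCoeff A = 0)
    (hB : PowerSeries.constantCoeff B = 0) :
    der (cosDiff A B) = -((1 - u ^ 2) * sinDiff A B * der (A - B)) := by
  rw [cosDiff, sinDiff, der_add, der_mul, der_mul, der_mul, der_omega, der_sub, der_cosA hA,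
    der_cosA hB, der_sinA hA, der_sinA hB]
  ring

theorem der_sinDiff {A B : PSeries} (hA : PowerSeries.constantCoeff A = 0)
    (hB : PowerSeries.constantCoeff B = 0) :
    der (sinDiff A B) = cosDiff A B * der (A - B) := by
  rw [cosDiff, sinDiff, der_sub, der_mul, der_mul, der_sub, der_cosA hA,
    der_cosA hB, der_sinA hA, der_sinA hB]
  ring

/-! ### Growth of trigonometric functions -/

theorem natDegree_coeff_mul_le {Y Z : PSeries} {n : ℕ}
    (hY : ∀ i ≤ n, (PowerSeries.coeff i Y).natDegree ≤ i)
    (hZ : ∀ i ≤ n, (PowerSeries.coeff i Z).natDegree ≤ i) :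
    (PowerSeries.coeff n (Y * Z)).natDegree ≤ n := by
  rw [PowerSeries.coeff_mul]
  refine Polynomial.natDegree_sum_le_of_forall_le _ _ fun x hx => ?_
  rw [Finset.HasAntidiagonal.mem_antidiagonal] at hx
  exact Polynomial.natDegree_mul_le.trans (hx ▸ add_le_add (hY _ (by omega)) (hZ _ (by omega)))

theorem coeff_der_d_mul (φ : PSeries) (n : ℕ) :
    PowerSeries.coeff n (der (d * φ)) = ((n : ℂ) + 1) • PowerSeries.coeff n φ := by
  rw [coeff_der, coeff_d_mul, Polynomial.smul_eq_C_mul, mul_comm]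
  simp

theorem Gr.der_d_mul {φ : PSeries} (h : Gr φ) : Gr (der (d * φ)) := fun n => by
  rw [coeff_der_d_mul]
  exact (Polynomial.natDegree_smul_le _ _).trans (h n)

theorem nu_der_d_mul (φ : PSeries) (n : ℕ) : nu n (der (d * φ)) = ((n : ℝ) + 1) * nu n φ := by
  rw [nu, coeff_der_d_mul, tauNorm_smul, nu]
  congr 1
  norm_cast

theorem sum_der_d_mul_le (Y φ : PSeries) (n : ℕ) :
    ∑ x ∈ antidiagonal n, nu x.1 Y * nu x.2 (der (d * φ))
      ≤ ((n : ℝ) + 1) * ∑ x ∈ antidiagonal n, nu x.1 Y * nu x.2 φ := by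
  rw [Finset.mul_sum]
  refine Finset.sum_le_sum fun x hx => ?_
  rw [Finset.HasAntidiagonal.mem_antidiagonal] at hx
  rw [nu_der_d_mul, mul_left_comm]
  have h : (x.2 : ℝ) ≤ n := by exact_mod_cast (by omega : x.2 ≤ n)
  have := mul_nonneg (nu_nonneg x.1 Y) (nu_nonneg x.2 φ)
  gcongr

/-- Integrated form of the cosine equation. The factor (1 - u²) d² raises order and degree by two,
so the coefficient of c at n + 2 depends only on s and φ up to n. -/
theorem smul_coeff_of_der_eq {c s φ : PSeries} (h : der c = -((1 - u ^ 2) * (d * s) * der (d * φ)))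
    (n : ℕ) : ((n : ℂ) + 2) • PowerSeries.coeff (n + 2) c
      = -((1 - Polynomial.X ^ 2) * PowerSeries.coeff n (s * der (d * φ))) := by
  have hu : (1 - u ^ 2 : PSeries) = pol (1 - Polynomial.X ^ 2) := by simp [u]
  have h1 := congrArg (PowerSeries.coeff (n + 1)) h
  rw [coeff_der, map_neg, hu, mul_assoc, PowerSeries.coeff_C_mul, mul_assoc, coeff_d_mul] at h1
  rw [← h1, Polynomial.smul_eq_C_mul, mul_comm]
  congr 1
  simp only [map_add, map_natCast, map_ofNat]
  push_cast
  ring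

theorem coeff_one_of_der_eq {c s φ : PSeries}
    (h : der c = -((1 - u ^ 2) * (d * s) * der (d * φ))) : PowerSeries.coeff 1 c = 0 := by
  have h1 := congrArg (PowerSeries.coeff 0) h
  rw [coeff_der] at h1
  simpa [d] using h1

theorem smul_coeff_of_der_eq' {c s φ : PSeries} (h : der (d * s) = c * der (d * φ))
    (n : ℕ) : ((n : ℂ) + 1) • PowerSeries.coeff n s = PowerSeries.coeff n (c * der (d * φ)) := by
  rw [← h, coeff_der_d_mul]

theorem natDegree_le_of_smul {p : ℂ[X]} {c : ℂ} (hc : c ≠ 0) {n : ℕ}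
    (h : (c • p).natDegree ≤ n) : p.natDegree ≤ n := by
  rw [← inv_smul_smul₀ hc p]
  exact (Polynomial.natDegree_smul_le _ _).trans h

/-- The pair (c, s) solves a triangular system: the coefficient c_n comes from lower coefficients of
s, and then s_n from the coefficients of c up to n. -/
theorem gr_of_der_eq {c s φ : PSeries} (hφ : Gr φ)
    (h : der c = -((1 - u ^ 2) * (d * s) * der (d * φ))) (h' : der (d * s) = c * der (d * φ))
    (h0 : PowerSeries.constantCoeff c = 1) : Gr c ∧ Gr s := by
  have key : ∀ n, (PowerSeries.coeff n c).natDegree ≤ n ∧ (PowerSeries.coeff n s).natDegree ≤ n := by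
    intro n
    induction n using Nat.strong_induction_on with
    | _ n ih =>
      have hc : (PowerSeries.coeff n c).natDegree ≤ n := by
        rcases n with _ | _ | n
        · simp [h0]
        · rw [zero_add, coeff_one_of_der_eq h]
          simp
        · have h2 : ((n : ℂ) + 2) ≠ 0 := by exact_mod_cast Nat.succ_ne_zero (n + 1)
          refine natDegree_le_of_smul h2 ?_
          rw [smul_coeff_of_der_eq h, Polynomial.natDegree_neg]
          refine Polynomial.natDegree_mul_le.trans ?_
          rw [natDegree_one_sub_X_sq, add_comm]
          exact Nat.add_le_add_right (natDegree_coeff_mul_le (fun i hi => (ih i (by omega)).2)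
            fun i _ => hφ.der_d_mul i) 2
      refine ⟨hc, ?_⟩
      have h1 : ((n : ℂ) + 1) ≠ 0 := by exact_mod_cast Nat.succ_ne_zero n
      refine natDegree_le_of_smul h1 ?_
      rw [smul_coeff_of_der_eq' h']
      refine natDegree_coeff_mul_le (fun i hi => ?_) fun i _ => hφ.der_d_mul i
      rcases hi.lt_or_eq with hlt | rfl
      · exact (ih i hlt).1
      · exact hc
  exact ⟨fun n => (key n).1, fun n => (key n).2⟩

/-- Nothing is lost by differentiating φ: the factor at most n + 1 from the derivative of d φ is
compensated by the division by n + 2 in the integration. -/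
theorem nu_add_two_le_of_der_eq {c s φ : PSeries} (hφ : Gr φ) (hs : Gr s)
    (h : der c = -((1 - u ^ 2) * (d * s) * der (d * φ))) (n : ℕ) :
    nu (n + 2) c ≤ mulK ^ 2 * ∑ x ∈ antidiagonal n, nu x.1 s * nu x.2 φ := by
  have h1 := congrArg (tauNorm (2 + n)) (smul_coeff_of_der_eq h n)
  have hg := hs.mul hφ.der_d_mul
  have h2 := tauNorm_mul_le (m := 2) natDegree_one_sub_X_sq.le (hg n)
  have h3 : (1 - Polynomial.X ^ 2 : ℂ[X]) = tau 2 := by simp [tau, D]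
  have h4 := nu_mul_le hs hφ.der_d_mul n
  have h5 := sum_der_d_mul_le s φ n
  have hK := one_le_mulK
  have h7 : 0 ≤ ∑ x ∈ antidiagonal n, nu x.1 s * nu x.2 φ :=
    Finset.sum_nonneg fun x _ => mul_nonneg (nu_nonneg _ _) (nu_nonneg _ _)
  rw [tauNorm_smul, tauNorm_neg] at h1
  rw [← h1, h3, tauNorm_tau le_rfl, Nat.sub_self, pow_zero, mul_one, add_comm 2 n] at h2
  have h6 : ‖(n : ℂ) + 2‖ = (n : ℝ) + 2 := by norm_cast
  rw [h6] at h2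
  change ((n : ℝ) + 2) * nu (n + 2) c ≤ mulK * nu n (s * der (d * φ)) at h2
  generalize (∑ x ∈ antidiagonal n, nu x.1 s * nu x.2 φ) = W at h5 h7 ⊢
  generalize (∑ x ∈ antidiagonal n, nu x.1 s * nu x.2 (der (d * φ))) = V at h4 h5
  generalize nu n (s * der (d * φ)) = y at h2 h4
  have hn : (0 : ℝ) ≤ n := n.cast_nonneg
  have h9 : mulK * y ≤ mulK * (mulK * (((n : ℝ) + 1) * W)) := by
    have hM : 0 ≤ mulK := by linarith
    exact mul_le_mul_of_nonneg_left (h4.trans (mul_le_mul_of_nonneg_left h5 hM)) hM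
  have h10 : 0 ≤ mulK ^ 2 * W := by positivity
  refine le_of_mul_le_mul_left (a := (n : ℝ) + 2) ?_ (by linarith)
  linarith

theorem nu_le_of_der_eq' {c s φ : PSeries} (hφ : Gr φ) (hc : Gr c)
    (h : der (d * s) = c * der (d * φ)) (n : ℕ) :
    nu n s ≤ mulK * ∑ x ∈ antidiagonal n, nu x.1 c * nu x.2 φ := by
  have h1 := congrArg (tauNorm n) (smul_coeff_of_der_eq' h n)
  have h4 := nu_mul_le hc hφ.der_d_mul n
  have h5 := sum_der_d_mul_le c φ n
  have hK := one_le_mulK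
  have h6 : ‖(n : ℂ) + 1‖ = (n : ℝ) + 1 := by norm_cast
  rw [tauNorm_smul, h6] at h1
  change ((n : ℝ) + 1) * nu n s = nu n (c * der (d * φ)) at h1
  rw [← h1] at h4
  have hn : (0 : ℝ) ≤ n := n.cast_nonneg
  have h8 : ((n : ℝ) + 1) * nu n s
      ≤ ((n : ℝ) + 1) * (mulK * ∑ x ∈ antidiagonal n, nu x.1 c * nu x.2 φ) := by
    refine h4.trans ((mul_le_mul_of_nonneg_left h5 (by linarith)).trans (le_of_eq ?_))
    ring
  exact le_of_mul_le_mul_left h8 (by linarith)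

theorem geo_of_der_eq {c s φ : PSeries} (hφ : Geo φ)
    (h : der c = -((1 - u ^ 2) * (d * s) * der (d * φ))) (h' : der (d * s) = c * der (d * φ))
    (h0 : PowerSeries.constantCoeff c = 1) : Geo c ∧ Geo s := by
  obtain ⟨gφ, K, ρ, hK, hρ, hb⟩ := hφ
  obtain ⟨gc, gs⟩ := gr_of_der_eq gφ h h' h0
  have hm := one_le_mulK
  have hM2 : 0 ≤ mulK ^ 2 * K := by positivity
  have hM1 : 0 ≤ mulK * K := mul_nonneg (by linarith) (by linarith)
  set y : ℕ → ℝ := fun n => nu n c + nu n s with hy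
  set T : ℕ → ℝ := fun n => ∑ j ∈ Finset.range n, ρ ^ (n - j) * y j with hT
  have hy0 : ∀ n, 0 ≤ y n := fun n => add_nonneg (nu_nonneg _ _) (nu_nonneg _ _)
  have hT0 : ∀ n, 0 ≤ T n := fun n => Finset.sum_nonneg fun j _ => mul_nonneg (by positivity) (hy0 j)
  have hconv : ∀ (Y : PSeries) (n : ℕ), ∑ x ∈ antidiagonal n, nu x.1 Y * nu x.2 φ
      ≤ K * ∑ j ∈ Finset.range (n + 1), ρ ^ (n - j) * nu j Y := by
    intro Y n
    rw [Finset.Nat.sum_antidiagonal_eq_sum_range_succ_mk, Finset.mul_sum]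
    refine Finset.sum_le_sum fun j _ => ?_
    calc _ ≤ nu j Y * (K * ρ ^ (n - j)) := mul_le_mul_of_nonneg_left (hb _) (nu_nonneg _ _)
      _ = _ := by ring
  have ha : ∀ n, nu (n + 1) c ≤ mulK ^ 2 * K * T (n + 1) := by
    intro n
    rcases n with _ | n
    · have h1 := coeff_one_of_der_eq h
      rw [zero_add, nu, h1, tauNorm_zero]
      exact mul_nonneg hM2 (hT0 1)
    · refine (nu_add_two_le_of_der_eq gφ gs h n).trans ?_
      rw [mul_assoc]
      refine mul_le_mul_of_nonneg_left ((hconv s n).trans ?_) (by positivity)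
      refine mul_le_mul_of_nonneg_left ?_ (by linarith)
      calc _ ≤ ∑ j ∈ Finset.range (n + 1), ρ ^ (n + 1 + 1 - j) * y j := by
            refine Finset.sum_le_sum fun j _ => ?_
            refine mul_le_mul (pow_le_pow_right₀ hρ (by omega)) ?_ (nu_nonneg _ _) (by positivity)
            exact le_add_of_nonneg_left (nu_nonneg _ _)
        _ ≤ _ := Finset.sum_le_sum_of_subset_of_nonneg (Finset.range_mono (by omega))
            fun j _ _ => mul_nonneg (by positivity) (hy0 j)
  -- The convolution for s at n + 1 contains c at the same index; that term is eliminated by its own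
  -- bound, so only indices at most n remain.
  have hb' : ∀ n, nu (n + 1) s ≤ mulK * K * (T (n + 1) + mulK ^ 2 * K * T (n + 1)) := by
    intro n
    refine (nu_le_of_der_eq' gφ gc h' (n + 1)).trans ?_
    rw [mul_assoc]
    refine mul_le_mul_of_nonneg_left ((hconv c (n + 1)).trans ?_) (by linarith)
    refine mul_le_mul_of_nonneg_left ?_ (by linarith)
    rw [Finset.sum_range_succ, Nat.sub_self, pow_zero, one_mul]
    refine add_le_add (Finset.sum_le_sum fun j _ => ?_) (ha n)
    exact mul_le_mul_of_nonneg_left (le_add_of_nonneg_right (nu_nonneg _ _)) (by positivity)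
  set M : ℝ := mulK ^ 2 * K + mulK * K * (1 + mulK ^ 2 * K) with hM
  have hM0 : 0 ≤ M := by positivity
  have hfin := geometric_of_recursion (x := y) (K := M) (ρ := ρ) hM0 (by linarith) (hy0 0) le_rfl
    (fun n => by
      have h1 := ha n
      have h2 := hb' n
      have h3 : y (n + 1) ≤ M * T (n + 1) := by
        simp only [hy, hM]
        linarith
      exact h3)
  have h1 : 1 ≤ ρ * (1 + M) := by nlinarith
  have hle : ∀ n, y n ≤ (y 0 + 1) * (ρ * (1 + M)) ^ n := fun n => by
    refine (hfin n).trans ?_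
    gcongr
    linarith
  refine ⟨⟨gc, y 0 + 1, ρ * (1 + M), by linarith [hy0 0], h1, fun n => ?_⟩,
    ⟨gs, y 0 + 1, ρ * (1 + M), by linarith [hy0 0], h1, fun n => ?_⟩⟩
  · exact (le_add_of_nonneg_right (nu_nonneg _ _)).trans (hle n)
  · exact (le_add_of_nonneg_left (nu_nonneg _ _)).trans (hle n)

/-- `sin (d B √(1-u²)) / (d √(1-u²))`. -/
def sinD (B : PSeries) : PSeries := B * PowerSeries.subst ((1 - u ^ 2) * (d * B) ^ 2) sincSqrt

theorem d_mul_sinD (B : PSeries) : d * sinD B = sinA (d * B) := by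
  rw [sinD, sinA, mul_assoc]

theorem constantCoeff_d_mul (B : PSeries) : PowerSeries.constantCoeff (d * B) = 0 := by
  simp [d]

theorem der_cosA_d_mul (B : PSeries) :
    der (cosA (d * B)) = -((1 - u ^ 2) * (d * sinD B) * der (d * B)) := by
  rw [der_cosA (constantCoeff_d_mul B), d_mul_sinD]

theorem der_d_mul_sinD (B : PSeries) : der (d * sinD B) = cosA (d * B) * der (d * B) := by
  rw [d_mul_sinD, der_sinA (constantCoeff_d_mul B)]

theorem Gr.trig {B : PSeries} (hB : Gr B) : Gr (cosA (d * B)) ∧ Gr (sinD B) :=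
  gr_of_der_eq hB (der_cosA_d_mul B) (der_d_mul_sinD B) (constantCoeff_cosA (constantCoeff_d_mul B))

theorem Geo.trig {B : PSeries} (hB : Geo B) : Geo (cosA (d * B)) ∧ Geo (sinD B) :=
  geo_of_der_eq hB (der_cosA_d_mul B) (der_d_mul_sinD B) (constantCoeff_cosA (constantCoeff_d_mul B))

/-! ### Factorial growth of scalar recursions -/

/-- `z!`, extended by `0` to the negative integers. -/
def fz (z : ℤ) : ℝ := if z < 0 then 0 else (z.toNat.factorial : ℝ)

theorem fz_natCast (n : ℕ) : fz n = n.factorial := by simp [fz]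

theorem fz_of_neg {z : ℤ} (h : z < 0) : fz z = 0 := by simp [fz, h]

theorem fz_nonneg (z : ℤ) : 0 ≤ fz z := by
  rw [fz]; split_ifs <;> positivity

theorem fz_mono {z w : ℤ} (h : z ≤ w) : fz z ≤ fz w := by
  rcases lt_or_ge z 0 with hz | hz
  · rw [fz_of_neg hz]; exact fz_nonneg w
  · rw [fz, fz, if_neg (by omega), if_neg (by omega)]
    exact_mod_cast Nat.factorial_le (by omega)

theorem factorial_mul_fz_le (j : ℕ) (z : ℤ) : j.factorial * fz (z - j) ≤ fz z := by
  rcases lt_or_ge (z - j) 0 with hz | hz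
  · rw [fz_of_neg hz, mul_zero]; exact fz_nonneg z
  · obtain ⟨m, hm⟩ := Int.eq_ofNat_of_zero_le hz
    have hz' : z = ((j + m : ℕ) : ℤ) := by push_cast; omega
    rw [hm, hz', fz_natCast, fz_natCast]
    exact_mod_cast Nat.le_of_dvd (Nat.factorial_pos _) (Nat.factorial_mul_factorial_dvd_factorial_add j m)

/-- The factorial absorbs the convolution: (x.2 + t)! is at most (n - s + t)! / (x.1 - s)!, and what
remains is an exponential series. A kernel of order s thus lowers the argument of the factorial by
s. -/
theorem sum_pow_mul_fz_le {ρ : ℝ} (hρ : 0 ≤ ρ) (s n : ℕ) (t : ℤ) :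
    ∑ x ∈ antidiagonal n, (if s ≤ x.1 then ρ ^ x.1 else 0) * fz (x.2 + t)
      ≤ ρ ^ s * Real.exp ρ * fz (n - s + t) := by
  have h : ∀ x ∈ antidiagonal n, (if s ≤ x.1 then ρ ^ x.1 else 0) * fz (x.2 + t)
      ≤ if s ≤ x.1 then ρ ^ s * fz (n - s + t) * (ρ ^ (x.1 - s) / (x.1 - s).factorial) else 0 := by
    intro x hx
    rw [Finset.HasAntidiagonal.mem_antidiagonal] at hx
    split_ifs with hs
    · have h1 := factorial_mul_fz_le (x.1 - s) (n - s + t)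
      rw [show (n : ℤ) - s + t - ((x.1 - s : ℕ) : ℤ) = x.2 + t by push_cast [hs]; omega] at h1
      have h2 : (0 : ℝ) < (x.1 - s).factorial := by exact_mod_cast Nat.factorial_pos _
      rw [mul_div_assoc', le_div_iff₀ h2]
      calc _ = ρ ^ x.1 * ((x.1 - s).factorial * fz (x.2 + t)) := by ring
        _ ≤ ρ ^ x.1 * fz (n - s + t) := by gcongr
        _ = _ := by
          rw [mul_right_comm, ← pow_add, show s + (x.1 - s) = x.1 by omega]
    · simp
  refine (Finset.sum_le_sum h).trans ?_
  rw [Finset.Nat.sum_antidiagonal_eq_sum_range_succ_mk]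
  simp only
  have h0 : 0 ≤ ρ ^ s * fz (n - s + t) := mul_nonneg (by positivity) (fz_nonneg _)
  calc _ ≤ ∑ k ∈ Finset.range (s + (n + 1)), if s ≤ k then
          ρ ^ s * fz (n - s + t) * (ρ ^ (k - s) / (k - s).factorial) else 0 :=
        Finset.sum_le_sum_of_subset_of_nonneg (Finset.range_mono (by omega)) fun k _ _ => by
          split_ifs
          · positivity
          · exact le_rfl
    _ = ∑ k ∈ Finset.range (n + 1), ρ ^ s * fz (n - s + t) * (ρ ^ k / k.factorial) := by
        rw [Finset.sum_range_add, Finset.sum_eq_zero, zero_add]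
        · refine Finset.sum_congr rfl fun k _ => ?_
          rw [if_pos (by omega), Nat.add_sub_cancel_left]
        · intro k hk
          rw [if_neg (by simpa using hk)]
    _ ≤ _ := by
        rw [← Finset.mul_sum]
        exact (mul_le_mul_of_nonneg_left (Real.sum_le_exp_of_nonneg hρ _) h0).trans
          (le_of_eq (by ring))

theorem sum_pow_mul_factorial_le {ρ : ℝ} (hρ : 0 ≤ ρ) (t n : ℕ) :
    ∑ x ∈ antidiagonal n, ρ ^ x.1 * ((x.2 + t).factorial : ℝ)
      ≤ Real.exp ρ * ((n + t).factorial : ℝ) := by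
  have h := sum_pow_mul_fz_le hρ 0 n t
  simp only [Nat.zero_le, if_true, pow_zero, one_mul, Nat.cast_zero, sub_zero, ← Nat.cast_add,
    fz_natCast] at h
  exact h

/-- The sum of `m e_m / (m - 1)!` over `m ≤ n`. -/
def wsum (e : ℕ → ℝ) (n : ℕ) : ℝ :=
  ∑ m ∈ Finset.range (n + 1), m * e m / ((m - 1).factorial : ℝ)

theorem wsum_nonneg {e : ℕ → ℝ} (he : ∀ n, 0 ≤ e n) (n : ℕ) : 0 ≤ wsum e n :=
  Finset.sum_nonneg fun m _ => by have := he m; positivity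

theorem wsum_mono {e : ℕ → ℝ} (he : ∀ n, 0 ≤ e n) {m n : ℕ} (h : m ≤ n) : wsum e m ≤ wsum e n :=
  Finset.sum_le_sum_of_subset_of_nonneg (Finset.range_mono (by omega)) fun k _ _ => by
    have := he k; positivity

theorem term_le_wsum {e : ℕ → ℝ} (he : ∀ n, 0 ≤ e n) {m n : ℕ} (h : m ≤ n) :
    m * e m / ((m - 1).factorial : ℝ) ≤ wsum e n :=
  Finset.single_le_sum (f := fun m : ℕ => m * e m / ((m - 1).factorial : ℝ))
    (fun k _ => by have := he k; positivity) (by simp; omega)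

/-! ### Two inversions of 𝒮 for scalar sequences, and factorial convolutions. -/

theorem descFactorial_mul_factorial {a b : ℕ} (h : b ≤ a) :
    (a.descFactorial b : ℝ) * (a - b).factorial = a.factorial := by
  rw [mul_comm]
  exact_mod_cast Nat.factorial_mul_descFactorial h

/-- The first inversion of `𝒮` in the scalar recursion. -/
theorem factorial_bound_of_inversion {e : ℕ → ℝ} (he : ∀ n, 0 ≤ e n) {h : ℕ → ℝ} {K : ℝ} (hK : 0 ≤ K)
    (hh : ∀ n, h n ≤ K * (e (n + 1) + ∑ k ∈ Finset.range n, (n - 1).descFactorial k * e (n - k)))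
    (n : ℕ) : h n ≤ 2 * K * ((n - 1).factorial * wsum e (n + 1)) := by
  have h1 : e (n + 1) ≤ (n - 1).factorial * wsum e (n + 1) := by
    have h2 := term_le_wsum he (le_refl (n + 1))
    rw [div_le_iff₀ (by exact_mod_cast Nat.factorial_pos _), Nat.add_sub_cancel] at h2
    have hw := wsum_nonneg he (n + 1)
    rcases n with _ | n
    · simpa using h2
    · rw [Nat.factorial_succ] at h2
      push_cast at h2
      have hn : (0 : ℝ) < (n : ℝ) + 1 := by positivity
      have h3 := he (n + 1 + 1)
      simp only [Nat.add_sub_cancel]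
      have h4 : ((n : ℝ) + 1) * e (n + 1 + 1) ≤ ((n : ℝ) + 1) * (n.factorial * wsum e (n + 1 + 1)) := by
        linarith
      exact le_of_mul_le_mul_left h4 hn
  -- The falling factorial is (n-1)! / (n-1-k)!, so with m = n - k each summand equals (n-1)! e_m /
  -- (m-1)!, a term of `wsum` up to the factor m ≥ 1.
  have h5 : ∑ k ∈ Finset.range n, ((n - 1).descFactorial k : ℝ) * e (n - k)
      ≤ (n - 1).factorial * wsum e (n + 1) := by
    have h6 : ∀ k ∈ Finset.range n, ((n - 1).descFactorial k : ℝ) * e (n - k)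
        ≤ (n - 1).factorial * (((n - k : ℕ) : ℝ) * e (n - k) / ((n - k - 1).factorial : ℝ)) := by
      intro k hk
      have hk' : k < n := by simpa using hk
      have h7 := descFactorial_mul_factorial (show k ≤ n - 1 by omega)
      rw [show n - k - 1 = n - 1 - k by omega, ← h7]
      have h8 : (0 : ℝ) < (n - 1 - k).factorial := by exact_mod_cast Nat.factorial_pos _
      have h9 : (1 : ℝ) ≤ ((n - k : ℕ) : ℝ) := by exact_mod_cast (by omega : 1 ≤ n - k)
      have h10 := he (n - k)
      calc _ ≤ ((n - 1).descFactorial k : ℝ) * (((n - k : ℕ) : ℝ) * e (n - k)) := by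
            gcongr
            exact le_mul_of_one_le_left h10 h9
        _ = _ := by field_simp
    refine (Finset.sum_le_sum h6).trans ?_
    rw [← Finset.mul_sum]
    gcongr
    have h11 := Finset.sum_range_reflect
      (fun m : ℕ => ((m + 1 : ℕ) : ℝ) * e (m + 1) / ((m + 1 - 1).factorial : ℝ)) n
    have h12 : ∑ k ∈ Finset.range n, ((n - k : ℕ) : ℝ) * e (n - k) / ((n - k - 1).factorial : ℝ)
        = ∑ m ∈ Finset.range n, ((m + 1 : ℕ) : ℝ) * e (m + 1) / ((m + 1 - 1).factorial : ℝ) := by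
      rw [← h11]
      refine Finset.sum_congr rfl fun k hk => ?_
      have hk' : k < n := by simpa using hk
      rw [show n - 1 - k + 1 = n - k by omega]
    rw [h12]
    refine le_trans ?_ (wsum_mono he (Nat.le_succ n))
    rw [wsum, Finset.sum_range_succ' (fun m : ℕ => (m : ℝ) * e m / ((m - 1).factorial : ℝ)) n]
    simp
  refine (hh n).trans ?_
  calc _ ≤ K * ((n - 1).factorial * wsum e (n + 1) + (n - 1).factorial * wsum e (n + 1)) := by
        gcongr
    _ = _ := by ring

/-- The first inversion gives h_n of size (n-1)!, and the index shift by 2 in the division by Q₁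
makes this (n+1)! for f_n. In the second inversion each of the n summands is at most of size (n+1)!,
so one more factor n appears and the total is (n+2)!. -/
theorem factorial_bound_of_two_inversions {e : ℕ → ℝ} (he : ∀ n, 0 ≤ e n) {g f h : ℕ → ℝ} {K ρ : ℝ}
    (hK : 0 ≤ K) (hρ : 0 ≤ ρ)
    (hh : ∀ n, h n ≤ K * (e (n + 1) + ∑ k ∈ Finset.range n, (n - 1).descFactorial k * e (n - k)))
    (hf : ∀ n, f n ≤ K * ∑ x ∈ antidiagonal n, ρ ^ x.1 * h (x.2 + 2))
    (hg : ∀ n, g n ≤ K * (f (n + 1) + ∑ k ∈ Finset.range n, (n - 1).descFactorial k * f (n - k)))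
    (n : ℕ) : g n ≤ 4 * K ^ 3 * Real.exp ρ * ((n + 2).factorial * wsum e (n + 4)) := by
  have h1 : ∀ n, f n ≤ 2 * K ^ 2 * Real.exp ρ * ((n + 1).factorial * wsum e (n + 3)) := by
    intro n
    refine (hf n).trans ?_
    have h2 : ∀ x ∈ antidiagonal n, ρ ^ x.1 * h (x.2 + 2)
        ≤ 2 * K * wsum e (n + 3) * (ρ ^ x.1 * ((x.2 + 1).factorial : ℝ)) := by
      intro x hx
      rw [Finset.HasAntidiagonal.mem_antidiagonal] at hx
      have h3 := factorial_bound_of_inversion he hK hh (x.2 + 2)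
      have h4 := wsum_mono he (show x.2 + 2 + 1 ≤ n + 3 by omega)
      calc _ ≤ ρ ^ x.1 * (2 * K * ((x.2 + 2 - 1).factorial * wsum e (n + 3))) := by
            gcongr
            exact h3.trans (by gcongr)
        _ = _ := by rw [show x.2 + 2 - 1 = x.2 + 1 by omega]; ring
    have h5 := wsum_nonneg he (n + 3)
    calc _ ≤ K * (2 * K * wsum e (n + 3) * (Real.exp ρ * ((n + 1).factorial : ℝ))) := by
          refine mul_le_mul_of_nonneg_left ((Finset.sum_le_sum h2).trans ?_) hK
          rw [← Finset.mul_sum]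
          exact mul_le_mul_of_nonneg_left (sum_pow_mul_factorial_le hρ 1 n) (by positivity)
      _ = _ := by ring
  have hw := wsum_nonneg he (n + 4)
  set C := 2 * K ^ 2 * Real.exp ρ with hC
  have hC0 : 0 ≤ C := by positivity
  have h6 : ∀ k ∈ Finset.range n, ((n - 1).descFactorial k : ℝ) * f (n - k)
      ≤ C * wsum e (n + 4) * (n + 1).factorial := by
    intro k hk
    have hk' : k < n := by simpa using hk
    have h7 := descFactorial_mul_factorial (show k ≤ n - 1 by omega)
    obtain ⟨m, rfl⟩ := Nat.exists_eq_add_of_lt hk'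
    simp only [show k + m + 1 - 1 = k + m by omega, show k + m - k = m by omega,
      show k + m + 1 - k = m + 1 by omega] at h7 ⊢
    have h8 := h1 (m + 1)
    have h9 := wsum_mono he (show m + 1 + 3 ≤ k + m + 1 + 4 by omega)
    calc _ ≤ ((k + m).descFactorial k : ℝ) * (C * ((m + 1 + 1).factorial * wsum e (k + m + 1 + 4))) := by
          gcongr
          exact h8.trans (by gcongr)
      _ = C * wsum e (k + m + 1 + 4) * (((m : ℝ) + 2) * (m + 1) *
            (((k + m).descFactorial k : ℝ) * m.factorial)) := by
          rw [Nat.factorial_succ, Nat.factorial_succ]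
          push_cast
          ring
      _ ≤ C * wsum e (k + m + 1 + 4) * (((k + m : ℝ) + 2) * (k + m + 1) * (k + m).factorial) := by
          rw [h7]
          have : (0 : ℝ) ≤ k := k.cast_nonneg
          gcongr <;> linarith
      _ = _ := by
          rw [Nat.factorial_succ (k + m + 1), Nat.factorial_succ (k + m)]
          push_cast
          ring
  have h10 := Finset.sum_le_card_nsmul _ _ _ h6
  rw [Finset.card_range, nsmul_eq_mul] at h10
  refine (hg n).trans ?_
  have h11 : ((n + 2).factorial : ℝ) = (n + 2) * (n + 1).factorial := by
    rw [Nat.factorial_succ]; push_cast; ring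
  have h12 := h1 (n + 1)
  simp only [show n + 1 + 1 = n + 2 by ring, show n + 1 + 3 = n + 4 by ring] at h12
  have h13 : (n : ℝ) * (C * wsum e (n + 4) * (n + 1).factorial)
      ≤ C * ((n + 2).factorial * wsum e (n + 4)) := by
    rw [h11]
    have : 0 ≤ C * wsum e (n + 4) * (n + 1).factorial := by positivity
    linarith
  calc _ ≤ K * (C * ((n + 2).factorial * wsum e (n + 4)) + C * ((n + 2).factorial * wsum e (n + 4))) := by
        gcongr
        exact h10.trans h13
    _ = _ := by rw [hC]; ring


/-- For a ≤ b the binomial C(a+b+10, a+1) is at least C(2a+2, a+1) ≥ 4^{a+1} / (2(a+1)). This gain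
of 4^a pays for 2^a and for the polynomial factor (a+9)^9. -/
theorem exists_two_pow_mul_factorial_le : ∃ C : ℝ, 1 ≤ C ∧ ∀ a b : ℕ, a ≤ b →
    (2 : ℝ) ^ (a + 7) * ((a + 9).factorial * (b + 9).factorial) ≤ C * (a + b + 10).factorial := by
  have ht : Tendsto (fun n : ℕ => (n : ℝ) ^ 9 / 2 ^ n) atTop (nhds 0) :=
    tendsto_pow_const_div_const_pow_of_one_lt 9 (by norm_num)
  obtain ⟨C, hC⟩ := ht.bddAbove_range
  have hC' : ∀ n : ℕ, (n : ℝ) ^ 9 ≤ C * 2 ^ n := fun n => by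
    have := hC ⟨n, rfl⟩
    rwa [div_le_iff₀ (by positivity)] at this
  have hC0 : 0 ≤ C := (by positivity : (0 : ℝ) ≤ (0 : ℕ) ^ 9 / 2 ^ 0).trans (hC ⟨0, rfl⟩)
  refine ⟨2 ^ 16 * C + 1, by linarith [show 0 ≤ 2 ^ 16 * C by positivity], fun a b hab => ?_⟩
  have h1 : (4 : ℝ) ^ (a + 1) ≤ 2 * (a + 1) * (a + b + 10).choose (a + 1) := by
    have h2 := Nat.four_pow_le_two_mul_self_mul_centralBinom (a + 1) (by omega)
    have h3 : (a + 1).centralBinom ≤ (a + b + 10).choose (a + 1) :=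
      Nat.choose_le_choose (a + 1) (by omega)
    calc (4 : ℝ) ^ (a + 1) ≤ ((2 * (a + 1) * (a + 1).centralBinom : ℕ) : ℝ) := by exact_mod_cast h2
      _ ≤ ((2 * (a + 1) * (a + b + 10).choose (a + 1) : ℕ) : ℝ) := by
          exact_mod_cast Nat.mul_le_mul_left _ h3
      _ = _ := by push_cast; ring
  have h4 : ((a + b + 10).choose (a + 1) : ℝ) * (a + 1).factorial * (b + 9).factorial
      = (a + b + 10).factorial := by
    have := Nat.choose_mul_factorial_mul_factorial (show a + 1 ≤ a + b + 10 by omega)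
    rw [show a + b + 10 - (a + 1) = b + 9 by omega] at this
    exact_mod_cast this
  have h5 : ((a + 9).factorial : ℝ) ≤ (a + 1).factorial * ((a + 9 : ℕ) : ℝ) ^ 8 := by
    have h6 := Nat.factorial_mul_ascFactorial (a + 1) 8
    have h7 := Nat.ascFactorial_le_pow_add (a + 1) 8
    rw [show a + 1 + 8 = a + 9 by ring] at h6 h7
    rw [← h6]
    exact_mod_cast Nat.mul_le_mul_left _ h7
  have h8 := hC' (a + 9)
  have ha : (0 : ℝ) < a + 1 := by positivity
  have h9 : ((a : ℝ) + 1) * ((a + 9 : ℕ) : ℝ) ^ 8 ≤ ((a + 9 : ℕ) : ℝ) ^ 9 := by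
    rw [pow_succ' _ 8]
    gcongr
    push_cast
    linarith
  have h10 : (4 : ℝ) ^ (a + 1) * (2 ^ (a + 7) * ((a + 9).factorial * (b + 9).factorial))
      ≤ 4 ^ (a + 1) * (2 ^ 16 * C * (a + b + 10).factorial) := by
    calc _ ≤ 2 * (a + 1) * ((a + b + 10).choose (a + 1) : ℝ) *
          (2 ^ (a + 7) * ((a + 1).factorial * ((a + 9 : ℕ) : ℝ) ^ 8 * (b + 9).factorial)) := by
          gcongr
      _ = 2 ^ (a + 8) * (((a : ℝ) + 1) * ((a + 9 : ℕ) : ℝ) ^ 8) * (a + b + 10).factorial := by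
          rw [← h4]; ring
      _ ≤ 2 ^ (a + 8) * (C * 2 ^ (a + 9)) * (a + b + 10).factorial := by
          have := h9.trans h8
          gcongr _ * ?_ * _
      _ = 4 ^ (a + 1) * (2 ^ 15 * C * (a + b + 10).factorial) := by
          rw [show (4 : ℝ) = 2 ^ 2 by norm_num, ← pow_mul]; ring
      _ ≤ _ := by gcongr <;> norm_num
  have h11 := le_of_mul_le_mul_left h10 (by positivity)
  refine h11.trans ?_
  gcongr
  linarith

/-- A convolution of two sequences of factorial growth is dominated by its extreme terms. -/
theorem exists_sum_mul_le : ∃ C : ℝ, 1 ≤ C ∧ ∀ (p q : ℕ → ℝ) (α β₀ M β : ℝ) (N : ℕ),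
    (∀ i, 0 ≤ p i) → (∀ i, 0 ≤ q i) → (∀ i < 7, p i = 0) → (∀ i < 7, q i = 0) →
    0 ≤ α → 0 ≤ M → 0 ≤ β₀ → β₀ ≤ 2 * β →
    (∀ i ≤ N, p i ≤ α * β₀ ^ i * (i + 2).factorial) →
    (∀ i ≤ N, p i ≤ M * β ^ i * (i + 2).factorial) →
    (∀ i ≤ N, q i ≤ α * β₀ ^ i * (i + 2).factorial) →
    (∀ i ≤ N, q i ≤ M * β ^ i * (i + 2).factorial) →
    ∀ n ≤ N + 7, ∑ x ∈ antidiagonal n, p x.1 * q x.2 ≤ C * α * M * β ^ n * fz (n - 3) := by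
  obtain ⟨C, hC1, hC⟩ := exists_two_pow_mul_factorial_le
  refine ⟨C, hC1, ?_⟩
  intro p q α β₀ M β N hp hq hp0 hq0 hα hM hβ₀ hβ hpα hpM hqα hqM n hn
  have hβ' : 0 ≤ β := by linarith
  have hz := fz_nonneg ((n : ℤ) - 3)
  -- The factor of smaller index is estimated with the old rate β₀ ≤ 2β, the one of larger index
  -- with the new rate β. The result is linear in M, and the loss 2^a is covered by the choice of C.
  have key : ∀ (p q : ℕ → ℝ), (∀ i, 0 ≤ p i) → (∀ i, 0 ≤ q i) →
      (∀ i ≤ N, p i ≤ α * β₀ ^ i * (i + 2).factorial) →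
      (∀ i ≤ N, q i ≤ M * β ^ i * (i + 2).factorial) →
      ∀ a b : ℕ, a ≤ b → (a + 7) + (b + 7) = n →
      p (a + 7) * q (b + 7) ≤ C * α * M * β ^ n * (n - 4).factorial := by
    intro p q hp hq hpα hqM a b hab hn'
    have h1 := hC a b hab
    calc p (a + 7) * q (b + 7) ≤ (α * β₀ ^ (a + 7) * (a + 7 + 2).factorial) *
          (M * β ^ (b + 7) * (b + 7 + 2).factorial) :=
          mul_le_mul (hpα _ (by omega)) (hqM _ (by omega)) (hq _) (by positivity)
      _ ≤ (α * (2 * β) ^ (a + 7) * (a + 7 + 2).factorial) *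
          (M * β ^ (b + 7) * (b + 7 + 2).factorial) := by gcongr
      _ = α * M * β ^ ((a + 7) + (b + 7)) * (2 ^ (a + 7) * ((a + 9).factorial * (b + 9).factorial)) := by
          rw [mul_pow, pow_add β]; ring
      _ ≤ α * M * β ^ ((a + 7) + (b + 7)) * (C * (a + b + 10).factorial) := by gcongr
      _ = _ := by rw [hn', show a + b + 10 = n - 4 by omega]; ring
  have hterm : ∀ x ∈ antidiagonal n, p x.1 * q x.2
      ≤ if x.1 ∈ Finset.Ico 7 n then C * α * M * β ^ n * (if 14 ≤ n then ((n - 4).factorial : ℝ) else 0)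
        else 0 := by
    intro x hx
    rw [Finset.HasAntidiagonal.mem_antidiagonal] at hx
    have hr : 0 ≤ (if x.1 ∈ Finset.Ico 7 n then C * α * M * β ^ n *
      (if 14 ≤ n then ((n - 4).factorial : ℝ) else 0) else 0) := by
      split_ifs <;> positivity
    rcases lt_or_ge x.1 7 with h1 | h1
    · rw [hp0 _ h1, zero_mul]; exact hr
    rcases lt_or_ge x.2 7 with h2 | h2
    · rw [hq0 _ h2, mul_zero]; exact hr
    rw [if_pos (by simp; omega), if_pos (by omega)]
    obtain ⟨a, ha⟩ := Nat.exists_eq_add_of_le' h1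
    obtain ⟨b, hb⟩ := Nat.exists_eq_add_of_le' h2
    rw [ha, hb] at hx ⊢
    rcases le_total a b with hab | hab
    · exact key p q hp hq hpα hqM a b hab hx
    · rw [mul_comm]
      exact key q p hq hp hqα hpM b a hab (by omega)
  refine (Finset.sum_le_sum hterm).trans ?_
  rw [Finset.Nat.sum_antidiagonal_eq_sum_range_succ_mk]
  simp only
  rw [← Finset.sum_filter, Finset.sum_const, nsmul_eq_mul]
  split_ifs with h14
  -- Each product is of size (n-4)!, and there are at most n - 7 ≤ n - 3 of them, which makes
  -- (n-3)!.
  · have hcard : (Finset.filter (fun k => k ∈ Finset.Ico 7 n) (Finset.range n.succ)).card ≤ n - 7 := by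
      refine (Finset.card_le_card (t := Finset.Ico 7 n) ?_).trans (by simp)
      intro k hk
      exact (Finset.mem_filter.mp hk).2
    obtain ⟨m, rfl⟩ := Nat.exists_eq_add_of_le' (show 4 ≤ n by omega)
    have h3 : fz (((m + 4 : ℕ) : ℤ) - 3) = (m + 1) * m.factorial := by
      rw [show ((m + 4 : ℕ) : ℤ) - 3 = ((m + 1 : ℕ) : ℤ) by push_cast; ring, fz_natCast,
        Nat.factorial_succ]
      push_cast; ring
    rw [h3]
    have h4 : ((Finset.filter (fun k => k ∈ Finset.Ico 7 (m + 4)) (Finset.range (m + 4).succ)).card : ℝ)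
        ≤ m + 1 := by
      have : m + 4 - 7 ≤ m + 1 := by omega
      exact_mod_cast hcard.trans this
    rw [show m + 4 - 4 = m by omega]
    calc _ ≤ ((m : ℝ) + 1) * (C * α * M * β ^ (m + 4) * m.factorial) := by gcongr
      _ = _ := by ring
  · simp only [mul_zero]
    positivity


/-- The scalar inequalities between the norms, scaled by `(2π) ^ n`, of the coefficients of the
series that occur in the fixed point equation for `F`. -/
structure NormRecursion (K ρ : ℝ) (g x φ c σ e h f : ℕ → ℝ) : Prop where
  one_le_K : 1 ≤ K
  one_le_ρ : 1 ≤ ρ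
  g_nonneg : ∀ n, 0 ≤ g n
  x_nonneg : ∀ n, 0 ≤ x n
  φ_nonneg : ∀ n, 0 ≤ φ n
  c_nonneg : ∀ n, 0 ≤ c n
  σ_nonneg : ∀ n, 0 ≤ σ n
  e_nonneg : ∀ n, 0 ≤ e n
  -- F begins at d^8, hence G / d begins at d^7.
  g_zero : ∀ n < 7, g n = 0
  c_zero : c 0 = 0
  c_one : c 1 = 0
  x_le : ∀ n, x n ≤ K * ∑ y ∈ antidiagonal n,
    ρ ^ y.1 / y.1.factorial * (y.2.ascFactorial y.1 * g y.2)
  φ_le : ∀ n, φ n ≤ K * ∑ y ∈ antidiagonal n, ρ ^ y.1 * g y.2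
  c_le : ∀ n, c (n + 2) ≤ K * ∑ y ∈ antidiagonal n, (φ y.1 + σ y.1) * φ y.2
  σ_le : ∀ n, σ n ≤ K * ∑ y ∈ antidiagonal n, c y.1 * φ y.2
  -- The first term is the explicit residual. The thresholds 10, 3 and 4 are orders in d: of the
  -- linear defects, and of the coefficients multiplying the cosine and the sine remainder.
  e_le : ∀ n, e n ≤ K * ρ ^ n
    + K * ∑ y ∈ antidiagonal n, (if 10 ≤ y.1 then ρ ^ y.1 else 0) * (x y.2 + g y.2)
    + K * ∑ y ∈ antidiagonal n, (if 3 ≤ y.1 then ρ ^ y.1 else 0) * c y.2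
    + K * ∑ y ∈ antidiagonal n, (if 4 ≤ y.1 then ρ ^ y.1 else 0) * σ y.2
  h_le : ∀ n, h n ≤ K * (e (n + 1) + ∑ k ∈ Finset.range n, (n - 1).descFactorial k * e (n - k))
  f_le : ∀ n, f n ≤ K * ∑ y ∈ antidiagonal n, ρ ^ y.1 * h (y.2 + 2)
  g_le : ∀ n, g n ≤ K * (f (n + 1) + ∑ k ∈ Finset.range n, (n - 1).descFactorial k * f (n - k))

/-! ### Convolution estimates for the norm recursion. -/

theorem ascFactorial_mul_factorial_le (m k : ℕ) :
    (m.ascFactorial k : ℝ) * (m + 2).factorial ≤ (m + k + 2).factorial := by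
  have h1 := Nat.factorial_mul_ascFactorial (m + 2) k
  have h2 := ascFactorial_mono k (show m ≤ m + 2 + 1 by omega)
  rw [show m + k + 2 = m + 2 + k by ring, ← h1, mul_comm]
  exact_mod_cast Nat.mul_le_mul_left _ h2

/-- Convolution with a sequence supported in `[s, ∞)` of geometric growth. -/
theorem sum_conv_le {ρ : ℝ} (hρ : 0 ≤ ρ) {y : ℕ → ℝ} {B : ℝ} (hB : 0 ≤ B) (s n : ℕ) (t : ℤ)
    (hy : ∀ m, m + s ≤ n → y m ≤ B * fz (m + t)) :
    ∑ x ∈ antidiagonal n, (if s ≤ x.1 then ρ ^ x.1 else 0) * y x.2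
      ≤ B * (ρ ^ s * Real.exp ρ * fz (n - s + t)) := by
  refine le_trans ?_ (mul_le_mul_of_nonneg_left (sum_pow_mul_fz_le hρ s n t) hB)
  rw [Finset.mul_sum]
  refine Finset.sum_le_sum fun x hx => ?_
  rw [Finset.HasAntidiagonal.mem_antidiagonal] at hx
  split_ifs with h
  · calc _ ≤ ρ ^ x.1 * (B * fz (x.2 + t)) := by
          have := hy x.2 (by omega)
          gcongr
      _ = _ := by ring
  · simp

theorem sum_conv_factorial_le {ρ β M : ℝ} (hρ : 0 ≤ ρ) (hβ : 1 ≤ β) (hM : 0 ≤ M) {N n : ℕ}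
    {g : ℕ → ℝ} (hg : ∀ i ≤ N, g i ≤ M * β ^ i * (i + 2).factorial) (hn : n ≤ N) :
    ∑ y ∈ antidiagonal n, ρ ^ y.1 * g y.2 ≤ Real.exp ρ * (M * β ^ n * (n + 2).factorial) := by
  calc _ ≤ ∑ y ∈ antidiagonal n, M * β ^ n * (ρ ^ y.1 * ((y.2 + 2).factorial : ℝ)) := by
        refine Finset.sum_le_sum fun y hy => ?_
        rw [Finset.HasAntidiagonal.mem_antidiagonal] at hy
        calc _ ≤ ρ ^ y.1 * (M * β ^ y.2 * (y.2 + 2).factorial) := by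
              have := hg y.2 (by omega)
              gcongr
          _ ≤ ρ ^ y.1 * (M * β ^ n * (y.2 + 2).factorial) := by
              gcongr
              omega
          _ = _ := by ring
    _ ≤ _ := by
        rw [← Finset.mul_sum]
        refine (mul_le_mul_of_nonneg_left (sum_pow_mul_factorial_le hρ 2 n)
          (by positivity)).trans (le_of_eq (by ring))

/-- A shift does not worsen factorial growth: m (m+1) ⋯ (m+k-1) (m+2)! is at most (m+k+2)!, and the
weights ρ^k / k! sum to at most e^ρ. -/
theorem sum_asc_factorial_le {ρ β M : ℝ} (hρ : 0 ≤ ρ) (hβ : 1 ≤ β) (hM : 0 ≤ M) {N n : ℕ}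
    {g : ℕ → ℝ} (hg : ∀ i ≤ N, g i ≤ M * β ^ i * (i + 2).factorial) (hn : n ≤ N) :
    ∑ y ∈ antidiagonal n, ρ ^ y.1 / y.1.factorial * (y.2.ascFactorial y.1 * g y.2)
      ≤ Real.exp ρ * (M * β ^ n * (n + 2).factorial) := by
  calc _ ≤ ∑ y ∈ antidiagonal n, M * β ^ n * (n + 2).factorial * (ρ ^ y.1 / y.1.factorial) := by
        refine Finset.sum_le_sum fun y hy => ?_
        rw [Finset.HasAntidiagonal.mem_antidiagonal] at hy
        have h1 := ascFactorial_mul_factorial_le y.2 y.1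
        rw [show y.2 + y.1 + 2 = n + 2 by omega] at h1
        calc _ ≤ ρ ^ y.1 / y.1.factorial * (y.2.ascFactorial y.1 *
                (M * β ^ y.2 * (y.2 + 2).factorial)) := by
              have := hg y.2 (by omega)
              gcongr
          _ = ρ ^ y.1 / y.1.factorial * (M * β ^ y.2 *
                (y.2.ascFactorial y.1 * (y.2 + 2).factorial)) := by ring
          _ ≤ ρ ^ y.1 / y.1.factorial * (M * β ^ n * (n + 2).factorial) := by
              gcongr
              omega
          _ = _ := by ring
    _ ≤ _ := by
        rw [← Finset.mul_sum, Finset.Nat.sum_antidiagonal_eq_sum_range_succ_mk]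
        simp only
        refine (mul_le_mul_of_nonneg_left (Real.sum_le_exp_of_nonneg hρ _)
          (by positivity)).trans (le_of_eq (by ring))

namespace NormRecursion

variable {K ρ : ℝ} {g x φ c σ e h f : ℕ → ℝ}

theorem φ_zero (H : NormRecursion K ρ g x φ c σ e h f) (n : ℕ) (hn : n < 7) : φ n = 0 := by
  refine le_antisymm ((H.φ_le n).trans (le_of_eq ?_)) (H.φ_nonneg n)
  rw [Finset.sum_eq_zero, mul_zero]
  intro y hy
  rw [Finset.HasAntidiagonal.mem_antidiagonal] at hy
  rw [H.g_zero _ (by omega), mul_zero]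

theorem σ_zero (H : NormRecursion K ρ g x φ c σ e h f) (n : ℕ) (hn : n < 7) : σ n = 0 := by
  refine le_antisymm ((H.σ_le n).trans (le_of_eq ?_)) (H.σ_nonneg n)
  rw [Finset.sum_eq_zero, mul_zero]
  intro y hy
  rw [Finset.HasAntidiagonal.mem_antidiagonal] at hy
  rw [H.φ_zero _ (by omega), mul_zero]

theorem c_add_two_zero (H : NormRecursion K ρ g x φ c σ e h f) (n : ℕ) (hn : n < 7) :
    c (n + 2) = 0 := by
  refine le_antisymm ((H.c_le n).trans (le_of_eq ?_)) (H.c_nonneg _)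
  rw [Finset.sum_eq_zero, mul_zero]
  intro y hy
  rw [Finset.HasAntidiagonal.mem_antidiagonal] at hy
  rw [H.φ_zero y.2 (by omega), mul_zero]

/-- A factorial bound for `g_n + σ_n + c_{n+2}`, `n ≤ N`, gives improved bounds for the nonlinear
terms of order slightly more than `N`. -/
theorem exists_nonlinear_le (H : NormRecursion K ρ g x φ c σ e h f) :
    ∃ C : ℝ, 1 ≤ C ∧ ∀ (α β₀ M β : ℝ) (N : ℕ), 0 ≤ α → 0 ≤ M → 1 ≤ β → 1 ≤ β₀ → β₀ ≤ 2 * β →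
      (∀ i ≤ N, g i + σ i + c (i + 2) ≤ α * β₀ ^ i * (i + 2).factorial) →
      (∀ i ≤ N, g i + σ i + c (i + 2) ≤ M * β ^ i * (i + 2).factorial) →
      (∀ n ≤ N + 7, c (n + 2) ≤ C * α * M * β ^ n * fz (n - 3)) ∧
      (∀ n ≤ N + 7, σ n ≤ C * α * M * β ^ (n - 2) * fz (n - 5)) ∧
      (∀ n ≤ N + 5, e n ≤ K * ρ ^ n + C * (1 + α) * M * β ^ (n - 5) * fz (n - 8)) := by
  obtain ⟨C₀, hC₀, hprod⟩ := exists_sum_mul_le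
  have hK := H.one_le_K
  have hρ := H.one_le_ρ
  have hK0 : 0 ≤ K := by linarith
  have hρ0 : 0 ≤ ρ := by linarith
  set K₁ := K * Real.exp ρ + 1 with hK₁
  have hexp : 1 ≤ Real.exp ρ := Real.one_le_exp hρ0
  have hK₁1 : 1 ≤ K₁ := by
    have : 0 ≤ K * Real.exp ρ := by positivity
    linarith
  set C₁ := K * C₀ * K₁ ^ 2 with hC₁
  have hC₁1 : 1 ≤ C₁ := by
    have h1 : 1 ≤ K * C₀ := one_le_mul_of_one_le_of_one_le hK hC₀
    exact one_le_mul_of_one_le_of_one_le h1 (one_le_pow₀ hK₁1)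
  set C₂ := K * K₁ * (ρ ^ 10 * Real.exp ρ) + K * C₁ * (ρ ^ 3 * Real.exp ρ)
    + K * C₁ * (ρ ^ 4 * Real.exp ρ) with hC₂
  have hC₂0 : 0 ≤ C₂ := by positivity
  refine ⟨C₁ + C₂, by linarith, ?_⟩
  intro α β₀ M β N hα hM hβ hβ₀ hβ₀β hψα hψM
  have hgα : ∀ i ≤ N, g i ≤ α * β₀ ^ i * (i + 2).factorial := fun i hi => by
    linarith [hψα i hi, H.σ_nonneg i, H.c_nonneg (i + 2)]
  have hgM : ∀ i ≤ N, g i ≤ M * β ^ i * (i + 2).factorial := fun i hi => by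
    linarith [hψM i hi, H.σ_nonneg i, H.c_nonneg (i + 2)]
  have hφ : ∀ (M β : ℝ), 0 ≤ M → 1 ≤ β → (∀ i ≤ N, g i + σ i + c (i + 2) ≤ M * β ^ i * (i + 2).factorial) →
      ∀ i ≤ N, φ i + σ i ≤ K₁ * M * β ^ i * (i + 2).factorial := by
    intro M β hM hβ hψ i hi
    have h1 : ∀ i ≤ N, g i ≤ M * β ^ i * (i + 2).factorial := fun i hi => by
      linarith [hψ i hi, H.σ_nonneg i, H.c_nonneg (i + 2)]
    have h2 := mul_le_mul_of_nonneg_left (sum_conv_factorial_le hρ0 hβ hM h1 hi) hK0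
    have h3 := hψ i hi
    have h4 := H.φ_le i
    calc φ i + σ i ≤ K * (Real.exp ρ * (M * β ^ i * (i + 2).factorial)) + M * β ^ i * (i + 2).factorial := by
          linarith [H.g_nonneg i, H.c_nonneg (i + 2)]
      _ = _ := by rw [hK₁]; ring
  have hφα := hφ α β₀ hα hβ₀ hψα
  have hφM := hφ M β hM hβ hψM
  have hφα' : ∀ i ≤ N, φ i ≤ K₁ * α * β₀ ^ i * (i + 2).factorial := fun i hi => by
    linarith [hφα i hi, H.σ_nonneg i]
  have hφM' : ∀ i ≤ N, φ i ≤ K₁ * M * β ^ i * (i + 2).factorial := fun i hi => by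
    linarith [hφM i hi, H.σ_nonneg i]
  have hcc : ∀ n ≤ N + 7, c (n + 2) ≤ C₁ * α * M * β ^ n * fz (n - 3) := by
    intro n hn
    have h1 := hprod (fun i => φ i + σ i) φ (K₁ * α) β₀ (K₁ * M) β N
      (fun i => add_nonneg (H.φ_nonneg i) (H.σ_nonneg i)) H.φ_nonneg
      (fun i hi => by rw [H.φ_zero i hi, H.σ_zero i hi, add_zero]) H.φ_zero
      (by positivity) (by positivity) (by linarith) hβ₀β hφα hφM hφα' hφM' n hn
    refine (H.c_le n).trans ((mul_le_mul_of_nonneg_left h1 hK0).trans (le_of_eq ?_))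
    rw [hC₁]; ring
  have hσσ : ∀ n ≤ N + 7, σ n ≤ C₁ * α * M * β ^ (n - 2) * fz (n - 5) := by
    intro n hn
    rcases lt_or_ge n 2 with hn2 | hn2
    · rw [H.σ_zero n (by omega)]
      have := fz_nonneg ((n : ℤ) - 5)
      positivity
    obtain ⟨m, rfl⟩ := Nat.exists_eq_add_of_le' hn2
    have hK1' : ∀ {a b : ℝ} (i : ℕ), 0 ≤ a → 0 ≤ b → a * b ^ i * (i + 2).factorial ≤ K₁ * a * b ^ i * (i + 2).factorial := by
      intro a b i ha hb
      gcongr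
      exact le_mul_of_one_le_left ha hK₁1
    have h1 := hprod (fun i => c (i + 2)) φ (K₁ * α) β₀ (K₁ * M) β N
      (fun i => H.c_nonneg _) H.φ_nonneg H.c_add_two_zero H.φ_zero
      (by positivity) (by positivity) (by linarith) hβ₀β
      (fun i hi => le_trans (by linarith [hψα i hi, H.σ_nonneg i, H.g_nonneg i]) (hK1' i hα (by linarith)))
      (fun i hi => le_trans (by linarith [hψM i hi, H.σ_nonneg i, H.g_nonneg i]) (hK1' i hM (by linarith)))
      hφα' hφM' m (by omega)
    -- Because c_0 = c_1 = 0 the convolution starts at c_2. This shift by two lowers (n-3)! to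
    -- (n-5)! and β^n to β^{n-2}.
    have h2 : ∑ y ∈ antidiagonal (m + 2), c y.1 * φ y.2 = ∑ y ∈ antidiagonal m, c (y.1 + 2) * φ y.2 := by
      rw [Finset.Nat.sum_antidiagonal_succ, Finset.Nat.sum_antidiagonal_succ]
      simp [H.c_zero, H.c_one]
    refine (H.σ_le _).trans ?_
    rw [h2]
    refine (mul_le_mul_of_nonneg_left h1 hK0).trans (le_of_eq ?_)
    rw [show ((m + 2 : ℕ) : ℤ) - 5 = m - 3 by push_cast; ring, Nat.add_sub_cancel, hC₁]; ring
  -- Linear terms: (m+2)! with a kernel of order 10 gives (n-8)!. Cosine remainder: (m-5)! with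
  -- order 3 gives (n-8)!. Sine remainder: (m-5)! with order 4 gives even (n-9)!. In all three the
  -- exponent of β is at most n - 5, so e_{n+4} is controlled by data of index below n.
  have hee : ∀ n ≤ N + 5, e n ≤ K * ρ ^ n + C₂ * (1 + α) * M * β ^ (n - 5) * fz (n - 8) := by
    intro n hn
    have hz := fz_nonneg ((n : ℤ) - 8)
    have hβ0 : 0 ≤ β := by linarith
    have hxg := sum_conv_le (y := fun m => x m + g m) hρ0
      (show 0 ≤ K₁ * M * β ^ (n - 5) by positivity) 10 n 2 (fun m hm => by
        have h2 := mul_le_mul_of_nonneg_left (sum_asc_factorial_le hρ0 hβ hM hgM (show m ≤ N by omega)) hK0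
        have h3 := hgM m (by omega)
        have h4 := H.x_le m
        rw [show (m : ℤ) + 2 = ((m + 2 : ℕ) : ℤ) by push_cast; ring, fz_natCast]
        calc x m + g m ≤ K₁ * M * β ^ m * (m + 2).factorial := by rw [hK₁]; linarith
          _ ≤ _ := by
            gcongr
            omega)
    have hc' := sum_conv_le (y := c) hρ0
      (show 0 ≤ C₁ * α * M * β ^ (n - 5) by positivity) 3 n (-5) (fun m hm => by
        have hz := fz_nonneg ((m : ℤ) + (-5))
        rcases m with _ | _ | m
        · rw [H.c_zero]; positivity
        · rw [zero_add, H.c_one]; positivity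
        · refine (hcc m (by omega)).trans ?_
          rw [show (m + 1 + 1 : ℕ) + (-5 : ℤ) = (m : ℤ) - 3 by push_cast; ring] at hz ⊢
          gcongr
          omega)
    have hσ' := sum_conv_le (y := σ) hρ0
      (show 0 ≤ C₁ * α * M * β ^ (n - 5) by positivity) 4 n (-5) (fun m hm => by
        have hz := fz_nonneg ((m : ℤ) - 5)
        refine (hσσ m (by omega)).trans ?_
        rw [← sub_eq_add_neg]
        gcongr _ * ?_ * _
        exact pow_le_pow_right₀ hβ (by omega))
    rw [show (n : ℤ) - (10 : ℕ) + 2 = n - 8 by push_cast; ring] at hxg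
    rw [show (n : ℤ) - (3 : ℕ) + (-5) = n - 8 by push_cast; ring] at hc'
    have h9 : fz ((n : ℤ) - (4 : ℕ) + (-5)) ≤ fz (n - 8) := fz_mono (by push_cast; linarith)
    have h10 : C₁ * α * M * β ^ (n - 5) * (ρ ^ 4 * Real.exp ρ * fz (n - (4 : ℕ) + (-5)))
        ≤ C₁ * α * M * β ^ (n - 5) * (ρ ^ 4 * Real.exp ρ * fz (n - 8)) := by gcongr
    refine (H.e_le n).trans ?_
    calc _ ≤ K * ρ ^ n + K * (K₁ * M * β ^ (n - 5) * (ρ ^ 10 * Real.exp ρ * fz (n - 8)))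
          + K * (C₁ * α * M * β ^ (n - 5) * (ρ ^ 3 * Real.exp ρ * fz (n - 8)))
          + K * (C₁ * α * M * β ^ (n - 5) * (ρ ^ 4 * Real.exp ρ * fz (n - 8))) := by
          gcongr
          exact hσ'.trans h10
      _ = K * ρ ^ n + (K * K₁ * (ρ ^ 10 * Real.exp ρ) * 1 + K * C₁ * (ρ ^ 3 * Real.exp ρ) * α
            + K * C₁ * (ρ ^ 4 * Real.exp ρ) * α) * M * β ^ (n - 5) * fz (n - 8) := by ring
      _ ≤ K * ρ ^ n + (K * K₁ * (ρ ^ 10 * Real.exp ρ) * (1 + α) + K * C₁ * (ρ ^ 3 * Real.exp ρ) * (1 + α)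
            + K * C₁ * (ρ ^ 4 * Real.exp ρ) * (1 + α)) * M * β ^ (n - 5) * fz (n - 8) := by
          gcongr <;> linarith
      _ = _ := by rw [hC₂]; ring
  have hβ0 : 0 ≤ β := by linarith
  refine ⟨fun n hn => (hcc n hn).trans ?_, fun n hn => (hσσ n hn).trans ?_, fun n hn => (hee n hn).trans ?_⟩
  · have hz := fz_nonneg ((n : ℤ) - 3)
    gcongr
    linarith
  · have hz := fz_nonneg ((n : ℤ) - 5)
    gcongr
    linarith
  · have hz := fz_nonneg ((n : ℤ) - 8)
    gcongr
    linarith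

end NormRecursion


/-! ### Bootstrap of the exponential rate. -/

theorem add_five_mul_fz_le (j : ℕ) :
    ((j + 5 : ℕ) : ℝ) * fz (((j + 5 : ℕ) : ℤ) - 8) / ((j + 4).factorial : ℝ) ≤ 1 / ((j : ℝ) + 1) ^ 2 := by
  rw [div_le_div_iff₀ (by exact_mod_cast Nat.factorial_pos _) (by positivity), one_mul]
  rcases lt_or_ge j 3 with hj | hj
  · rw [fz_of_neg (by omega)]; simp
  obtain ⟨m, rfl⟩ := Nat.exists_eq_add_of_le' hj
  rw [show ((m + 3 + 5 : ℕ) : ℤ) - 8 = (m : ℤ) by push_cast; ring, fz_natCast]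
  simp only [Nat.factorial_succ]
  push_cast
  have hm : (0 : ℝ) ≤ m := m.cast_nonneg
  have h1 : ((m : ℝ) + 3 + 5) * (m + 3 + 1) ^ 2
      ≤ (m + 3 + 3 + 1) * (m + 3 + 2 + 1) * (m + 3 + 1 + 1) * (m + 3 + 1) * (m + 2 + 1) * (m + 1 + 1) * (m + 1) := by
    have h2 : ((m : ℝ) + 3 + 5) * (m + 3 + 1) ≤ (m + 3 + 3 + 1) * (m + 3 + 2 + 1) := by nlinarith
    calc ((m : ℝ) + 3 + 5) * (m + 3 + 1) ^ 2 = (((m : ℝ) + 3 + 5) * (m + 3 + 1)) * (m + 3 + 1) * 1 := by ring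
      _ ≤ ((m + 3 + 3 + 1) * (m + 3 + 2 + 1)) * (m + 3 + 1) *
          ((m + 3 + 1 + 1) * (m + 2 + 1) * (m + 1 + 1) * (m + 1)) := by
          gcongr
          have h3 : (1 : ℝ) ≤ (m + 3 + 1 + 1) * (m + 2 + 1) * (m + 1 + 1) := by
            refine one_le_mul_of_one_le_of_one_le (one_le_mul_of_one_le_of_one_le ?_ ?_) ?_ <;> linarith
          exact one_le_mul_of_one_le_of_one_le h3 (by linarith)
      _ = _ := by ring
  calc _ = (((m : ℝ) + 3 + 5) * (m + 3 + 1) ^ 2) * m.factorial := by ring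
    _ ≤ _ * m.factorial := mul_le_mul_of_nonneg_right h1 (by positivity)
    _ = _ := by ring

theorem fz_sub_three_le {n : ℕ} (hn : 0 < n) :
    fz ((n : ℤ) - 3) ≤ (n + 2).factorial * (1 / (n : ℝ) ^ 2) := by
  rcases lt_or_ge n 3 with hj | hj
  · rw [fz_of_neg (by omega)]; positivity
  obtain ⟨m, rfl⟩ := Nat.exists_eq_add_of_le' hj
  rw [show ((m + 3 : ℕ) : ℤ) - 3 = (m : ℤ) by push_cast; ring, fz_natCast, mul_one_div,
    le_div_iff₀ (by positivity)]
  simp only [Nat.factorial_succ]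
  push_cast
  have hm : (0 : ℝ) ≤ m := m.cast_nonneg
  calc (m.factorial : ℝ) * (m + 3) ^ 2 = (m + 3) * (m + 3) * m.factorial * (1 * 1 * 1) := by ring
    _ ≤ (m + 2 + 1 + 1) * (m + 2 + 1) * m.factorial * ((m + 3 + 1 + 1) * (m + 1 + 1) * (m + 1)) := by
        have h1 : (m : ℝ) + 3 ≤ m + 2 + 1 + 1 := by linarith
        have h2 : (m : ℝ) + 3 ≤ m + 2 + 1 := by linarith
        have h3 : (1 : ℝ) ≤ m + 3 + 1 + 1 := by linarith
        have h4 : (1 : ℝ) ≤ m + 1 + 1 := by linarith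
        have h5 : (1 : ℝ) ≤ m + 1 := by linarith
        exact mul_le_mul (mul_le_mul_of_nonneg_right (mul_le_mul h1 h2 (by positivity) (by positivity))
          (by positivity)) (mul_le_mul (mul_le_mul h3 h4 zero_le_one (by positivity)) h5 zero_le_one
          (by positivity)) (by positivity) (by positivity)
    _ ≤ _ := le_of_eq (by ring)

theorem sum_mul_pow_div_factorial_le {ρ : ℝ} (hρ : 0 ≤ ρ) (n : ℕ) :
    ∑ m ∈ Finset.range n, (m : ℝ) * ρ ^ m / ((m - 1).factorial : ℝ) ≤ Real.exp (4 * ρ) := by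
  refine le_trans (Finset.sum_le_sum fun m _ => ?_)
    (Real.sum_le_exp_of_nonneg (x := 4 * ρ) (by positivity) n)
  rcases m with _ | m
  · simp
  rw [Nat.add_sub_cancel, Nat.factorial_succ, mul_pow]
  have h1 : ((m + 1 : ℕ) : ℝ) ^ 2 ≤ 4 ^ (m + 1) := by
    have : (m + 1) ^ 2 ≤ (2 ^ (m + 1)) ^ 2 := Nat.pow_le_pow_left (Nat.lt_two_pow_self).le 2
    rw [← pow_mul, mul_comm, pow_mul] at this
    exact_mod_cast this
  rw [div_le_div_iff₀ (by positivity) (by positivity)]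
  calc _ = ((m + 1 : ℕ) : ℝ) ^ 2 * (ρ ^ (m + 1) * m.factorial) := by push_cast; ring
    _ ≤ 4 ^ (m + 1) * (ρ ^ (m + 1) * m.factorial) := by gcongr
    _ = _ := by ring

theorem sum_one_div_sq_le (n : ℕ) : ∑ j ∈ Finset.range n, 1 / ((j : ℝ) + 1) ^ 2 ≤ 2 := by
  have h : ∀ n : ℕ, ∑ j ∈ Finset.range (n + 1), 1 / ((j : ℝ) + 1) ^ 2 ≤ 2 - 1 / ((n : ℝ) + 1) := by
    intro n
    induction n with
    | zero => norm_num
    | succ n ih =>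
      rw [Finset.sum_range_succ]
      push_cast
      have h1 : 1 / ((n : ℝ) + 1 + 1) ^ 2 ≤ 1 / ((n : ℝ) + 1) - 1 / ((n : ℝ) + 1 + 1) := by
        rw [div_sub_div _ _ (by positivity) (by positivity),
          div_le_div_iff₀ (by positivity) (by positivity)]
        have : (0 : ℝ) ≤ n := n.cast_nonneg
        nlinarith
      linarith
  rcases n with _ | n
  · simp
  · refine (h n).trans ?_
    have : 0 ≤ 1 / ((n : ℝ) + 1) := by positivity
    linarith

namespace NormRecursion

variable {K ρ : ℝ} {g x φ c σ e h f : ℕ → ℝ}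

/-- Write ψ_n = g_n + σ_n + c_{n+2}. Since m (m-8)! / (m-1)! decays like m^{-6}, earlier bounds
enter ψ_n only through the summable weights 1/(j+1)². The a priori bound α β₀^i serves for one
factor of each product, so the estimate is linear in Z; allowing Z to vary with the index prepares
the Gronwall argument. -/
theorem exists_step (H : NormRecursion K ρ g x φ c σ e h f) :
    ∃ L : ℝ, 1 ≤ L ∧ ∀ (α β₀ β : ℝ) (Z : ℕ → ℝ) (n : ℕ), 0 ≤ α → 1 ≤ β → 1 ≤ β₀ → β₀ ≤ 2 * β →
      Monotone Z → (∀ i, 0 ≤ Z i) → 0 < n →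
      (∀ i < n, g i + σ i + c (i + 2) ≤ α * β₀ ^ i * (i + 2).factorial) →
      (∀ i < n, g i + σ i + c (i + 2) ≤ Z i * β ^ i * (i + 2).factorial) →
      g n + σ n + c (n + 2) ≤ (n + 2).factorial * (L +
        L * (1 + α) * ∑ j ∈ Finset.range n, Z j * β ^ j * (1 / ((j : ℝ) + 1) ^ 2)
        + L * α * Z (n - 1) * β ^ n * (1 / (n : ℝ) ^ 2)) := by
  obtain ⟨C, hC1, hC⟩ := H.exists_nonlinear_le
  have hK := H.one_le_K
  have hρ := H.one_le_ρ
  have hK0 : 0 ≤ K := by linarith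
  have hρ0 : 0 ≤ ρ := by linarith
  set C₄ := 4 * K ^ 3 * Real.exp ρ with hC₄
  have hC₄0 : 0 ≤ C₄ := by positivity
  refine ⟨C₄ * (K * Real.exp (4 * ρ)) + C₄ * C + 2 * C, ?_, ?_⟩
  · have : 0 ≤ C₄ * (K * Real.exp (4 * ρ)) + C₄ * C := by positivity
    linarith
  intro α β₀ β Z n hα hβ hβ₀ hβ₀β hZ hZ0 hn hψα hψZ
  have hβ0 : 0 ≤ β := by linarith
  have hN : ∀ N < n, ∀ i ≤ N, g i + σ i + c (i + 2) ≤ Z N * β ^ i * (i + 2).factorial := by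
    intro N hN i hi
    refine (hψZ i (by omega)).trans ?_
    have := hZ hi
    gcongr
  have hwe : wsum e (n + 4) ≤ K * Real.exp (4 * ρ)
      + C * (1 + α) * ∑ j ∈ Finset.range n, Z j * β ^ j * (1 / ((j : ℝ) + 1) ^ 2) := by
    -- The bound for e_m uses ψ_i only for i ≤ m - 5 < n. For m < 5 the truncated index is 0 and `fz
    -- (m - 8)` vanishes.
    have h1 : ∀ m ∈ Finset.range (n + 4 + 1), (m : ℝ) * e m / ((m - 1).factorial : ℝ)
        ≤ K * (m * ρ ^ m / ((m - 1).factorial : ℝ)) +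
          C * (1 + α) * (Z (m - 5) * β ^ (m - 5) * (m * fz (m - 8) / ((m - 1).factorial : ℝ))) := by
      intro m hm
      have hm' : m < n + 4 + 1 := by simpa using hm
      have h2 := (hC α β₀ (Z (m - 5)) β (m - 5) hα (hZ0 _) hβ hβ₀ hβ₀β
        (fun i hi => hψα i (by omega)) (hN _ (by omega))).2.2 m (by omega)
      calc _ ≤ (m : ℝ) * (K * ρ ^ m + C * (1 + α) * Z (m - 5) * β ^ (m - 5) * fz (m - 8)) /
            ((m - 1).factorial : ℝ) := by gcongr
        _ = _ := by ring
    refine (Finset.sum_le_sum h1).trans ?_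
    rw [Finset.sum_add_distrib, ← Finset.mul_sum, ← Finset.mul_sum]
    have h3 := sum_mul_pow_div_factorial_le hρ0 (n + 4 + 1)
    have h4 : ∑ m ∈ Finset.range (n + 4 + 1),
        Z (m - 5) * β ^ (m - 5) * (m * fz (m - 8) / ((m - 1).factorial : ℝ))
        ≤ ∑ j ∈ Finset.range n, Z j * β ^ j * (1 / ((j : ℝ) + 1) ^ 2) := by
      rw [show n + 4 + 1 = 5 + n by ring, Finset.sum_range_add, Finset.sum_eq_zero, zero_add]
      · refine Finset.sum_le_sum fun j _ => ?_
        have h5 := add_five_mul_fz_le j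
        rw [add_comm 5 j, show j + 5 - 5 = j by omega, show j + 5 - 1 = j + 4 by omega]
        have := hZ0 j
        gcongr
      · intro m hm
        have hm' : m < 5 := by simpa using hm
        rw [fz_of_neg (by omega)]
        simp
    gcongr
  have hg := factorial_bound_of_two_inversions H.e_nonneg hK0 hρ0 H.h_le H.f_le H.g_le n
  obtain ⟨hc, hσ, -⟩ := hC α β₀ (Z (n - 1)) β (n - 1) hα (hZ0 _) hβ hβ₀ hβ₀β
    (fun i hi => hψα i (by omega)) (hN _ (by omega))
  have hc := hc n (by omega)
  have hσ := hσ n (by omega)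
  have hf3 := fz_sub_three_le hn
  have hz0 := hZ0 (n - 1)
  have hc' : c (n + 2) ≤ C * α * Z (n - 1) * β ^ n * ((n + 2).factorial * (1 / (n : ℝ) ^ 2)) :=
    hc.trans (by gcongr)
  have hσ' : σ n ≤ C * α * Z (n - 1) * β ^ n * ((n + 2).factorial * (1 / (n : ℝ) ^ 2)) := by
    refine hσ.trans ?_
    have h6 : fz ((n : ℤ) - 5) ≤ fz (n - 3) := fz_mono (by omega)
    have h7 : β ^ (n - 2) ≤ β ^ n := pow_le_pow_right₀ hβ (by omega)
    have h8 := h6.trans hf3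
    have h9 := fz_nonneg ((n : ℤ) - 5)
    gcongr
  have hS : 0 ≤ ∑ j ∈ Finset.range n, Z j * β ^ j * (1 / ((j : ℝ) + 1) ^ 2) :=
    Finset.sum_nonneg fun j _ => by have := hZ0 j; positivity
  set s := ∑ j ∈ Finset.range n, Z j * β ^ j * (1 / ((j : ℝ) + 1) ^ 2) with hs
  set r := Z (n - 1) * β ^ n * (1 / (n : ℝ) ^ 2) with hr
  have hr0 : 0 ≤ r := by positivity
  set A := C₄ * (K * Real.exp (4 * ρ)) with hA
  have hA0 : 0 ≤ A := by positivity
  have hC0 : 0 ≤ C := by linarith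
  calc g n + σ n + c (n + 2) ≤ C₄ * ((n + 2).factorial * (K * Real.exp (4 * ρ) + C * (1 + α) * s)) +
        C * α * Z (n - 1) * β ^ n * ((n + 2).factorial * (1 / (n : ℝ) ^ 2)) +
        C * α * Z (n - 1) * β ^ n * ((n + 2).factorial * (1 / (n : ℝ) ^ 2)) := by
        gcongr
        exact hg.trans (by gcongr)
    _ = (n + 2).factorial * (A + (C₄ * C) * ((1 + α) * s) + (2 * C) * (α * r)) := by
        rw [hr, hA]; ring
    _ ≤ (n + 2).factorial * ((A + C₄ * C + 2 * C) + (A + C₄ * C + 2 * C) * ((1 + α) * s)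
          + (A + C₄ * C + 2 * C) * (α * r)) := by
        have h10 : 0 ≤ C₄ * C := by positivity
        gcongr <;> linarith
    _ = _ := by rw [hr]; ring

theorem psi_zero (H : NormRecursion K ρ g x φ c σ e h f) (n : ℕ) (hn : n < 7) :
    g n + σ n + c (n + 2) = 0 := by
  rw [H.g_zero n hn, H.σ_zero n hn, H.c_add_two_zero n hn]; simp

/-- A first factorial bound with a large exponential factor. -/
theorem exists_crude_bound (H : NormRecursion K ρ g x φ c σ e h f) :
    ∃ α B : ℝ, 0 ≤ α ∧ 1 ≤ B ∧ ∀ n, g n + σ n + c (n + 2) ≤ α * B ^ n * (n + 2).factorial := by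
  obtain ⟨L, hL, hstep⟩ := H.exists_step
  have hL0 : 0 < L := by linarith
  -- With these values L α = 1/4, α B / 4 = L and 2 L (1 + α) ≤ B / 4, so each of the three terms of
  -- `exists_step` takes at most a quarter of α B^n.
  refine ⟨1 / (4 * L), 16 * L ^ 2, by positivity, by nlinarith, fun n => ?_⟩
  set α := 1 / (4 * L) with hα
  set B := 16 * L ^ 2 with hB
  have hB1 : 1 ≤ B := by nlinarith
  have hα0 : 0 < α := by positivity
  have hαL : L * α = 1 / 4 := by rw [hα]; field_simp
  have hα1 : α ≤ 1 := by
    rw [hα, div_le_one (by positivity)]; linarith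
  induction n using Nat.strong_induction_on with
  | _ n ih =>
    rcases lt_or_ge n 7 with hn | hn
    · rw [H.psi_zero n hn]; positivity
    refine (hstep α B B (fun _ => α) n hα0.le hB1 hB1 (by linarith) monotone_const
      (fun _ => hα0.le) (by omega) ih ih).trans ?_
    obtain ⟨m, rfl⟩ := Nat.exists_eq_add_of_le' (show 1 ≤ n by omega)
    have h1 : ∑ j ∈ Finset.range (m + 1), α * B ^ j * (1 / ((j : ℝ) + 1) ^ 2) ≤ α * B ^ m * 2 := by
      refine le_trans ?_ (mul_le_mul_of_nonneg_left (sum_one_div_sq_le (m + 1)) (by positivity))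
      rw [Finset.mul_sum]
      refine Finset.sum_le_sum fun j hj => ?_
      have : j < m + 1 := by simpa using hj
      gcongr
      omega
    have h2 : 1 / ((m + 1 : ℕ) : ℝ) ^ 2 ≤ 1 := by
      rw [div_le_one (by positivity)]
      exact one_le_pow₀ (by exact_mod_cast Nat.succ_pos m)
    have h3 : B ≤ B ^ (m + 1) := le_self_pow₀ hB1 (by omega)
    have hLB : L ≤ α * B ^ (m + 1) / 4 := by
      have : α * B / 4 = L := by rw [hα, hB]; field_simp; norm_num
      have h5 : α * B ≤ α * B ^ (m + 1) := by gcongr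
      linarith
    have h6 : L * (1 + α) * (α * B ^ m * 2) ≤ α * B ^ (m + 1) / 4 := by
      have h7 : L * (1 + α) * 2 ≤ B / 4 := by
        rw [hB]; nlinarith
      calc _ = (α * B ^ m) * (L * (1 + α) * 2) := by ring
        _ ≤ (α * B ^ m) * (B / 4) := by gcongr
        _ = _ := by ring
    have h8 : L * α * α * B ^ (m + 1) * (1 / ((m + 1 : ℕ) : ℝ) ^ 2) ≤ α * B ^ (m + 1) / 4 := by
      rw [hαL]
      calc _ ≤ 1 / 4 * α * B ^ (m + 1) * 1 := by gcongr
        _ = _ := by ring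
    calc _ ≤ ((m + 1 + 2).factorial : ℝ) * (α * B ^ (m + 1) / 4 + α * B ^ (m + 1) / 4
          + α * B ^ (m + 1) / 4) := by
          gcongr
          exact (mul_le_mul_of_nonneg_left h1 (by positivity)).trans h6
      _ ≤ ((m + 1 + 2).factorial : ℝ) * (α * B ^ (m + 1)) := by
          gcongr
          have : 0 ≤ α * B ^ (m + 1) := by positivity
          linarith
      _ = _ := by ring

/-- A discrete Gronwall argument. The bound at the old rate makes the recursion linear, and it
closes at the new rate with constants solving Z_{n+1} = (1 + R/(n+1)²) Z_n, which stay bounded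
because ∑ 1/(j+1)² converges. No smallness of α is needed. -/
theorem halve_bound (H : NormRecursion K ρ g x φ c σ e h f) {α β₀ β : ℝ} (hα : 0 ≤ α)
    (hβ₀ : 1 ≤ β₀) (hβ : 1 ≤ β) (hβ₀β : β₀ ≤ 2 * β)
    (hψ : ∀ n, g n + σ n + c (n + 2) ≤ α * β₀ ^ n * (n + 2).factorial) :
    ∃ M : ℝ, 0 ≤ M ∧ ∀ n, g n + σ n + c (n + 2) ≤ M * β ^ n * (n + 2).factorial := by
  obtain ⟨L, hL, hstep⟩ := H.exists_step
  set R := L * (1 + 2 * α) with hR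
  have hR0 : 0 ≤ R := by positivity
  set Z : ℕ → ℝ := fun n => L * ∏ j ∈ Finset.range n, (1 + R * (1 / ((j : ℝ) + 1) ^ 2)) with hZ
  have hZs : ∀ n, Z (n + 1) = Z n + R * (1 / ((n : ℝ) + 1) ^ 2) * Z n := by
    intro n
    simp only [hZ, Finset.prod_range_succ]
    ring
  have hZ0 : ∀ n, 0 ≤ Z n := fun n =>
    mul_nonneg (by linarith) (Finset.prod_nonneg fun j _ => by positivity)
  have hZm : Monotone Z := monotone_nat_of_le_succ fun n => by
    rw [hZs]
    have := hZ0 n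
    exact le_add_of_nonneg_right (by positivity)
  have hZb : ∀ n, Z n ≤ L * Real.exp (R * 2) := by
    intro n
    refine mul_le_mul_of_nonneg_left ?_ (by linarith)
    calc _ ≤ ∏ j ∈ Finset.range n, Real.exp (R * (1 / ((j : ℝ) + 1) ^ 2)) := by
          refine Finset.prod_le_prod (fun j _ => by positivity) fun j _ => ?_
          rw [add_comm]
          exact Real.add_one_le_exp _
      _ = Real.exp (R * ∑ j ∈ Finset.range n, 1 / ((j : ℝ) + 1) ^ 2) := by
          rw [← Real.exp_sum, Finset.mul_sum]
      _ ≤ _ := Real.exp_le_exp.mpr (mul_le_mul_of_nonneg_left (sum_one_div_sq_le n) hR0)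
  have hZsum : ∀ n, Z n = L + R * ∑ j ∈ Finset.range n, Z j * (1 / ((j : ℝ) + 1) ^ 2) := by
    intro n
    induction n with
    | zero => simp [hZ]
    | succ n ih =>
      rw [hZs, Finset.sum_range_succ, mul_add, ← add_assoc, ← ih]
      ring
  have hmain : ∀ n, g n + σ n + c (n + 2) ≤ Z n * β ^ n * (n + 2).factorial := by
    intro n
    induction n using Nat.strong_induction_on with
    | _ n ih =>
      rcases Nat.eq_zero_or_pos n with hn | hn
      · subst hn
        rw [H.psi_zero 0 (by norm_num)]
        have := hZ0 0
        positivity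
      refine (hstep α β₀ β Z n hα hβ hβ₀ hβ₀β hZm hZ0 hn (fun i _ => hψ i) ih).trans ?_
      have hβ0 : 0 ≤ β := by linarith
      have h1 : ∑ j ∈ Finset.range n, Z j * β ^ j * (1 / ((j : ℝ) + 1) ^ 2)
          ≤ β ^ n * ∑ j ∈ Finset.range n, Z j * (1 / ((j : ℝ) + 1) ^ 2) := by
        rw [Finset.mul_sum]
        refine Finset.sum_le_sum fun j hj => ?_
        have hj' : j < n := by simpa using hj
        have h2 : β ^ j ≤ β ^ n := pow_le_pow_right₀ hβ hj'.le
        have := hZ0 j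
        calc _ = β ^ j * (Z j * (1 / ((j : ℝ) + 1) ^ 2)) := by ring
          _ ≤ _ := by gcongr
      -- The extra term of `exists_step` is the summand j = n - 1 and joins the sum, whence R =
      -- L(1+α) + Lα.
      have h3 : Z (n - 1) * (1 / (n : ℝ) ^ 2) ≤ ∑ j ∈ Finset.range n, Z j * (1 / ((j : ℝ) + 1) ^ 2) := by
        have h4 := Finset.single_le_sum (f := fun j : ℕ => Z j * (1 / ((j : ℝ) + 1) ^ 2))
          (fun j _ => by have := hZ0 j; positivity) (show n - 1 ∈ Finset.range n by simp; omega)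
        rwa [show ((n - 1 : ℕ) : ℝ) + 1 = n by push_cast [hn]; ring] at h4
      set s := ∑ j ∈ Finset.range n, Z j * (1 / ((j : ℝ) + 1) ^ 2) with hs
      have h5 : 1 ≤ β ^ n := one_le_pow₀ hβ
      have h6 : 0 ≤ L * α := by positivity
      calc _ ≤ ((n + 2).factorial : ℝ) * (L * β ^ n + L * (1 + α) * (β ^ n * s) + L * α * β ^ n * s) := by
            refine mul_le_mul_of_nonneg_left (add_le_add (add_le_add
              (le_mul_of_one_le_right (by linarith) h5) (by gcongr)) ?_) (by positivity)
            calc _ = (L * α * β ^ n) * (Z (n - 1) * (1 / (n : ℝ) ^ 2)) := by ring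
              _ ≤ _ := by gcongr
        _ = ((n + 2).factorial : ℝ) * (β ^ n * (L + R * s)) := by rw [hR]; ring
        _ = _ := by rw [hZsum n]; ring
  refine ⟨L * Real.exp (R * 2), by positivity, fun n => (hmain n).trans ?_⟩
  have := hZb n
  gcongr

/-- The rate is halved repeatedly, but kept at least 1, until B / 2^k < 1. -/
theorem exists_bound (H : NormRecursion K ρ g x φ c σ e h f) :
    ∃ M : ℝ, 0 ≤ M ∧ ∀ n, g n + σ n + c (n + 2) ≤ M * (n + 2).factorial := by
  obtain ⟨α, B, hα, hB, hψ⟩ := H.exists_crude_bound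
  have h1 : ∀ k : ℕ, ∃ M : ℝ, 0 ≤ M ∧
      ∀ n, g n + σ n + c (n + 2) ≤ M * (max 1 (B / 2 ^ k)) ^ n * (n + 2).factorial := by
    intro k
    induction k with
    | zero => exact ⟨α, hα, by simpa [max_eq_right hB] using hψ⟩
    | succ k ih =>
      obtain ⟨M, hM, hMψ⟩ := ih
      refine H.halve_bound hM (le_max_left _ _) (le_max_left _ _) ?_ hMψ
      refine max_le ?_ ?_
      · linarith [le_max_left 1 (B / 2 ^ (k + 1))]
      · have := le_max_right 1 (B / 2 ^ (k + 1))
        rw [pow_succ, ← div_div] at this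
        rw [pow_succ, ← div_div]
        linarith
  obtain ⟨k, hk⟩ := pow_unbounded_of_one_lt B (one_lt_two)
  obtain ⟨M, hM, hMψ⟩ := h1 k
  refine ⟨M, hM, fun n => (hMψ n).trans (le_of_eq ?_)⟩
  rw [max_eq_left, one_pow, mul_one]
  rw [div_le_one (by positivity)]
  exact hk.le

/-- The sharp factorial bound for the right hand side of the recursion. -/
theorem exists_e_le (H : NormRecursion K ρ g x φ c σ e h f) :
    ∃ M : ℝ, ∀ n, e n ≤ M * (n - 8).factorial := by
  obtain ⟨C, hC1, hC⟩ := H.exists_nonlinear_le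
  obtain ⟨M, hM, hψ⟩ := H.exists_bound
  have hK := H.one_le_K
  have hρ := H.one_le_ρ
  refine ⟨K * (ρ ^ 8 * Real.exp ρ) + C * (1 + M) * M, fun n => ?_⟩
  have h1 := (hC M 1 M 1 n hM hM le_rfl le_rfl (by norm_num) (fun i _ => by simpa using hψ i)
    (fun i _ => by simpa using hψ i)).2.2 n (by omega)
  rw [one_pow, mul_one] at h1
  have h2 : fz ((n : ℤ) - 8) ≤ (n - 8).factorial := by
    rw [← fz_natCast]
    exact fz_mono (by omega)
  have h3 : ρ ^ n ≤ ρ ^ 8 * Real.exp ρ * (n - 8).factorial := by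
    have h4 : ρ ^ n ≤ ρ ^ 8 * ρ ^ (n - 8) := by
      rw [← pow_add]; exact pow_le_pow_right₀ hρ (by omega)
    have h5 := Real.pow_div_factorial_le_exp ρ (by linarith) (n - 8)
    rw [div_le_iff₀ (by positivity)] at h5
    calc _ ≤ _ := h4
      _ ≤ ρ ^ 8 * (Real.exp ρ * (n - 8).factorial) := by gcongr
      _ = _ := by ring
  calc _ ≤ _ := h1
    _ ≤ K * (ρ ^ 8 * Real.exp ρ * (n - 8).factorial) + C * (1 + M) * M * (n - 8).factorial := by gcongr
    _ = _ := by ring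

end NormRecursion


/-! ### Jets of power series -/

/-- The first coefficients of `Z` are the entries of the list. -/
def Jet (Z : PowerSeries ℂ) : List ℂ → Prop
  | [] => True
  | a :: l => PowerSeries.coeff 0 Z = a ∧
      Jet (PowerSeries.mk fun n => PowerSeries.coeff (n + 1) Z) l

theorem jet_iff {Z : PowerSeries ℂ} {l : List ℂ} :
    Jet Z l ↔ ∀ i < l.length, PowerSeries.coeff i Z = l.getD i 0 := by
  induction l generalizing Z with
  | nil => simp [Jet]
  | cons a l ih =>
    rw [Jet, ih]
    constructor
    · rintro ⟨h0, h⟩ i hi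
      rcases i with _ | i
      · simpa using h0
      · simpa using h i (by simpa using hi)
    · intro h
      refine ⟨by simpa using h 0 (by simp), fun i hi => ?_⟩
      simpa using h (i + 1) (by simpa using hi)

theorem Jet.coeff_eq {Z : PowerSeries ℂ} {l : List ℂ} (h : Jet Z l) {i : ℕ} (hi : i < l.length) :
    PowerSeries.coeff i Z = l.getD i 0 := jet_iff.mp h i hi

theorem Jet.congr {Z : PowerSeries ℂ} {l m : List ℂ} (h : Jet Z l) (e : l = m) : Jet Z m := e ▸ h

theorem Jet.add {Z W : PowerSeries ℂ} {l m : List ℂ} (hZ : Jet Z l) (hW : Jet W m) :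
    Jet (Z + W) (List.zipWith (· + ·) l m) := by
  induction l generalizing Z W m with
  | nil => simp [Jet]
  | cons a l ih =>
    cases m with
    | nil => simp [Jet]
    | cons b m =>
      refine ⟨by rw [map_add, hZ.1, hW.1], ?_⟩
      exact ih hZ.2 hW.2

theorem Jet.C_mul {Z : PowerSeries ℂ} {l : List ℂ} (hZ : Jet Z l) (c : ℂ) :
    Jet (PowerSeries.C c * Z) (l.map (c * ·)) := by
  induction l generalizing Z with
  | nil => simp [Jet]
  | cons a l ih =>
    refine ⟨by rw [PowerSeries.coeff_C_mul, hZ.1], ?_⟩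
    have := ih hZ.2
    convert this using 1
    ext n
    simp

theorem Jet.X_mul {Z : PowerSeries ℂ} {l : List ℂ} (hZ : Jet Z l) :
    Jet (PowerSeries.X * Z) (0 :: l) := by
  refine ⟨by simp, ?_⟩
  convert hZ using 1
  ext n
  simp [PowerSeries.coeff_succ_X_mul]

/-- The truncated product of lists of coefficients. -/
def jetMul : List ℂ → List ℂ → List ℂ
  | [], _ => []
  | a :: l, m => List.zipWith (· + ·) (m.map (a * ·)) (0 :: jetMul l m)

theorem Jet.mul {Z W : PowerSeries ℂ} {l m : List ℂ} (hZ : Jet Z l) (hW : Jet W m) :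
    Jet (Z * W) (jetMul l m) := by
  induction l generalizing Z with
  | nil => simp [Jet, jetMul]
  | cons a l ih =>
    have h : Z = PowerSeries.C a
        + PowerSeries.X * PowerSeries.mk fun n => PowerSeries.coeff (n + 1) Z := by
      ext n
      rcases n with _ | n
      · simpa using hZ.1
      · simp [PowerSeries.coeff_succ_X_mul, PowerSeries.coeff_C]
    rw [h, add_mul, mul_assoc]
    exact (hW.C_mul a).add (ih hZ.2).X_mul

/-- Evaluation of the coefficients at `u = x`. -/
def ev (x : ℂ) : PSeries →+* PowerSeries ℂ := PowerSeries.map (Polynomial.evalRingHom x)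

theorem coeff_ev (x : ℂ) (Z : PSeries) (n : ℕ) :
    PowerSeries.coeff n (ev x Z) = (PowerSeries.coeff n Z).eval x := by
  simp [ev]

/-- A polynomial coefficient is zero if it vanishes at every complex point. This reduces each
low-order identity to scalar identities between lists, settled by `ring`. -/
theorem coeff_eq_zero_of_jet {Z : PSeries} {k N : ℕ}
    (h : ∀ x, Jet (ev x Z) (List.replicate N 0)) (hk : k < N) : PowerSeries.coeff k Z = 0 := by
  refine Polynomial.funext fun x => ?_
  rw [← coeff_ev, (h x).coeff_eq (by simpa using hk)]
  simp [List.getD_replicate, hk]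

theorem ev_d (x : ℂ) : ev x d = PowerSeries.X := by simp [ev, d]
theorem ev_u (x : ℂ) : ev x u = PowerSeries.C x := by simp [ev, u]
theorem ev_num (x c : ℂ) : ev x (num c) = PowerSeries.C c := by simp [ev]

theorem eval_coeff_op_ex (s x : ℂ) (p : ℂ[X]) (m n : ℕ) :
    (PowerSeries.coeff n (op (ex s) (pol p * d ^ m))).eval x
      = if m ≤ n then s ^ (n - m) / (n - m).factorial * ((DL ^ (n - m)) p).eval x else 0 := by
  have hc : ∀ n, PowerSeries.coeff n (pol p * d ^ m) = if n = m then p else 0 := by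
    intro n
    rw [PowerSeries.coeff_C_mul, d, PowerSeries.coeff_X_pow]
    split_ifs <;> simp
  rw [coeff_op]
  split_ifs with h
  · rw [Finset.sum_eq_single (n - m, m)]
    · rw [hc, if_pos rfl, coeff_ex, Polynomial.eval_smul, smul_eq_mul]
    · rintro ⟨a, b⟩ hab hne
      rw [Finset.HasAntidiagonal.mem_antidiagonal] at hab
      have : b ≠ m := fun hb => hne (by simp only at hab; rw [Prod.mk.injEq]; omega)
      simp [hc, this]
    · intro hn
      exact absurd (Finset.HasAntidiagonal.mem_antidiagonal.mpr (by simp; omega)) hn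
  · rw [Finset.sum_eq_zero, Polynomial.eval_zero]
    rintro ⟨a, b⟩ hab
    rw [Finset.HasAntidiagonal.mem_antidiagonal] at hab
    have : b ≠ m := by simp only at hab; omega
    simp [hc, this]

/-! ### The polynomials τ_2, …, τ_9. -/

theorem tau_eq_2 : tau 2 = C (1 / 1 : ℂ) * Polynomial.X ^ 0 + C (-1 / 1 : ℂ) * Polynomial.X ^ 2 := by
  refine Polynomial.funext fun x => ?_
  simp [tau, D]
  try ring

theorem tau_eq_3 : tau 3 = C (-1 / 1 : ℂ) * Polynomial.X ^ 1 + C (1 / 1 : ℂ) * Polynomial.X ^ 3 := by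
  rw [show tau 3 = C (1 / ((1 : ℕ) + 1 : ℂ)) * D (tau 2) from rfl, tau_eq_2]
  refine Polynomial.funext fun x => ?_
  simp [D]
  try ring

theorem tau_eq_4 : tau 4 = C (-1 / 3 : ℂ) * Polynomial.X ^ 0 + C (4 / 3 : ℂ) * Polynomial.X ^ 2 + C (-1 / 1 : ℂ) * Polynomial.X ^ 4 := by
  rw [show tau 4 = C (1 / ((2 : ℕ) + 1 : ℂ)) * D (tau 3) from rfl, tau_eq_3]
  refine Polynomial.funext fun x => ?_
  simp [D]
  try ring

theorem tau_eq_5 : tau 5 = C (2 / 3 : ℂ) * Polynomial.X ^ 1 + C (-5 / 3 : ℂ) * Polynomial.X ^ 3 + C (1 / 1 : ℂ) * Polynomial.X ^ 5 := by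
  rw [show tau 5 = C (1 / ((3 : ℕ) + 1 : ℂ)) * D (tau 4) from rfl, tau_eq_4]
  refine Polynomial.funext fun x => ?_
  simp [D]
  try ring

theorem tau_eq_6 : tau 6 = C (2 / 15 : ℂ) * Polynomial.X ^ 0 + C (-17 / 15 : ℂ) * Polynomial.X ^ 2 + C (2 / 1 : ℂ) * Polynomial.X ^ 4 + C (-1 / 1 : ℂ) * Polynomial.X ^ 6 := by
  rw [show tau 6 = C (1 / ((4 : ℕ) + 1 : ℂ)) * D (tau 5) from rfl, tau_eq_5]
  refine Polynomial.funext fun x => ?_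
  simp [D]
  try ring

theorem tau_eq_7 : tau 7 = C (-17 / 45 : ℂ) * Polynomial.X ^ 1 + C (77 / 45 : ℂ) * Polynomial.X ^ 3 + C (-7 / 3 : ℂ) * Polynomial.X ^ 5 + C (1 / 1 : ℂ) * Polynomial.X ^ 7 := by
  rw [show tau 7 = C (1 / ((5 : ℕ) + 1 : ℂ)) * D (tau 6) from rfl, tau_eq_6]
  refine Polynomial.funext fun x => ?_
  simp [D]
  try ring

theorem tau_eq_8 : tau 8 = C (-17 / 315 : ℂ) * Polynomial.X ^ 0 + C (248 / 315 : ℂ) * Polynomial.X ^ 2 + C (-12 / 5 : ℂ) * Polynomial.X ^ 4 + C (8 / 3 : ℂ) * Polynomial.X ^ 6 + C (-1 / 1 : ℂ) * Polynomial.X ^ 8 := by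
  rw [show tau 8 = C (1 / ((6 : ℕ) + 1 : ℂ)) * D (tau 7) from rfl, tau_eq_7]
  refine Polynomial.funext fun x => ?_
  simp [D]
  try ring

theorem tau_eq_9 : tau 9 = C (62 / 315 : ℂ) * Polynomial.X ^ 1 + C (-88 / 63 : ℂ) * Polynomial.X ^ 3 + C (16 / 5 : ℂ) * Polynomial.X ^ 5 + C (-3 / 1 : ℂ) * Polynomial.X ^ 7 + C (1 / 1 : ℂ) * Polynomial.X ^ 9 := by
  rw [show tau 9 = C (1 / ((7 : ℕ) + 1 : ℂ)) * D (tau 8) from rfl, tau_eq_8]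
  refine Polynomial.funext fun x => ?_
  simp [D]
  try ring

theorem tau_eval_0 (x : ℂ) : (tau 0).eval x = 1 := by simp [tau]

theorem tau_eval_1 (x : ℂ) : (tau 1).eval x = x := by simp [tau]

theorem tau_eval_2 (x : ℂ) : (tau 2).eval x = 1 + (-1) * x ^ 2 := by
  rw [tau_eq_2]; simp; try ring

theorem tau_eval_3 (x : ℂ) : (tau 3).eval x = (-1) * x ^ 1 + 1 * x ^ 3 := by
  rw [tau_eq_3]; simp; try ring

theorem tau_eval_4 (x : ℂ) : (tau 4).eval x = (-1 / 3) + (4 / 3) * x ^ 2 + (-1) * x ^ 4 := by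
  rw [tau_eq_4]; simp; try ring

theorem tau_eval_5 (x : ℂ) : (tau 5).eval x = (2 / 3) * x ^ 1 + (-5 / 3) * x ^ 3 + 1 * x ^ 5 := by
  rw [tau_eq_5]; simp; try ring

theorem tau_eval_6 (x : ℂ) : (tau 6).eval x = (2 / 15) + (-17 / 15) * x ^ 2 + 2 * x ^ 4 + (-1) * x ^ 6 := by
  rw [tau_eq_6]; simp; try ring

theorem tau_eval_7 (x : ℂ) : (tau 7).eval x = (-17 / 45) * x ^ 1 + (77 / 45) * x ^ 3 + (-7 / 3) * x ^ 5 + 1 * x ^ 7 := by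
  rw [tau_eq_7]; simp; try ring

theorem tau_eval_8 (x : ℂ) : (tau 8).eval x = (-17 / 315) + (248 / 315) * x ^ 2 + (-12 / 5) * x ^ 4 + (8 / 3) * x ^ 6 + (-1) * x ^ 8 := by
  rw [tau_eq_8]; simp; try ring

theorem tau_eval_9 (x : ℂ) : (tau 9).eval x = (62 / 315) * x ^ 1 + (-88 / 63) * x ^ 3 + (16 / 5) * x ^ 5 + (-3) * x ^ 7 + 1 * x ^ 9 := by
  rw [tau_eq_9]; simp; try ring



/-! ### The explicit series of low order -/

theorem coeff_op_add (f : PowerSeries ℂ) (Y Z : PSeries) (n : ℕ) :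
    PowerSeries.coeff n (op f (Y + Z)) = PowerSeries.coeff n (op f Y) + PowerSeries.coeff n (op f Z) := by
  rw [op_add, map_add]

/-- In the basis τ_n all powers of D are explicit, so shifted copies of the series can be expanded
mechanically. -/
theorem U_eq : U = pol (((-1 / 4) : ℂ) • tau 1) * d ^ 2
      + pol (((91 / 864) : ℂ) • tau 3 + ((41 / 1728) : ℂ) • tau 1) * d ^ 4
      + pol (((-319 / 2880) : ℂ) • tau 5 + ((-83 / 3456) : ℂ) • tau 3 + ((-259 / 69120) : ℂ) • tau 1) * d ^ 6 := by
  have h2 : pol (((-1 / 4) : ℂ) • tau 1) = num (-1 / 4) * u := by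
    have h : (((-1 / 4) : ℂ) • tau 1 : ℂ[X]) = C (-1 / 4) * Polynomial.X := Polynomial.funext fun x => by
      simp only [Polynomial.eval_add, Polynomial.eval_smul, tau_eval_1]
      simp
      try ring
    rw [h]
    simp [u]
  have h4 : pol (((91 / 864) : ℂ) • tau 3 + ((41 / 1728) : ℂ) • tau 1) = num (91 / 864) * u ^ 3 - num (47 / 576) * u := by
    have h : (((91 / 864) : ℂ) • tau 3 + ((41 / 1728) : ℂ) • tau 1 : ℂ[X]) = C (91 / 864) * Polynomial.X ^ 3 - C (47 / 576) * Polynomial.X := Polynomial.funext fun x => by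
      simp only [Polynomial.eval_add, Polynomial.eval_smul, tau_eval_3, tau_eval_1]
      simp
      try ring
    rw [h]
    simp [u]
  have h6 : pol (((-319 / 2880) : ℂ) • tau 5 + ((-83 / 3456) : ℂ) • tau 3 + ((-259 / 69120) : ℂ) • tau 1) = num (-319 / 2880) * u ^ 5 + num (185 / 1152) * u ^ 3 - num (3703 / 69120) * u := by
    have h : (((-319 / 2880) : ℂ) • tau 5 + ((-83 / 3456) : ℂ) • tau 3 + ((-259 / 69120) : ℂ) • tau 1 : ℂ[X]) = C (-319 / 2880) * Polynomial.X ^ 5 + C (185 / 1152) * Polynomial.X ^ 3 - C (3703 / 69120) * Polynomial.X := Polynomial.funext fun x => by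
      simp only [Polynomial.eval_add, Polynomial.eval_smul, tau_eval_5, tau_eval_3, tau_eval_1]
      simp
      try ring
    rw [h]
    simp [u]
  rw [U, h2, h4, h6]
  try ring

theorem Q_eq : Q = pol ((1 : ℂ) • tau 0) * d ^ 0
      + pol (((1 / 4) : ℂ) • tau 2) * d ^ 2
      + pol (((-91 / 432) : ℂ) • tau 4 + ((-13 / 1296) : ℂ) • tau 2) * d ^ 4
      + pol (((319 / 960) : ℂ) • tau 6 + ((347 / 8640) : ℂ) • tau 4 + ((149 / 64800) : ℂ) • tau 2) * d ^ 6 := by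
  have h0 : pol ((1 : ℂ) • tau 0) = 1 := by
    have h : ((1 : ℂ) • tau 0 : ℂ[X]) = 1 := Polynomial.funext fun x => by
      simp only [Polynomial.eval_add, Polynomial.eval_smul, tau_eval_0]
      simp
      try ring
    rw [h]
    simp [u]
  have h2 : pol (((1 / 4) : ℂ) • tau 2) = num (1 / 4) * (1 - u ^ 2) := by
    have h : (((1 / 4) : ℂ) • tau 2 : ℂ[X]) = C (1 / 4) * (1 - Polynomial.X ^ 2) := Polynomial.funext fun x => by
      simp only [Polynomial.eval_add, Polynomial.eval_smul, tau_eval_2]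
      simp
      try ring
    rw [h]
    simp [u]
  have h4 : pol (((-91 / 432) : ℂ) • tau 4 + ((-13 / 1296) : ℂ) • tau 2) = num (91 / 432) * u ^ 4 - num (13 / 48) * u ^ 2 + num (13 / 216) := by
    have h : (((-91 / 432) : ℂ) • tau 4 + ((-13 / 1296) : ℂ) • tau 2 : ℂ[X]) = C (91 / 432) * Polynomial.X ^ 4 - C (13 / 48) * Polynomial.X ^ 2 + C (13 / 216) := Polynomial.funext fun x => by
      simp only [Polynomial.eval_add, Polynomial.eval_smul, tau_eval_4, tau_eval_2]
      simp
      try ring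
    rw [h]
    simp [u]
  have h6 : pol (((319 / 960) : ℂ) • tau 6 + ((347 / 8640) : ℂ) • tau 4 + ((149 / 64800) : ℂ) • tau 2) = num (-319 / 960) * u ^ 6 + num (1079 / 1728) * u ^ 4 - num (937 / 2880) * u ^ 2
        + num (287 / 8640) := by
    have h : (((319 / 960) : ℂ) • tau 6 + ((347 / 8640) : ℂ) • tau 4 + ((149 / 64800) : ℂ) • tau 2 : ℂ[X]) = C (-319 / 960) * Polynomial.X ^ 6 + C (1079 / 1728) * Polynomial.X ^ 4 - C (937 / 2880) * Polynomial.X ^ 2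
        + C (287 / 8640) := Polynomial.funext fun x => by
      simp only [Polynomial.eval_add, Polynomial.eval_smul, tau_eval_6, tau_eval_4, tau_eval_2]
      simp
      try ring
    rw [h]
    simp [u]
  rw [Q, h0, h2, h4, h6]
  try ring

theorem Q₁_eq : Q₁ = pol (((-1) : ℂ) • tau 2) * d ^ 2
      + pol (((1 / 4) : ℂ) • tau 4 + ((1 / 3) : ℂ) • tau 2) * d ^ 4
      + pol (((-5 / 108) : ℂ) • tau 6 + ((-65 / 432) : ℂ) • tau 4 + ((-4 / 27) : ℂ) • tau 2) * d ^ 6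
      + pol (((-367 / 2160) : ℂ) • tau 8 + ((47 / 324) : ℂ) • tau 6 + ((2519 / 64800) : ℂ) • tau 4 + ((-1411 / 90720) : ℂ) • tau 2) * d ^ 8 := by
  have h2 : pol (((-1) : ℂ) • tau 2) = u ^ 2 - 1 := by
    have h : (((-1) : ℂ) • tau 2 : ℂ[X]) = Polynomial.X ^ 2 - 1 := Polynomial.funext fun x => by
      simp only [Polynomial.eval_add, Polynomial.eval_smul, tau_eval_2]
      simp
      try ring
    rw [h]
    simp [u]
  have h4 : pol (((1 / 4) : ℂ) • tau 4 + ((1 / 3) : ℂ) • tau 2) = num (1 / 4) * (1 - u ^ 4) := by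
    have h : (((1 / 4) : ℂ) • tau 4 + ((1 / 3) : ℂ) • tau 2 : ℂ[X]) = C (1 / 4) * (1 - Polynomial.X ^ 4) := Polynomial.funext fun x => by
      simp only [Polynomial.eval_add, Polynomial.eval_smul, tau_eval_4, tau_eval_2]
      simp
      try ring
    rw [h]
    simp [u]
  have h6 : pol (((-5 / 108) : ℂ) • tau 6 + ((-65 / 432) : ℂ) • tau 4 + ((-4 / 27) : ℂ) • tau 2) = -(num (5 / 48) * (1 - u ^ 2) * (num (4 / 9) * u ^ 4 + u ^ 2 + 1)) := by
    have h : (((-5 / 108) : ℂ) • tau 6 + ((-65 / 432) : ℂ) • tau 4 + ((-4 / 27) : ℂ) • tau 2 : ℂ[X]) = -(C (5 / 48) * (1 - Polynomial.X ^ 2) * (C (4 / 9) * Polynomial.X ^ 4 + Polynomial.X ^ 2 + 1)) := Polynomial.funext fun x => by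
      simp only [Polynomial.eval_add, Polynomial.eval_smul, tau_eval_6, tau_eval_4, tau_eval_2]
      simp
      try ring
    rw [h]
    simp [u]
  have h8 : pol (((-367 / 2160) : ℂ) • tau 8 + ((47 / 324) : ℂ) • tau 6 + ((2519 / 64800) : ℂ) • tau 4 + ((-1411 / 90720) : ℂ) • tau 2) = (1 - u ^ 2) * (num (-367 / 2160) * u ^ 6 + num (185 / 432) * u ^ 4 - num (997 / 4320) * u ^ 2) := by
    have h : (((-367 / 2160) : ℂ) • tau 8 + ((47 / 324) : ℂ) • tau 6 + ((2519 / 64800) : ℂ) • tau 4 + ((-1411 / 90720) : ℂ) • tau 2 : ℂ[X]) = (1 - Polynomial.X ^ 2) * (C (-367 / 2160) * Polynomial.X ^ 6 + C (185 / 432) * Polynomial.X ^ 4 - C (997 / 4320) * Polynomial.X ^ 2) := Polynomial.funext fun x => by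
      simp only [Polynomial.eval_add, Polynomial.eval_smul, tau_eval_8, tau_eval_6, tau_eval_4, tau_eval_2]
      simp
      try ring
    rw [h]
    simp [u]
  rw [Q₁, h2, h4, h6, h8]
  try ring

/-- Keeping s symbolic lets one expansion serve both half shifts s = ±1. -/
theorem jet_op_Q₁ (x s : ℂ) : Jet (ev x (op (ex (s / 2)) Q₁)) [
    0,
    0,
    s ^ 0 * ((-1) + 1 * x ^ 2),
    s ^ 1 * (1 * x ^ 1 + (-1) * x ^ 3),
    s ^ 0 * ((1 / 4) + (-1 / 4) * x ^ 4) + s ^ 2 * ((1 / 4) + (-1) * x ^ 2 + (3 / 4) * x ^ 4),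
    s ^ 1 * ((-1 / 2) * x ^ 3 + (1 / 2) * x ^ 5) + s ^ 3 * ((-1 / 3) * x ^ 1 + (5 / 6) * x ^ 3 + (-1 / 2) * x ^ 5),
    s ^ 0 * ((-5 / 48) + (25 / 432) * x ^ 4 + (5 / 108) * x ^ 6) + s ^ 2 * ((-3 / 8) * x ^ 2 + 1 * x ^ 4 + (-5 / 8) * x ^ 6) + s ^ 4 * ((-1 / 24) + (17 / 48) * x ^ 2 + (-5 / 8) * x ^ 4 + (5 / 16) * x ^ 6),
    s ^ 1 * ((25 / 216) * x ^ 3 + (5 / 216) * x ^ 5 + (-5 / 36) * x ^ 7) + s ^ 3 * ((-1 / 8) * x ^ 1 + (19 / 24) * x ^ 3 + (-31 / 24) * x ^ 5 + (5 / 8) * x ^ 7) + s ^ 5 * ((17 / 240) * x ^ 1 + (-77 / 240) * x ^ 3 + (7 / 16) * x ^ 5 + (-3 / 16) * x ^ 7),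
    s ^ 0 * ((-997 / 4320) * x ^ 2 + (949 / 1440) * x ^ 4 + (-323 / 540) * x ^ 6 + (367 / 2160) * x ^ 8) + s ^ 2 * ((25 / 288) * x ^ 2 + (-25 / 432) * x ^ 4 + (-235 / 864) * x ^ 6 + (35 / 144) * x ^ 8) + s ^ 4 * ((-1 / 64) + (5 / 16) * x ^ 2 + (-53 / 48) * x ^ 4 + (65 / 48) * x ^ 6 + (-35 / 64) * x ^ 8) + s ^ 6 * ((17 / 2880) + (-31 / 360) * x ^ 2 + (21 / 80) * x ^ 4 + (-7 / 24) * x ^ 6 + (7 / 64) * x ^ 8),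
    s ^ 1 * ((-997 / 4320) * x ^ 1 + (6691 / 4320) * x ^ 3 + (-249 / 80) * x ^ 5 + (334 / 135) * x ^ 7 + (-367 / 540) * x ^ 9) + s ^ 3 * ((25 / 864) * x ^ 1 + (-175 / 2592) * x ^ 3 + (-605 / 2592) * x ^ 5 + (515 / 864) * x ^ 7 + (-35 / 108) * x ^ 9) + s ^ 5 * ((1 / 16) * x ^ 1 + (-121 / 240) * x ^ 3 + (301 / 240) * x ^ 5 + (-5 / 4) * x ^ 7 + (7 / 16) * x ^ 9) + s ^ 7 * ((-31 / 2520) * x ^ 1 + (11 / 126) * x ^ 3 + (-1 / 5) * x ^ 5 + (3 / 16) * x ^ 7 + (-1 / 16) * x ^ 9)] := by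
  rw [jet_iff]
  intro i hi
  simp only [List.length_cons, List.length_nil] at hi
  rw [coeff_ev, Q₁_eq]
  interval_cases i <;>
    simp only [coeff_op_add, Polynomial.eval_add, eval_coeff_op_ex, Nat.reduceLeDiff, Nat.reduceSub,
      le_refl, if_true, if_false, zero_add, add_zero] <;>
    simp only [map_add, map_smul, DL_pow_tau, Polynomial.eval_add, Polynomial.eval_smul,
      smul_eq_mul, Nat.reduceAdd, tau_eval_0, tau_eval_1, tau_eval_2, tau_eval_3,
      tau_eval_4, tau_eval_5, tau_eval_6, tau_eval_7, tau_eval_8, tau_eval_9,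
      List.getD_cons_zero, List.getD_cons_succ] <;>
    simp only [Nat.ascFactorial, Nat.factorial] <;> push_cast <;> ring

theorem jet_op_Q (x s : ℂ) : Jet (ev x (op (ex s) Q)) [
    s ^ 0 * (1),
    0,
    s ^ 0 * ((1 / 4) + (-1 / 4) * x ^ 2),
    s ^ 1 * ((-1 / 2) * x ^ 1 + (1 / 2) * x ^ 3),
    s ^ 0 * ((13 / 216) + (-13 / 48) * x ^ 2 + (91 / 432) * x ^ 4) + s ^ 2 * ((-1 / 4) + 1 * x ^ 2 + (-3 / 4) * x ^ 4),
    s ^ 1 * ((-13 / 24) * x ^ 1 + (299 / 216) * x ^ 3 + (-91 / 108) * x ^ 5) + s ^ 3 * ((2 / 3) * x ^ 1 + (-5 / 3) * x ^ 3 + 1 * x ^ 5),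
    s ^ 0 * ((287 / 8640) + (-937 / 2880) * x ^ 2 + (1079 / 1728) * x ^ 4 + (-319 / 960) * x ^ 6) + s ^ 2 * ((-13 / 48) + (169 / 72) * x ^ 2 + (-1807 / 432) * x ^ 4 + (455 / 216) * x ^ 6) + s ^ 4 * ((1 / 6) + (-17 / 12) * x ^ 2 + (5 / 2) * x ^ 4 + (-5 / 4) * x ^ 6),
    s ^ 1 * ((-937 / 1440) * x ^ 1 + (13601 / 4320) * x ^ 3 + (-19403 / 4320) * x ^ 5 + (319 / 160) * x ^ 7) + s ^ 3 * ((169 / 108) * x ^ 1 + (-1157 / 162) * x ^ 3 + (793 / 81) * x ^ 5 + (-455 / 108) * x ^ 7) + s ^ 5 * ((-17 / 30) * x ^ 1 + (77 / 30) * x ^ 3 + (-7 / 2) * x ^ 5 + (3 / 2) * x ^ 7)] := by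
  rw [jet_iff]
  intro i hi
  simp only [List.length_cons, List.length_nil] at hi
  rw [coeff_ev, Q_eq]
  interval_cases i <;>
    simp only [coeff_op_add, Polynomial.eval_add, eval_coeff_op_ex, Nat.reduceLeDiff, Nat.reduceSub,
      le_refl, if_true, if_false, zero_add, add_zero] <;>
    simp only [map_add, map_smul, DL_pow_tau, Polynomial.eval_add, Polynomial.eval_smul,
      smul_eq_mul, Nat.reduceAdd, tau_eval_0, tau_eval_1, tau_eval_2, tau_eval_3,
      tau_eval_4, tau_eval_5, tau_eval_6, tau_eval_7, tau_eval_8, tau_eval_9,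
      List.getD_cons_zero, List.getD_cons_succ] <;>
    simp only [Nat.ascFactorial, Nat.factorial] <;> push_cast <;> ring

theorem jet_op_U (x s : ℂ) : Jet (ev x (op (ex s) U)) [
    0,
    0,
    s ^ 0 * ((-1 / 4) * x ^ 1),
    s ^ 1 * ((-1 / 4) + (1 / 4) * x ^ 2),
    s ^ 0 * ((-47 / 576) * x ^ 1 + (91 / 864) * x ^ 3) + s ^ 2 * ((1 / 4) * x ^ 1 + (-1 / 4) * x ^ 3),
    s ^ 1 * ((-47 / 576) + (229 / 576) * x ^ 2 + (-91 / 288) * x ^ 4) + s ^ 3 * ((1 / 12) + (-1 / 3) * x ^ 2 + (1 / 4) * x ^ 4),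
    s ^ 0 * ((-3703 / 69120) * x ^ 1 + (185 / 1152) * x ^ 3 + (-319 / 2880) * x ^ 5) + s ^ 2 * ((229 / 576) * x ^ 1 + (-593 / 576) * x ^ 3 + (91 / 144) * x ^ 5) + s ^ 4 * ((-1 / 6) * x ^ 1 + (5 / 12) * x ^ 3 + (-1 / 4) * x ^ 5),
    s ^ 1 * ((-3703 / 69120) + (37003 / 69120) * x ^ 2 + (-1193 / 1152) * x ^ 4 + (319 / 576) * x ^ 6) + s ^ 3 * ((229 / 1728) + (-251 / 216) * x ^ 2 + (3599 / 1728) * x ^ 4 + (-455 / 432) * x ^ 6) + s ^ 5 * ((-1 / 30) + (17 / 60) * x ^ 2 + (-1 / 2) * x ^ 4 + (1 / 4) * x ^ 6),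
    s ^ 2 * ((37003 / 69120) * x ^ 1 + (-180163 / 69120) * x ^ 3 + (1075 / 288) * x ^ 5 + (-319 / 192) * x ^ 7) + s ^ 4 * ((-251 / 432) * x ^ 1 + (4603 / 1728) * x ^ 3 + (-6329 / 1728) * x ^ 5 + (455 / 288) * x ^ 7) + s ^ 6 * ((17 / 180) * x ^ 1 + (-77 / 180) * x ^ 3 + (7 / 12) * x ^ 5 + (-1 / 4) * x ^ 7)] := by
  rw [jet_iff]
  intro i hi
  simp only [List.length_cons, List.length_nil] at hi
  rw [coeff_ev, U_eq]
  interval_cases i <;>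
    simp only [coeff_op_add, Polynomial.eval_add, eval_coeff_op_ex, Nat.reduceLeDiff, Nat.reduceSub,
      le_refl, if_true, if_false, zero_add, add_zero] <;>
    simp only [map_add, map_smul, DL_pow_tau, Polynomial.eval_add, Polynomial.eval_smul,
      smul_eq_mul, Nat.reduceAdd, tau_eval_0, tau_eval_1, tau_eval_2, tau_eval_3,
      tau_eval_4, tau_eval_5, tau_eval_6, tau_eval_7, tau_eval_8, tau_eval_9,
      List.getD_cons_zero, List.getD_cons_succ] <;>
    simp only [Nat.ascFactorial, Nat.factorial] <;> push_cast <;> ring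



theorem Jet.tail {Z : PowerSeries ℂ} {a : ℂ} {l : List ℂ} (h : Jet (PowerSeries.X * Z) (a :: l)) :
    Jet Z l := by
  convert h.2 using 1
  ext n
  simp [PowerSeries.coeff_succ_X_mul]

theorem jet_nil (Z : PowerSeries ℂ) : Jet Z [] := trivial

/-- Clearing a denominator with constant term 1 preserves the order of vanishing, so inverse series
never have to be expanded. -/
theorem coeff_eq_zero_of_mul {V Z : PSeries} {N : ℕ} (hV : PowerSeries.constantCoeff V = 1)
    (h : ∀ k < N, PowerSeries.coeff k (V * Z) = 0) : ∀ k < N, PowerSeries.coeff k Z = 0 := by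
  intro k hk
  have h1 : Z = inv V * (V * Z) := by rw [← mul_assoc, mul_comm (inv V), mul_inv V hV, one_mul]
  rw [h1, PowerSeries.coeff_mul, Finset.sum_eq_zero]
  intro y hy
  rw [Finset.HasAntidiagonal.mem_antidiagonal] at hy
  rw [h _ (by omega), mul_zero]

theorem jet_expS (x θ : ℂ) : Jet (ev x (expS θ)) [1, θ, θ ^ 2 / 2, θ ^ 3 / 6, θ ^ 4 / 24,
    θ ^ 5 / 120, θ ^ 6 / 720, θ ^ 7 / 5040, θ ^ 8 / 40320, θ ^ 9 / 362880] := by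
  have h : ∀ n, PowerSeries.coeff n (ev x (expS θ)) = θ ^ n / n.factorial := fun n => by
    rw [coeff_ev, expS_eq, PowerSeries.coeff_map, coeff_ex, Polynomial.eval_C]
  rw [jet_iff]
  intro i hi
  simp only [List.length_cons, List.length_nil] at hi
  rw [h]
  interval_cases i <;> simp [Nat.factorial]

theorem ev_den (x θ : ℂ) : ev x (den θ) = PowerSeries.C ((1 + x) / 2) * ev x (expS θ)
    + PowerSeries.C ((1 - x) / 2) * ev x (expS (-θ)) := by
  rw [den, coshS, sinhS]
  simp only [map_add, map_mul, map_sub, ev_u, ev_num]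
  have h1 : (PowerSeries.C ((1 + x) / 2) : PowerSeries ℂ)
      = PowerSeries.C (1 / 2) + PowerSeries.C x * PowerSeries.C (1 / 2) := by
    rw [← map_mul, ← map_add]; congr 1; ring
  have h2 : (PowerSeries.C ((1 - x) / 2) : PowerSeries ℂ)
      = PowerSeries.C (1 / 2) - PowerSeries.C x * PowerSeries.C (1 / 2) := by
    rw [← map_mul, ← map_sub]; congr 1; ring
  rw [h1, h2]
  ring

theorem jet_den (x θ : ℂ) : Jet (ev x (den θ)) [1, x * θ, θ ^ 2 / 2, x * θ ^ 3 / 6, θ ^ 4 / 24,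
    x * θ ^ 5 / 120, θ ^ 6 / 720, x * θ ^ 7 / 5040, θ ^ 8 / 40320, x * θ ^ 9 / 362880] := by
  rw [ev_den]
  refine (((jet_expS x θ).C_mul _).add ((jet_expS x (-θ)).C_mul _)).congr ?_
  simp only [List.map_cons, List.map_nil, List.zipWith_cons_cons, List.zipWith_nil_left]
  repeat' refine congrArg₂ List.cons ?_ ?_
  all_goals first | rfl | ring

/-- `ε² / d²`. -/
def epsSq : PSeries := (num 2 * sinhcS (1 / 2)) ^ 2

theorem eps_sq_eq : eps ^ 2 = d * (d * epsSq) := by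
  rw [eps, epsSq, ← d_mul_sinhcS]; ring

theorem eps_sq_eq_exp : eps ^ 2 = expS 1 + expS (-1) - 2 := by
  have h1 : expS 1 = expS (1 / 2) * expS (1 / 2) := by rw [expS_mul]; norm_num
  have h2 : expS (-1) = expS (-(1 / 2)) * expS (-(1 / 2)) := by rw [expS_mul]; norm_num
  have h3 : expS (1 / 2) * expS (-(1 / 2)) = 1 := by
    rw [expS_mul, add_neg_cancel, expS_zero]
  have h4 : num 2 * num (1 / 2) = 1 := by rw [num_mul, ← num_one]; norm_num
  rw [eps, sinhS, h1, h2]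
  linear_combination (-2 : PSeries) * h3 + (num 2 * num (1 / 2) + 1) * (expS (1 / 2) - expS (-(1 / 2))) ^ 2 * h4

theorem jet_epsSq (x : ℂ) : Jet (ev x epsSq) [1, 0, 1 / 12, 0, 1 / 360, 0, 1 / 20160, 0] := by
  have h : ev x (eps ^ 2) = PowerSeries.X * (PowerSeries.X * ev x epsSq) := by
    rw [eps_sq_eq, map_mul, map_mul, ev_d]
  have h2 : ev x (2 : PSeries) = PowerSeries.C 2 * ev x (expS 0) := by
    rw [expS_zero, map_one, mul_one, map_ofNat, map_ofNat]
  have h1 : Jet (ev x (eps ^ 2)) [0, 0, 1, 0, 1 / 12, 0, 1 / 360, 0, 1 / 20160, 0] := by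
    have h3 : ev x (eps ^ 2) = ev x (expS 1) + ev x (expS (-1)) + PowerSeries.C (-2) * ev x (expS 0) := by
      rw [eps_sq_eq_exp, map_sub, map_add, h2, map_neg]; ring
    rw [h3]
    refine (((jet_expS x 1).add (jet_expS x (-1))).add ((jet_expS x 0).C_mul _)).congr ?_
    simp only [List.map_cons, List.map_nil, List.zipWith_cons_cons, List.zipWith_nil_left]
    repeat' refine congrArg₂ List.cons ?_ ?_
    all_goals first | rfl | norm_num
  rw [h] at h1
  exact h1.tail.tail

/-- The integrating factor. -/
def mu : PSeries :=
  1 - num (1 / 2) * d ^ 2 + num (55 / 216) * d ^ 4 - num (119 / 4320) * d ^ 6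

theorem jet_mu (x : ℂ) : Jet (ev x mu) [1, 0, -1 / 2, 0, 55 / 216, 0, -119 / 4320, 0] := by
  rw [jet_iff]
  intro i hi
  simp only [List.length_cons, List.length_nil] at hi
  simp only [mu, map_add, map_sub, map_mul, map_pow, map_one, ev_d, ev_num,
    PowerSeries.coeff_C_mul, PowerSeries.coeff_X_pow, PowerSeries.coeff_one]
  interval_cases i <;> norm_num

theorem jet_Q (x : ℂ) : Jet (ev x Q) [
    1,
    0,
    (1 / 4) + (-1 / 4) * x ^ 2,
    0,
    (13 / 216) + (-13 / 48) * x ^ 2 + (91 / 432) * x ^ 4,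
    0,
    (287 / 8640) + (-937 / 2880) * x ^ 2 + (1079 / 1728) * x ^ 4 + (-319 / 960) * x ^ 6,
    0] := by
  have h := jet_op_Q x 0
  rw [ex_zero, op_one] at h
  refine h.congr ?_
  repeat' refine congrArg₂ List.cons ?_ ?_
  all_goals first | rfl | ring

theorem jet_U (x : ℂ) : Jet (ev x U) [
    0,
    0,
    (-1 / 4) * x ^ 1,
    0,
    (-47 / 576) * x ^ 1 + (91 / 864) * x ^ 3,
    0,
    (-3703 / 69120) * x ^ 1 + (185 / 1152) * x ^ 3 + (-319 / 2880) * x ^ 5,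
    0,
    0] := by
  have h := jet_op_U x 0
  rw [ex_zero, op_one] at h
  refine h.congr ?_
  repeat' refine congrArg₂ List.cons ?_ ?_
  all_goals first | rfl | ring

theorem jet_mu_mul_Q (x : ℂ) : Jet (ev x (mu * ((1 - u ^ 2) * Q))) [
    1 + (-1) * x ^ 2,
    0,
    (-1 / 4) + (1 / 4) * x ^ 4,
    0,
    (41 / 216) + (-145 / 432) * x ^ 2 + (77 / 216) * x ^ 4 + (-91 / 432) * x ^ 6,
    0,
    (113 / 2880) + (-253 / 864) * x ^ 2 + (1669 / 2160) * x ^ 4 + (-613 / 720) * x ^ 6 + (319 / 960) * x ^ 8,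
    0] := by
  have h : ev x (mu * ((1 - u ^ 2) * Q)) = ev x mu * (PowerSeries.C (1 - x ^ 2) * ev x Q) := by
    simp [ev_u]
  rw [h]
  refine ((jet_mu x).mul ((jet_Q x).C_mul _)).congr ?_
  simp only [jetMul, List.map_cons, List.map_nil, List.zipWith_cons_cons, List.zipWith_nil_left,
    List.zipWith_nil_right, mul_zero, zero_mul, add_zero, zero_add]
  repeat' refine congrArg₂ List.cons ?_ ?_
  all_goals first | rfl | ring

/-- The defect of the factorization of the linear difference operator at the shift `s`. -/
def delta (s : ℂ) : PSeries :=
  op (ex (s / 2)) Q₁ + d ^ 2 * (mu * ((1 - u ^ 2) * Q)) * (op (ex s) Q * inv (den s))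

/-- Q, Q₁ and `mu` are matched so that, below d^10, the half-shifted Q₁ cancels the coefficient of
the fully shifted G in the weighted equation. The check is finite once `den s` is cleared. -/
theorem coeff_delta {s : ℂ} (hs : s = 1 ∨ s = -1) : ∀ k < 10, PowerSeries.coeff k (delta s) = 0 := by
  refine coeff_eq_zero_of_mul (constantCoeff_den s) fun k hk => ?_
  have h : den s * delta s
      = den s * op (ex (s / 2)) Q₁ + d * (d * ((mu * ((1 - u ^ 2) * Q)) * op (ex s) Q)) := by
    rw [delta]
    linear_combination d ^ 2 * (mu * ((1 - u ^ 2) * Q)) * op (ex s) Q * den_mul_inv s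
  rw [h]
  refine coeff_eq_zero_of_jet (fun x => ?_) hk
  rw [map_add, map_mul, map_mul, map_mul, map_mul, ev_d]
  refine (((jet_den x s).mul (jet_op_Q₁ x s)).add
    ((jet_mu_mul_Q x).mul (jet_op_Q x s)).X_mul.X_mul).congr ?_
  simp only [jetMul, List.map_cons, List.map_nil, List.zipWith_cons_cons, List.zipWith_nil_left,
    List.zipWith_nil_right, mul_zero, zero_mul, add_zero, zero_add, List.replicate]
  rcases hs with rfl | rfl
  · repeat' refine congrArg₂ List.cons ?_ ?_
    all_goals first | rfl | ring
  · repeat' refine congrArg₂ List.cons ?_ ?_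
    all_goals first | rfl | ring


/-! ### Expansion of the nonlinearity at U. -/

theorem exists_subst_eq (f : PowerSeries ℂ) {w : PSeries} (hw : PowerSeries.HasSubst w) :
    ∃ W : PSeries, PowerSeries.subst w f
      = num (PowerSeries.coeff 0 f) + num (PowerSeries.coeff 1 f) * w + w ^ 2 * W := by
  have hC : ∀ c : ℂ, PowerSeries.subst w (PowerSeries.C c) = num c := fun c => by
    rw [subst_eq_subst_map hw, PowerSeries.map_C]
    exact PowerSeries.subst_C _
  refine ⟨PowerSeries.subst w (PowerSeries.mk fun n => PowerSeries.coeff (n + 2) f), ?_⟩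
  have h : f = PowerSeries.C (PowerSeries.coeff 0 f)
      + PowerSeries.C (PowerSeries.coeff 1 f) * PowerSeries.X
      + PowerSeries.X ^ 2 * PowerSeries.mk fun n => PowerSeries.coeff (n + 2) f := by
    ext n
    rcases n with _ | _ | n
    · simp
    · simp [PowerSeries.coeff_X_pow_mul', PowerSeries.coeff_C]
    · simp [PowerSeries.coeff_X_pow_mul', PowerSeries.coeff_C, PowerSeries.coeff_X]
  conv_lhs => rw [h]
  rw [PowerSeries.subst_add hw, PowerSeries.subst_add hw, PowerSeries.subst_mul hw,
    PowerSeries.subst_mul hw, PowerSeries.subst_pow hw, PowerSeries.subst_X hw, hC, hC]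

theorem constantCoeff_U : PowerSeries.constantCoeff U = 0 := by simp [U, d]

theorem exists_U_eq : ∃ W : PSeries, U = d ^ 2 * W :=
  ⟨num (-1 / 4) * u
    + (num (91 / 864) * u ^ 3 - num (47 / 576) * u) * d ^ 2
    + (num (-319 / 2880) * u ^ 5 + num (185 / 1152) * u ^ 3 - num (3703 / 69120) * u) * d ^ 4,
    by rw [U]; ring⟩

theorem ev_two (x : ℂ) : ev x 2 = PowerSeries.C 2 := by
  rw [map_ofNat, map_ofNat]

theorem jet_d_pow_mul (x : ℂ) (Z : PSeries) : Jet (ev x (d ^ 8 * Z)) [0, 0, 0, 0, 0, 0, 0, 0] := by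
  have h : d ^ 8 * Z = d * (d * (d * (d * (d * (d * (d * (d * Z))))))) := by ring
  rw [h]
  simp only [map_mul, ev_d]
  exact (jet_nil _).X_mul.X_mul.X_mul.X_mul.X_mul.X_mul.X_mul.X_mul

theorem jet_omega_mul_U_sq (x : ℂ) :
    Jet (ev x ((1 - u ^ 2) * U ^ 2)) [
    0,
    0,
    0,
    0,
    (1 / 16) * x ^ 2 + (-1 / 16) * x ^ 4,
    0,
    (47 / 1152) * x ^ 2 + (-323 / 3456) * x ^ 4 + (91 / 1728) * x ^ 6,
    0,
    (55481 / 1658880) * x ^ 2 + (-651583 / 4976640) * x ^ 4 + (152993 / 933120) * x ^ 6 + (-248117 / 3732480) * x ^ 8] := by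
  have h : ev x ((1 - u ^ 2) * U ^ 2) = PowerSeries.C (1 - x ^ 2) * (ev x U * ev x U) := by
    simp [ev_u, sq]
  rw [h]
  refine (((jet_U x).mul (jet_U x)).C_mul _).congr ?_
  simp only [jetMul, List.map_cons, List.map_nil, List.zipWith_cons_cons, List.zipWith_nil_left,
    List.zipWith_nil_right, mul_zero, zero_mul, add_zero, zero_add]
  repeat' refine congrArg₂ List.cons ?_ ?_
  all_goals first | rfl | ring

/-- U has order 2, so w = (1 - u²) U² has order 4 and w² has order 8. Up to d^7 only the first two
coefficients of f matter. -/
theorem jet_subst_U (x : ℂ) (f : PowerSeries ℂ) :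
    Jet (ev x (PowerSeries.subst ((1 - u ^ 2) * U ^ 2) f)) [PowerSeries.coeff 0 f, 0, 0, 0,
      PowerSeries.coeff 1 f * ((1 / 16) * x ^ 2 + (-1 / 16) * x ^ 4), 0,
      PowerSeries.coeff 1 f * ((47 / 1152) * x ^ 2 + (-323 / 3456) * x ^ 4 + (91 / 1728) * x ^ 6), 0] := by
  obtain ⟨W, hW⟩ := exists_subst_eq f (hasSubst_sq constantCoeff_U)
  obtain ⟨U', hU'⟩ := exists_U_eq
  have h : ((1 - u ^ 2) * U ^ 2) ^ 2 * W = d ^ 8 * ((1 - u ^ 2) ^ 2 * U' ^ 4 * W) := by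
    rw [hU']; ring
  rw [hW, h, map_add, map_add, map_mul _ (num _), ev_num, ev_num]
  have h0 : Jet (PowerSeries.C (PowerSeries.coeff 0 f)) [PowerSeries.coeff 0 f, 0, 0, 0, 0, 0, 0, 0] := by
    rw [jet_iff]
    intro i hi
    simp only [List.length_cons, List.length_nil] at hi
    rw [PowerSeries.coeff_C]
    interval_cases i <;> simp
  refine ((h0.add ((jet_omega_mul_U_sq x).C_mul _)).add (jet_d_pow_mul x _)).congr ?_
  simp only [jetMul, List.map_cons, List.map_nil, List.zipWith_cons_cons, List.zipWith_nil_left,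
    List.zipWith_nil_right, mul_zero, zero_mul, add_zero, zero_add, List.replicate]
  repeat' refine congrArg₂ List.cons ?_ ?_
  all_goals first | rfl | ring

theorem jet_cosA_U (x : ℂ) : Jet (ev x (cosA U)) [
    1,
    0,
    0,
    0,
    (-1 / 32) * x ^ 2 + (1 / 32) * x ^ 4,
    0,
    (-47 / 2304) * x ^ 2 + (323 / 6912) * x ^ 4 + (-91 / 3456) * x ^ 6,
    0] := by
  refine (jet_subst_U x cosSqrt).congr ?_
  rw [cosSqrt, PowerSeries.coeff_mk, PowerSeries.coeff_mk]
  norm_num [Nat.factorial]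
  try constructor
  all_goals try ring

theorem jet_sinA_U (x : ℂ) : Jet (ev x (sinA U)) [
    0,
    0,
    (-1 / 4) * x ^ 1,
    0,
    (-47 / 576) * x ^ 1 + (91 / 864) * x ^ 3,
    0,
    (-3703 / 69120) * x ^ 1 + (47 / 288) * x ^ 3 + (-653 / 5760) * x ^ 5,
    0] := by
  rw [sinA, map_mul]
  refine ((jet_U x).mul (jet_subst_U x sincSqrt)).congr ?_
  rw [sincSqrt, PowerSeries.coeff_mk, PowerSeries.coeff_mk]
  norm_num [Nat.factorial]
  simp only [jetMul, List.map_cons, List.map_nil, List.zipWith_cons_cons, List.zipWith_nil_left,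
    List.zipWith_nil_right, mul_zero, zero_mul, add_zero, zero_add, List.replicate]
  repeat' refine congrArg₂ List.cons ?_ ?_
  all_goals first | rfl | ring

/-- The value at `U` of the nonlinearity. -/
def nonlin : PSeries := 2 * u * cosA U + (2 * u ^ 2 - 1) * sinA U

/-- The derivative at `U` of the nonlinearity. -/
def nonlinDeriv : PSeries := (2 * u ^ 2 - 1) * cosA U - 2 * u * (1 - u ^ 2) * sinA U

theorem jet_nonlin (x : ℂ) : Jet (ev x nonlin) [
    2 * x ^ 1,
    0,
    (1 / 4) * x ^ 1 + (-1 / 2) * x ^ 3,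
    0,
    (47 / 576) * x ^ 1 + (-143 / 432) * x ^ 3 + (59 / 216) * x ^ 5,
    0,
    (3703 / 69120) * x ^ 1 + (-10753 / 34560) * x ^ 3 + (4607 / 8640) * x ^ 5 + (-1207 / 4320) * x ^ 7,
    0] := by
  have h : ev x nonlin = PowerSeries.C (2 * x) * ev x (cosA U)
      + PowerSeries.C (2 * x ^ 2 - 1) * ev x (sinA U) := by
    simp [nonlin, ev_u, ev_two]
  rw [h]
  refine (((jet_cosA_U x).C_mul _).add ((jet_sinA_U x).C_mul _)).congr ?_
  simp only [jetMul, List.map_cons, List.map_nil, List.zipWith_cons_cons, List.zipWith_nil_left,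
    List.zipWith_nil_right, mul_zero, zero_mul, add_zero, zero_add, List.replicate]
  repeat' refine congrArg₂ List.cons ?_ ?_
  all_goals first | rfl | ring

theorem jet_nonlinDeriv (x : ℂ) : Jet (ev x nonlinDeriv) [
    (-1) + 2 * x ^ 2,
    0,
    (1 / 2) * x ^ 2 + (-1 / 2) * x ^ 4,
    0,
    (7 / 36) * x ^ 2 + (-101 / 216) * x ^ 4 + (59 / 216) * x ^ 6,
    0,
    (551 / 4320) * x ^ 2 + (-2251 / 4320) * x ^ 4 + (323 / 480) * x ^ 6 + (-1207 / 4320) * x ^ 8,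
    0] := by
  have h : ev x nonlinDeriv = PowerSeries.C (2 * x ^ 2 - 1) * ev x (cosA U)
      + PowerSeries.C (-2 * x * (1 - x ^ 2)) * ev x (sinA U) := by
    simp [nonlinDeriv, ev_u, ev_two]
    ring
  rw [h]
  refine (((jet_cosA_U x).C_mul _).add ((jet_sinA_U x).C_mul _)).congr ?_
  simp only [jetMul, List.map_cons, List.map_nil, List.zipWith_cons_cons, List.zipWith_nil_left,
    List.zipWith_nil_right, mul_zero, zero_mul, add_zero, zero_add, List.replicate]
  repeat' refine congrArg₂ List.cons ?_ ?_
  all_goals first | rfl | ring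

/-- The defect of the factorization of the linearized equation at the unshifted argument. -/
def lambda : PSeries := op (ex (1 / 2)) Q₁ + op (ex (-1 / 2)) Q₁
  + d ^ 2 * (mu * ((1 - u ^ 2) * Q)) * (Q * (2 + eps ^ 2 * nonlinDeriv))

theorem jet_two (x : ℂ) : Jet (ev x 2) [2, 0, 0, 0, 0, 0, 0, 0] := by
  rw [jet_iff]
  intro i hi
  simp only [List.length_cons, List.length_nil] at hi
  have h2 : (2 : PowerSeries ℂ) = PowerSeries.C 2 := (map_ofNat _ _).symm
  rw [map_ofNat, h2, PowerSeries.coeff_C]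
  interval_cases i <;> simp

theorem jet_linear (x : ℂ) : Jet (ev x (2 + eps ^ 2 * nonlinDeriv)) [
    2,
    0,
    (-1) + 2 * x ^ 2,
    0,
    (-1 / 12) + (2 / 3) * x ^ 2 + (-1 / 2) * x ^ 4,
    0,
    (-1 / 360) + (29 / 120) * x ^ 2 + (-55 / 108) * x ^ 4 + (59 / 216) * x ^ 6,
    0] := by
  have h : ev x (2 + eps ^ 2 * nonlinDeriv)
      = ev x 2 + PowerSeries.X * (PowerSeries.X * (ev x epsSq * ev x nonlinDeriv)) := by
    rw [eps_sq_eq, map_add, map_mul, map_mul, map_mul, ev_d]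
    ring
  rw [h]
  refine ((jet_two x).add ((jet_epsSq x).mul (jet_nonlinDeriv x)).X_mul.X_mul).congr ?_
  simp only [jetMul, List.map_cons, List.map_nil, List.zipWith_cons_cons, List.zipWith_nil_left,
    List.zipWith_nil_right, mul_zero, zero_mul, add_zero, zero_add, List.replicate]
  repeat' refine congrArg₂ List.cons ?_ ?_
  all_goals first | rfl | ring

/-- The counterpart of `coeff_delta` for the unshifted G, whose coefficient in the linearization at
U is 2 + ε² `nonlinDeriv`. -/
theorem coeff_lambda : ∀ k < 10, PowerSeries.coeff k lambda = 0 := by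
  intro k hk
  refine coeff_eq_zero_of_jet (fun x => ?_) hk
  have h : ev x lambda = ev x (op (ex (1 / 2)) Q₁) + ev x (op (ex (-1 / 2)) Q₁)
      + PowerSeries.X * (PowerSeries.X * (ev x (mu * ((1 - u ^ 2) * Q)) * (ev x Q *
        ev x (2 + eps ^ 2 * nonlinDeriv)))) := by
    rw [lambda, map_add, map_add, map_mul _ (_ * _), map_mul _ (d ^ 2), map_pow, ev_d,
      map_mul _ Q]
    ring
  rw [h]
  refine (((jet_op_Q₁ x 1).add (jet_op_Q₁ x (-1))).add
    ((jet_mu_mul_Q x).mul ((jet_Q x).mul (jet_linear x))).X_mul.X_mul).congr ?_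
  simp only [jetMul, List.map_cons, List.map_nil, List.zipWith_cons_cons, List.zipWith_nil_left,
    List.zipWith_nil_right, mul_zero, zero_mul, add_zero, zero_add, List.replicate]
  repeat' refine congrArg₂ List.cons ?_ ?_
  all_goals first | rfl | ring

/-! ### The separatrix polynomials of low order and the residual of U. -/

theorem L_iterate_1 : L^[1] 1 = C (-1 / 1 : ℂ) * Polynomial.X ^ 1 := by
  rw [Function.iterate_one]
  refine Polynomial.funext fun x => ?_
  simp [L, D]
  try ring

theorem L_iterate_2 : L^[2] 1 = C (-1 / 1 : ℂ) * Polynomial.X ^ 0 + C (2 / 1 : ℂ) * Polynomial.X ^ 2 := by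
  rw [Function.iterate_succ_apply', L_iterate_1]
  refine Polynomial.funext fun x => ?_
  simp [L, D]
  try ring

theorem L_iterate_3 : L^[3] 1 = C (5 / 1 : ℂ) * Polynomial.X ^ 1 + C (-6 / 1 : ℂ) * Polynomial.X ^ 3 := by
  rw [Function.iterate_succ_apply', L_iterate_2]
  refine Polynomial.funext fun x => ?_
  simp [L, D]
  try ring

theorem L_iterate_4 : L^[4] 1 = C (5 / 1 : ℂ) * Polynomial.X ^ 0 + C (-28 / 1 : ℂ) * Polynomial.X ^ 2 + C (24 / 1 : ℂ) * Polynomial.X ^ 4 := by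
  rw [Function.iterate_succ_apply', L_iterate_3]
  refine Polynomial.funext fun x => ?_
  simp [L, D]
  try ring

theorem L_iterate_5 : L^[5] 1 = C (-61 / 1 : ℂ) * Polynomial.X ^ 1 + C (180 / 1 : ℂ) * Polynomial.X ^ 3 + C (-120 / 1 : ℂ) * Polynomial.X ^ 5 := by
  rw [Function.iterate_succ_apply', L_iterate_4]
  refine Polynomial.funext fun x => ?_
  simp [L, D]
  try ring

theorem L_iterate_6 : L^[6] 1 = C (-61 / 1 : ℂ) * Polynomial.X ^ 0 + C (662 / 1 : ℂ) * Polynomial.X ^ 2 + C (-1320 / 1 : ℂ) * Polynomial.X ^ 4 + C (720 / 1 : ℂ) * Polynomial.X ^ 6 := by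
  rw [Function.iterate_succ_apply', L_iterate_5]
  refine Polynomial.funext fun x => ?_
  simp [L, D]
  try ring

theorem L_iterate_7 : L^[7] 1 = C (1385 / 1 : ℂ) * Polynomial.X ^ 1 + C (-7266 / 1 : ℂ) * Polynomial.X ^ 3 + C (10920 / 1 : ℂ) * Polynomial.X ^ 5 + C (-5040 / 1 : ℂ) * Polynomial.X ^ 7 := by
  rw [Function.iterate_succ_apply', L_iterate_6]
  refine Polynomial.funext fun x => ?_
  simp [L, D]
  try ring

theorem jet_sepSeries (x : ℂ) : Jet (ev x sepSeries) [
    0,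
    0,
    2 * x ^ 1,
    0,
    (-5 / 6) * x ^ 1 + 1 * x ^ 3,
    0,
    (61 / 180) * x ^ 1 + (-1) * x ^ 3 + (2 / 3) * x ^ 5,
    0,
    (-277 / 2016) * x ^ 1 + (173 / 240) * x ^ 3 + (-13 / 12) * x ^ 5 + (1 / 2) * x ^ 7] := by
  rw [jet_iff]
  intro i hi
  simp only [List.length_cons, List.length_nil] at hi
  rw [coeff_ev, sepSeries, PowerSeries.coeff_mk]
  interval_cases i
  · simp
  · simp
  · rw [if_pos (by decide), sepPoly, L_iterate_1]
    simp [Nat.factorial]; try ring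
  · rw [if_neg (by decide)]; simp
  · rw [if_pos (by decide), sepPoly, L_iterate_3]
    simp [Nat.factorial]; try ring
  · rw [if_neg (by decide)]; simp
  · rw [if_pos (by decide), sepPoly, L_iterate_5]
    simp [Nat.factorial]; try ring
  · rw [if_neg (by decide)]; simp
  · rw [if_pos (by decide), sepPoly, L_iterate_7]
    simp [Nat.factorial]; try ring

/-- The linear difference operator on the left hand side of the equation. -/
def linOp (Z : PSeries) : PSeries :=
  op (ex 1) Z * inv (den 1) + op (ex (-1)) Z * inv (den (-1)) - 2 * Z

theorem coeff_residual : ∀ k < 9, PowerSeries.coeff k (rhs U - linOp U) = 0 := by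
  refine coeff_eq_zero_of_mul (constantCoeff_den 1) (coeff_eq_zero_of_mul (constantCoeff_den (-1))
    fun k hk => ?_)
  have h : den (-1) * (den 1 * (rhs U - linOp U)) = den (-1) * den 1 *
        (d * (d * (epsSq * nonlin)) + (-1) * sepSeries + 2 * U)
      + (-1) * (den (-1) * op (ex 1) U) + (-1) * (den 1 * op (ex (-1)) U) := by
    rw [rhs, linOp, eps_sq_eq, nonlin]
    linear_combination (-den (-1) * op (ex 1) U) * den_mul_inv 1
      + (-den 1 * op (ex (-1)) U) * den_mul_inv (-1)
  rw [h]
  refine coeff_eq_zero_of_jet (fun x => ?_) hk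
  have hm : ∀ Z : PSeries, ev x (-1 * Z) = PowerSeries.C (-1) * ev x Z := fun Z => by simp
  have h2 : ev x (2 * U) = PowerSeries.C 2 * ev x U := by
    rw [map_mul, map_ofNat, map_ofNat]
  simp only [map_add, hm, h2, map_mul (ev x) (den _), map_mul (ev x) (den _ * _), ev_d,
    map_mul (ev x) d, map_mul (ev x) epsSq]
  refine (((((jet_den x (-1)).mul (jet_den x 1)).mul (((((jet_epsSq x).mul (jet_nonlin x)).X_mul.X_mul).add
    ((jet_sepSeries x).C_mul (-1))).add ((jet_U x).C_mul 2))).add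
    (((jet_den x (-1)).mul (jet_op_U x 1)).C_mul (-1))).add
    (((jet_den x 1).mul (jet_op_U x (-1))).C_mul (-1))).congr ?_
  simp only [jetMul, List.map_cons, List.map_nil, List.zipWith_cons_cons, List.zipWith_nil_left,
    List.zipWith_nil_right, mul_zero, zero_mul, add_zero, zero_add, List.replicate]
  repeat' refine congrArg₂ List.cons ?_ ?_
  all_goals first | rfl | ring


/-! ### The equation for `F` -/

theorem den_neg_one : den (-1) = coshS 1 - u * sinhS 1 := by
  rw [den, coshS, sinhS, coshS, sinhS, neg_neg]
  ring

theorem linOp_sub (Y Z : PSeries) : linOp (Y - Z) = linOp Y - linOp Z := by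
  rw [linOp, linOp, linOp, op_sub, op_sub]
  ring

theorem linOp_d_mul (Z : PSeries) : linOp (d * Z) = d * linOp Z := by
  rw [linOp, linOp, op_d_mul, op_d_mul]
  ring

theorem linOp_d_pow_mul (m : ℕ) (Z : PSeries) : linOp (d ^ m * Z) = d ^ m * linOp Z := by
  induction m with
  | zero => simp
  | succ m ih => rw [pow_succ', mul_assoc, linOp_d_mul, ih, mul_assoc]

theorem IsFormalSolution.linOp_eq {A : PSeries} (hA : IsFormalSolution A) : linOp A = rhs A := by
  rw [← hA.equation, linOp, substU_T, substU_T, den_neg_one, den]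

theorem IsFormalSolution.constantCoeff {A : PSeries} (hA : IsFormalSolution A) :
    PowerSeries.constantCoeff A = 0 := by
  rw [← PowerSeries.coeff_zero_eq_constantCoeff_apply]
  exact hA.coeff_zero

/-- `cos (F √(1-u²)) - 1`. -/
def cosRem (A : PSeries) : PSeries := cosDiff A U - 1

/-- `sin (F √(1-u²)) / √(1-u²) - F`. -/
def sinRem (A : PSeries) : PSeries := sinDiff A U - F A

/-- An exact expansion at U: by the addition theorems cos and sin of F replace a Taylor series, and
no remainder has to be estimated separately. -/
theorem rhs_eq (A : PSeries) :
    rhs A = rhs U + eps ^ 2 * (nonlin * cosRem A + nonlinDeriv * (F A + sinRem A)) := by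
  rw [rhs, rhs, cosA_eq (A := A) constantCoeff_U, sinA_eq (A := A) constantCoeff_U, nonlin,
    nonlinDeriv, cosRem, sinRem]
  ring

theorem IsFormalSolution.linOp_F {A : PSeries} (hA : IsFormalSolution A) :
    linOp (F A) = (rhs U - linOp U)
      + eps ^ 2 * (nonlin * cosRem A + nonlinDeriv * (F A + sinRem A)) := by
  rw [F, linOp_sub, hA.linOp_eq, rhs_eq A, F]
  ring

theorem constantCoeff_F {A : PSeries} (hA : IsFormalSolution A) :
    PowerSeries.constantCoeff (F A) = 0 := by
  rw [F, map_sub, hA.constantCoeff, constantCoeff_U, sub_zero]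

theorem constantCoeff_cosRem {A : PSeries} (hA : IsFormalSolution A) :
    PowerSeries.constantCoeff (cosRem A) = 0 := by
  rw [cosRem, cosDiff]
  simp [constantCoeff_cosA hA.constantCoeff, constantCoeff_cosA constantCoeff_U,
    constantCoeff_sinA constantCoeff_U]

theorem constantCoeff_sinRem {A : PSeries} (hA : IsFormalSolution A) :
    PowerSeries.constantCoeff (sinRem A) = 0 := by
  rw [sinRem, sinDiff]
  simp [constantCoeff_sinA hA.constantCoeff, constantCoeff_F hA,
    constantCoeff_sinA constantCoeff_U]

/-! ### Orders of vanishing of F and of its nonlinear remainders. -/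

theorem der_cosRem {A : PSeries} (hA : IsFormalSolution A) :
    der (cosRem A) = -((1 - u ^ 2) * (F A + sinRem A) * der (F A)) := by
  rw [cosRem, der_sub, der_one, sub_zero, der_cosDiff hA.constantCoeff constantCoeff_U, sinRem, F]
  ring

theorem der_F_add_sinRem {A : PSeries} (hA : IsFormalSolution A) :
    der (F A + sinRem A) = (1 + cosRem A) * der (F A) := by
  rw [sinRem, add_sub_cancel, der_sinDiff hA.constantCoeff constantCoeff_U, cosRem, F]
  ring

theorem der_sinRem {A : PSeries} (hA : IsFormalSolution A) :
    der (sinRem A) = cosRem A * der (F A) := by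
  have h := der_F_add_sinRem hA
  rw [der_add] at h
  linear_combination h

theorem d_pow_dvd_iff {n : ℕ} {Z : PSeries} :
    d ^ n ∣ Z ↔ ∀ k < n, PowerSeries.coeff k Z = 0 := PowerSeries.X_pow_dvd_iff

theorem d_pow_dvd_of_der {n : ℕ} {Z : PSeries} (h : d ^ n ∣ der Z)
    (h0 : PowerSeries.constantCoeff Z = 0) : d ^ (n + 1) ∣ Z := by
  rw [d_pow_dvd_iff] at h ⊢
  intro k hk
  rcases k with _ | k
  · simpa using h0
  · have := h k (by omega)
    rw [coeff_der] at this
    have h1 : ((k : ℂ[X]) + 1) ≠ 0 := by exact_mod_cast Nat.succ_ne_zero k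
    simpa [h1] using this

theorem d_pow_dvd_der {n : ℕ} {Z : PSeries} (h : d ^ (n + 1) ∣ Z) : d ^ n ∣ der Z := by
  rw [d_pow_dvd_iff] at h ⊢
  intro k hk
  rw [coeff_der, h (k + 1) (by omega), zero_mul]

/-- The remainders are at least quadratic in F, as their differential equations show. Only one extra
power of d is kept, which is enough for `d_pow_dvd_F_step`. -/
theorem d_pow_dvd_cosRem {A : PSeries} (hA : IsFormalSolution A) {m : ℕ}
    (h : d ^ (m + 1) ∣ F A) : d ^ (m + 2) ∣ cosRem A ∧ d ^ (m + 2) ∣ sinRem A := by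
  have h1 := d_pow_dvd_der h
  have h2 : d ^ (m + 1) ∣ F A + sinRem A := by
    refine d_pow_dvd_of_der ?_ ?_
    · rw [der_F_add_sinRem hA]
      exact h1.mul_left _
    · rw [map_add, constantCoeff_F hA, constantCoeff_sinRem hA, add_zero]
  have h3 : d ^ (m + 2) ∣ cosRem A := by
    refine d_pow_dvd_of_der ?_ (constantCoeff_cosRem hA)
    rw [der_cosRem hA]
    exact ((h2.mul_left _).mul_right _).neg_right
  refine ⟨h3, d_pow_dvd_of_der ?_ (constantCoeff_sinRem hA)⟩
  rw [der_sinRem hA]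
  exact ((pow_dvd_pow d (Nat.le_succ _)).trans h3).mul_right _

/-- After cancellation r = p' satisfies (1 - u²) r' = 4 u r. For r ≠ 0 of degree n the leading
coefficients would give -n = 4. -/
theorem derivative_eq_zero_of_D_D {p : ℂ[X]} (h : D (D p) = 2 * Polynomial.X * D p) :
    derivative p = 0 := by
  have h0 := one_sub_X_sq_ne_zero
  have h1 : (1 - Polynomial.X ^ 2 : ℂ[X]) * ((1 - Polynomial.X ^ 2) * derivative (derivative p))
      = (1 - Polynomial.X ^ 2) * (4 * Polynomial.X * derivative p) := by
    have h2 : D (D p) = (1 - Polynomial.X ^ 2) * ((1 - Polynomial.X ^ 2) * derivative (derivative p)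
        - 2 * Polynomial.X * derivative p) := by
      simp only [D, derivative_mul, derivative_sub, derivative_one, derivative_X_pow]
      rw [show (C ((2 : ℕ) : ℂ) : ℂ[X]) = 2 from map_natCast C 2]
      ring
    rw [h2, D] at h
    linear_combination h
  have h3 := mul_left_cancel₀ h0 h1
  set r := derivative p with hr
  by_contra hne
  have h4 := congrArg (fun q => Polynomial.coeff q (r.natDegree + 1)) h3
  have h5 : (4 * Polynomial.X * r) = Polynomial.X * (C 4 * r) := by
    rw [show (C 4 : ℂ[X]) = 4 from map_ofNat _ _]; ring
  rw [h5, sub_mul, one_mul, Polynomial.coeff_sub, Polynomial.coeff_X_mul, Polynomial.coeff_C_mul,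
    Polynomial.coeff_derivative, Polynomial.coeff_eq_zero_of_natDegree_lt (by omega), zero_mul,
    zero_sub] at h4
  have hlc : r.coeff r.natDegree ≠ 0 := leadingCoeff_ne_zero.mpr hne
  rcases hn : r.natDegree with _ | n
  · rw [hn, sq, mul_assoc, Polynomial.coeff_X_mul, Polynomial.mul_coeff_zero, Polynomial.coeff_X_zero,
      zero_mul, neg_zero] at h4
    rw [hn] at hlc
    simp [hlc] at h4
  · rw [hn, sq, mul_assoc, Polynomial.coeff_X_mul, Polynomial.coeff_X_mul,
      Polynomial.coeff_derivative] at h4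
    rw [hn] at hlc
    have h6 : (4 + ((n : ℂ) + 1)) * r.coeff (n + 1) = 0 := by linear_combination -h4
    have h7 : (4 + ((n : ℂ) + 1)) ≠ 0 := by exact_mod_cast (by omega : 4 + (n + 1) ≠ 0)
    exact hlc ((mul_eq_zero.mp h6).resolve_left h7)

theorem eq_zero_of_D_D {p : ℂ[X]} (h : D (D p) = 2 * Polynomial.X * D p)
    (hodd : p.comp (-Polynomial.X) = -p) : p = 0 := by
  obtain ⟨c, rfl⟩ : ∃ c, p = C c :=
    ⟨_, Polynomial.eq_C_of_derivative_eq_zero (derivative_eq_zero_of_D_D h)⟩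
  rw [Polynomial.C_comp] at hodd
  exact self_eq_neg.mp hodd

theorem coeff_den (θ : ℂ) : PowerSeries.coeff 0 (den θ) = 1 ∧
    PowerSeries.coeff 1 (den θ) = C θ * Polynomial.X ∧
    PowerSeries.coeff 2 (den θ) = C (θ ^ 2 / 2) := by
  refine ⟨Polynomial.funext fun x => ?_, Polynomial.funext fun x => ?_, Polynomial.funext fun x => ?_⟩
  · rw [← coeff_ev, (jet_den x θ).coeff_eq (by simp)]; simp
  · rw [← coeff_ev, (jet_den x θ).coeff_eq (by simp)]
    simp only [List.getD_cons_succ, List.getD_cons_zero, Polynomial.eval_mul, Polynomial.eval_C,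
      Polynomial.eval_X]
    ring
  · rw [← coeff_ev, (jet_den x θ).coeff_eq (by simp)]; simp

theorem coeff_mul_low (Y Z : PSeries) :
    PowerSeries.coeff 0 (Y * Z) = PowerSeries.coeff 0 Y * PowerSeries.coeff 0 Z ∧
    PowerSeries.coeff 1 (Y * Z) = PowerSeries.coeff 0 Y * PowerSeries.coeff 1 Z
      + PowerSeries.coeff 1 Y * PowerSeries.coeff 0 Z ∧
    PowerSeries.coeff 2 (Y * Z) = PowerSeries.coeff 0 Y * PowerSeries.coeff 2 Z
      + PowerSeries.coeff 1 Y * PowerSeries.coeff 1 Z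
      + PowerSeries.coeff 2 Y * PowerSeries.coeff 0 Z := by
  refine ⟨?_, ?_, ?_⟩
  · rw [PowerSeries.coeff_mul]; simp
  · rw [PowerSeries.coeff_mul, Finset.Nat.sum_antidiagonal_succ]; simp
  · rw [PowerSeries.coeff_mul, Finset.Nat.sum_antidiagonal_succ, Finset.Nat.sum_antidiagonal_succ]
    simp [add_assoc]

theorem coeff_op_ex_low (θ : ℂ) (Z : PSeries) :
    PowerSeries.coeff 0 (op (ex θ) Z) = PowerSeries.coeff 0 Z ∧
    PowerSeries.coeff 1 (op (ex θ) Z) = PowerSeries.coeff 1 Z + C θ * DL (PowerSeries.coeff 0 Z) ∧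
    PowerSeries.coeff 2 (op (ex θ) Z) = PowerSeries.coeff 2 Z + C θ * DL (PowerSeries.coeff 1 Z)
      + C (θ ^ 2 / 2) * DL (DL (PowerSeries.coeff 0 Z)) := by
  refine ⟨?_, ?_, ?_⟩
  · rw [coeff_op]; simp [coeff_ex]
  · rw [coeff_op, Finset.Nat.sum_antidiagonal_succ]
    simp [coeff_ex, Polynomial.smul_eq_C_mul]
  · rw [coeff_op, Finset.Nat.sum_antidiagonal_succ, Finset.Nat.sum_antidiagonal_succ]
    simp only [coeff_ex, Polynomial.smul_eq_C_mul, Finset.Nat.antidiagonal_zero,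
      Finset.sum_singleton, pow_zero, pow_one, Nat.factorial, zero_add, Module.End.one_apply,
      sq (DL), Module.End.mul_apply, Nat.reduceAdd]
    norm_num
    ring

/-- The orders d^0 and d^1 cancel between the two opposite shifts. At d² the expansions of exp(±d D)
and of the denominators leave the operator D² - 2uD + 2u² - 1 on the leading coefficient. -/
theorem coeff_two_linOp {Z : PSeries} (h1 : PowerSeries.coeff 1 Z = 0) {W : PSeries}
    (h : d ^ 3 ∣ linOp Z - d ^ 2 * W) :
    DL (DL (PowerSeries.coeff 0 Z)) - 2 * Polynomial.X * DL (PowerSeries.coeff 0 Z)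
      + (2 * Polynomial.X ^ 2 - 1) * PowerSeries.coeff 0 Z = PowerSeries.coeff 0 W := by
  have h2 : den (-1) * den 1 * (linOp Z - d ^ 2 * W)
      = den (-1) * op (ex 1) Z + den 1 * op (ex (-1)) Z - den (-1) * (den 1 * (Z + Z))
        - d * (d * (den (-1) * (den 1 * W))) := by
    rw [linOp]
    linear_combination (den (-1) * op (ex 1) Z) * den_mul_inv 1
      + (den 1 * op (ex (-1)) Z) * den_mul_inv (-1)
  have h3 := (d_pow_dvd_iff.mp (h.mul_left (den (-1) * den 1))) 2 (by norm_num)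
  rw [h2] at h3
  obtain ⟨a0, a1, a2⟩ := coeff_den 1
  obtain ⟨b0, b1, b2⟩ := coeff_den (-1)
  have h4 : ∀ V : PSeries, PowerSeries.coeff 2 (d * (d * V)) = PowerSeries.coeff 0 V := fun V => by
    rw [coeff_d_mul, coeff_d_mul]
  have hC : (C (1 / 2 : ℂ) : ℂ[X]) * 2 = 1 := by
    rw [← map_ofNat C 2, ← C_mul]; norm_num
  rw [map_sub, h4] at h3
  simp only [map_sub, map_add, (coeff_mul_low _ _).1, (coeff_mul_low _ _).2.1,
    (coeff_mul_low _ _).2.2, (coeff_op_ex_low _ _).1, (coeff_op_ex_low _ _).2.1,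
    (coeff_op_ex_low _ _).2.2, a0, a1, a2, b0, b1, b2, h1, map_zero, one_pow, C_1, C_neg,
    neg_one_sq] at h3
  linear_combination h3 + (PowerSeries.coeff 0 Z - DL (DL (PowerSeries.coeff 0 Z))) * hC


/-- The substitution `u ↦ -u`. -/
def reflect : PSeries →+* PSeries := PowerSeries.map (Polynomial.compRingHom (-Polynomial.X))

theorem coeff_reflect (Z : PSeries) (n : ℕ) :
    PowerSeries.coeff n (reflect Z) = (PowerSeries.coeff n Z).comp (-Polynomial.X) := by
  simp [reflect]

theorem reflect_d : reflect d = d := by simp [reflect, d]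
theorem reflect_u : reflect u = -u := by simp [reflect, u]
theorem reflect_num (c : ℂ) : reflect (num c) = num c := by simp [reflect]

theorem reflect_U : reflect U = -U := by
  rw [U]
  simp only [map_add, map_sub, map_mul, map_pow, reflect_d, reflect_u, reflect_num]
  ring

theorem reflect_Q : reflect Q = Q := by
  rw [Q]
  simp only [map_add, map_sub, map_mul, map_pow, map_one, reflect_d, reflect_u, reflect_num]
  ring

theorem constantCoeff_Q : PowerSeries.constantCoeff Q = 1 := by simp [Q, d]

theorem reflect_inv_Q : reflect (inv Q) = inv Q := by
  have h1 := mul_inv Q constantCoeff_Q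
  have h2 := congrArg reflect h1
  rw [map_mul, reflect_Q, map_one] at h2
  linear_combination (inv Q) * h2 - reflect (inv Q) * h1

theorem IsFormalSolution.reflect {A : PSeries} (hA : IsFormalSolution A) : reflect A = -A := by
  ext1 n
  rw [coeff_reflect, map_neg]
  rcases Nat.even_or_odd' n with ⟨m, rfl | rfl⟩
  · exact hA.odd m
  · rw [hA.coeff_odd]; simp

theorem reflect_F {A : PSeries} (hA : IsFormalSolution A) : reflect (F A) = -F A := by
  rw [F, map_sub, hA.reflect, reflect_U]; ring

theorem coeff_odd_U (n : ℕ) : PowerSeries.coeff (2 * n + 1) U = 0 := by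
  rw [U_eq]
  simp only [d, map_add (PowerSeries.coeff (2 * n + 1)), PowerSeries.coeff_C_mul,
    PowerSeries.coeff_X_pow]
  rw [if_neg (by omega), if_neg (by omega), if_neg (by omega)]
  simp

theorem coeff_odd_F {A : PSeries} (hA : IsFormalSolution A) (n : ℕ) :
    PowerSeries.coeff (2 * n + 1) (F A) = 0 := by
  rw [F, map_sub, hA.coeff_odd, coeff_odd_U, sub_zero]

theorem d_ne_zero : (d : PSeries) ≠ 0 := PowerSeries.X_ne_zero

theorem coeff_zero_nonlinDeriv :
    PowerSeries.coeff 0 (epsSq * nonlinDeriv) = 2 * Polynomial.X ^ 2 - 1 := by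
  refine Polynomial.funext fun x => ?_
  rw [(coeff_mul_low _ _).1, Polynomial.eval_mul, ← coeff_ev, ← coeff_ev,
    (jet_epsSq x).coeff_eq (by simp), (jet_nonlinDeriv x).coeff_eq (by simp)]
  simp
  ring

/-- Both sides contain (2u² - 1) times the leading coefficient p of F, so what remains is D² p = 2u
D p. Its polynomial solutions are constants, and p is odd, so p = 0. The next coefficient of F
vanishes by parity. The limit m ≤ 2 reflects that the residual is known to vanish only below d^9. -/
theorem d_pow_dvd_F_step {A : PSeries} (hA : IsFormalSolution A) {m : ℕ} (hm : m ≤ 2)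
    (h : d ^ (2 * m + 2) ∣ F A) : d ^ (2 * (m + 1) + 2) ∣ F A := by
  obtain ⟨Z, hZ⟩ := id h
  have hcoeff : ∀ k, PowerSeries.coeff (k + (2 * m + 2)) (F A) = PowerSeries.coeff k Z := fun k => by
    rw [hZ, d, PowerSeries.coeff_X_pow_mul]
  have h1 : PowerSeries.coeff 1 Z = 0 := by
    rw [← hcoeff, show 1 + (2 * m + 2) = 2 * (m + 1) + 1 by ring, coeff_odd_F hA]
  obtain ⟨hc, hs⟩ := d_pow_dvd_cosRem hA (m := 2 * m + 1) h
  have h2 : d ^ (2 * m + 2) * (linOp Z - d ^ 2 * (epsSq * nonlinDeriv * Z))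
      = (rhs U - linOp U) + d ^ 2 * (epsSq * (nonlin * cosRem A + nonlinDeriv * sinRem A)) := by
    have h3 := hA.linOp_F
    have h4 := linOp_d_pow_mul (2 * m + 2) Z
    rw [← hZ] at h4
    rw [mul_sub, ← h4, h3, eps_sq_eq]
    linear_combination (d ^ 2 * epsSq * nonlinDeriv) * hZ
  have h5 : d ^ (2 * m + 2) * d ^ 3 ∣ d ^ (2 * m + 2) * (linOp Z - d ^ 2 * (epsSq * nonlinDeriv * Z)) := by
    rw [h2, ← pow_add]
    refine dvd_add ?_ ?_
    · exact (pow_dvd_pow d (by omega)).trans (d_pow_dvd_iff.mpr coeff_residual)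
    · rw [show 2 * m + 2 + 3 = 2 + (2 * m + 1 + 2) by ring, pow_add]
      exact mul_dvd_mul_left _ (((hc.mul_left _).add (hs.mul_left _)).mul_left _)
  have h6 := coeff_two_linOp h1 ((mul_dvd_mul_iff_left (pow_ne_zero _ d_ne_zero)).mp h5)
  rw [(coeff_mul_low _ _).1, coeff_zero_nonlinDeriv] at h6
  have h7 : PowerSeries.coeff 0 Z = 0 := by
    refine eq_zero_of_D_D ?_ ?_
    · rw [← DL_apply, ← DL_apply]
      linear_combination h6
    · rw [← hcoeff, ← coeff_reflect, reflect_F hA, map_neg]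
  rw [d_pow_dvd_iff] at h ⊢
  intro k hk
  rcases lt_or_ge k (2 * m + 2) with h8 | h8
  · exact h k h8
  · obtain ⟨j, rfl⟩ := Nat.exists_eq_add_of_le' h8
    rw [hcoeff]
    have : j < 2 := by omega
    interval_cases j
    · exact h7
    · exact h1

/-- The polynomial `U` is the formal solution up to order six. -/
theorem d_pow_dvd_F {A : PSeries} (hA : IsFormalSolution A) : d ^ 8 ∣ F A := by
  have h0 : d ^ (2 * 0 + 2) ∣ F A := by
    rw [d_pow_dvd_iff]
    intro k hk
    rcases k with _ | k
    · simpa using constantCoeff_F hA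
    · obtain rfl : k = 0 := by omega
      exact coeff_odd_F hA 0
  exact d_pow_dvd_F_step hA (m := 2) le_rfl (d_pow_dvd_F_step hA (m := 1) (by norm_num)
    (d_pow_dvd_F_step hA (m := 0) (by norm_num) h0))

/-! ### The fixed point equation -/

theorem S_eq_sub (Z : PSeries) :
    2 * S Z = op (ex (1 / 2)) Z - op (ex (-(1 / 2))) Z := by
  rw [S, substU_T, substU_T]
  linear_combination (op (ex (1 / 2)) Z - op (ex (-(1 / 2))) Z) * two_mul_num_half

theorem op_ex_op_ex (a b : ℂ) (Z : PSeries) : op (ex a) (op (ex b) Z) = op (ex (a + b)) Z := by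
  rw [← op_mul, ex_mul]

/-- 2𝒮 is a difference of half shifts, shifts are multiplicative, and two half shifts compose to a
full shift or to the identity. -/
theorem four_mul_S_mul_S (Z : PSeries) :
    4 * S (Q₁ * S Z) = op (ex (1 / 2)) Q₁ * op (ex 1) Z + op (ex (-1 / 2)) Q₁ * op (ex (-1)) Z
      - (op (ex (1 / 2)) Q₁ + op (ex (-1 / 2)) Q₁) * Z := by
  have e1 : ∀ θ : ℂ, 2 * op (ex θ) (S Z) = op (ex (θ + 1 / 2)) Z - op (ex (θ + -(1 / 2))) Z := by
    intro θ
    have h := congrArg (op (ex θ)) (S_eq_sub Z)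
    rw [op_sub, op_ex_op_ex, op_ex_op_ex, two_mul, op_add] at h
    rw [two_mul, h]
  have h1 := S_eq_sub (Q₁ * S Z)
  rw [op_ex_mul, op_ex_mul] at h1
  have h2 := e1 (1 / 2)
  have h3 := e1 (-(1 / 2))
  rw [show (1 : ℂ) / 2 + 1 / 2 = 1 by norm_num, add_neg_cancel, ex_zero, op_one] at h2
  rw [show -((1 : ℂ) / 2) + -(1 / 2) = -1 by norm_num, neg_add_cancel, ex_zero, op_one] at h3
  rw [show (-1 : ℂ) / 2 = -(1 / 2) by norm_num]
  linear_combination 2 * h1 + op (ex (1 / 2)) Q₁ * h2 - op (ex (-(1 / 2))) Q₁ * h3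

/-- Combines the previous expansion with the equation for F = Q G multiplied by d² μ (1 - u²) Q. By
definition `delta` and `lambda` are what is left of the terms linear in G. -/
theorem four_mul_S_mul_S_G {A : PSeries} (hA : IsFormalSolution A) :
    4 * S (Q₁ * S (G A)) = delta 1 * op (ex 1) (G A) + delta (-1) * op (ex (-1)) (G A)
      - lambda * G A - d ^ 2 * (mu * ((1 - u ^ 2) * Q)) * ((rhs U - linOp U)
        + eps ^ 2 * (nonlin * cosRem A + nonlinDeriv * sinRem A)) := by
  have h1 := hA.linOp_F
  rw [linOp, ← Q_mul_G, op_ex_mul, op_ex_mul] at h1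
  rw [four_mul_S_mul_S, delta, delta, lambda]
  linear_combination -(d ^ 2 * (mu * ((1 - u ^ 2) * Q))) * h1


/-! ### Geometric growth of the explicit series -/

theorem geo_two : Geo 2 := by
  rw [← one_add_one_eq_two]
  exact geo_one.add geo_one

theorem geo_d_sq : Geo (d ^ 2) := geo_d.pow 2

/-- `U / d`. -/
def UDiv : PSeries := num (-1 / 4) * (u * d)
    + (num (91 / 864) * (u * d) ^ 3 - num (47 / 576) * (u * d) * d ^ 2)
    + (num (-319 / 2880) * (u * d) ^ 5 + num (185 / 1152) * (u * d) ^ 3 * d ^ 2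
      - num (3703 / 69120) * (u * d) * d ^ 4)

theorem U_eq_d_mul : U = d * UDiv := by rw [U, UDiv]; ring

theorem geo_UDiv : Geo UDiv := by
  have h := geo_u_mul_d
  exact (((geo_num _).mul h).add (((geo_num _).mul (h.pow 3)).sub
    (((geo_num _).mul h).mul geo_d_sq))).add ((((geo_num _).mul (h.pow 5)).add
      (((geo_num _).mul (h.pow 3)).mul geo_d_sq)).sub (((geo_num _).mul h).mul (geo_d.pow 4)))

theorem geo_Q : Geo Q := by
  have h := geo_u_mul_d
  have e : Q = 1 + num (1 / 4) * ((1 - u ^ 2) * d ^ 2)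
      + (num (91 / 432) * (u * d) ^ 4 - num (13 / 48) * (u * d) ^ 2 * d ^ 2 + num (13 / 216) * d ^ 4)
      + (num (-319 / 960) * (u * d) ^ 6 + num (1079 / 1728) * (u * d) ^ 4 * d ^ 2
        - num (937 / 2880) * (u * d) ^ 2 * d ^ 4 + num (287 / 8640) * d ^ 6) := by
    rw [Q]; ring
  rw [e]
  refine ((geo_one.add ((geo_num _).mul geo_omega)).add ?_).add ?_
  · exact (((geo_num _).mul (h.pow 4)).sub (((geo_num _).mul (h.pow 2)).mul geo_d_sq)).add
      ((geo_num _).mul (geo_d.pow 4))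
  · exact ((((geo_num _).mul (h.pow 6)).add (((geo_num _).mul (h.pow 4)).mul geo_d_sq)).sub
      (((geo_num _).mul (h.pow 2)).mul (geo_d.pow 4))).add ((geo_num _).mul (geo_d.pow 6))

/-- The series with `Q₁ = -(1 - u²) d² Q₁Div`. -/
def Q₁Div : PSeries := 1 - num (1 / 4) * (d ^ 2 + (u * d) ^ 2)
    + num (5 / 48) * (num (4 / 9) * (u * d) ^ 4 + (u * d) ^ 2 * d ^ 2 + d ^ 4)
    - (num (-367 / 2160) * (u * d) ^ 6 + num (185 / 432) * (u * d) ^ 4 * d ^ 2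
      - num (997 / 4320) * (u * d) ^ 2 * d ^ 4)

theorem Q₁_eq_mul : Q₁ = -((1 - u ^ 2) * d ^ 2 * Q₁Div) := by rw [Q₁, Q₁Div]; ring

theorem constantCoeff_Q₁Div : PowerSeries.constantCoeff Q₁Div = 1 := by simp [Q₁Div, d]

theorem geo_Q₁Div : Geo Q₁Div := by
  have h := geo_u_mul_d
  refine ((geo_one.sub ((geo_num _).mul (geo_d_sq.add (h.pow 2)))).add ((geo_num _).mul ?_)).sub ?_
  · exact (((geo_num _).mul (h.pow 4)).add ((h.pow 2).mul geo_d_sq)).add (geo_d.pow 4)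
  · exact (((geo_num _).mul (h.pow 6)).add (((geo_num _).mul (h.pow 4)).mul geo_d_sq)).sub
      (((geo_num _).mul (h.pow 2)).mul (geo_d.pow 4))

theorem geo_Q₁ : Geo Q₁ := by
  rw [Q₁_eq_mul]
  exact (geo_omega.mul geo_Q₁Div).neg

theorem geo_mu : Geo mu :=
  ((geo_one.sub ((geo_num _).mul geo_d_sq)).add ((geo_num _).mul (geo_d.pow 4))).sub
    ((geo_num _).mul (geo_d.pow 6))

theorem geo_epsSq : Geo epsSq := ((geo_num _).mul (geo_sinhcS _)).pow 2

/-- `d² μ (1 - u²) Q`. -/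
def weight : PSeries := d ^ 2 * (mu * ((1 - u ^ 2) * Q))

theorem weight_eq : weight = (1 - u ^ 2) * d ^ 2 * (mu * Q) := by rw [weight]; ring

theorem geo_weight : Geo weight := by
  rw [weight_eq]
  exact geo_omega.mul (geo_mu.mul geo_Q)

theorem geo_inv_den (θ : ℂ) : Geo (inv (den θ)) := geo_inv (geo_den θ) (constantCoeff_den θ)

theorem geo_delta (s : ℂ) : Geo (delta s) :=
  (geo_Q₁.op_ex _).add (geo_weight.mul ((geo_Q.op_ex _).mul (geo_inv_den s)))

/-- The constant coefficients 2u and 2u² - 1 show that `nonlin` and `nonlinDeriv` exceed the grading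
by one and two degrees. Powers of d taken from ε² restore it. -/
theorem geo_d_mul_nonlin : Geo (d * nonlin) := by
  have e : d * nonlin = 2 * (u * d) * cosA (d * UDiv)
      + (2 * (u * d) ^ 2 - d ^ 2) * sinD UDiv := by
    rw [nonlin, U_eq_d_mul, ← d_mul_sinD]; ring
  rw [e]
  exact ((geo_two.mul geo_u_mul_d).mul geo_UDiv.trig.1).add
    (((geo_two.mul (geo_u_mul_d.pow 2)).sub geo_d_sq).mul geo_UDiv.trig.2)

theorem geo_d_sq_mul_nonlinDeriv : Geo (d ^ 2 * nonlinDeriv) := by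
  have e : d ^ 2 * nonlinDeriv = (2 * (u * d) ^ 2 - d ^ 2) * cosA (d * UDiv)
      - 2 * (u * d) * ((1 - u ^ 2) * d ^ 2) * sinD UDiv := by
    rw [nonlinDeriv, U_eq_d_mul, ← d_mul_sinD]; ring
  rw [e]
  exact (((geo_two.mul (geo_u_mul_d.pow 2)).sub geo_d_sq).mul geo_UDiv.trig.1).sub
    (((geo_two.mul geo_u_mul_d).mul geo_omega).mul geo_UDiv.trig.2)

theorem geo_lambda : Geo lambda := by
  have e : lambda = op (ex (1 / 2)) Q₁ + op (ex (-1 / 2)) Q₁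
      + weight * (Q * (2 + epsSq * (d ^ 2 * nonlinDeriv))) := by
    rw [lambda, weight, eps_sq_eq]; ring
  rw [e]
  exact ((geo_Q₁.op_ex _).add (geo_Q₁.op_ex _)).add
    (geo_weight.mul (geo_Q.mul (geo_two.add (geo_epsSq.mul geo_d_sq_mul_nonlinDeriv))))

theorem Geo.linOp {Z : PSeries} (hZ : Geo Z) : Geo (linOp Z) :=
  (((hZ.op_ex _).mul (geo_inv_den _)).add ((hZ.op_ex _).mul (geo_inv_den _))).sub (geo_two.mul hZ)

/-- Applying L in degree n costs n from D plus a constant from the factor u. The resulting n!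
cancels against the factorial in `sepPoly`. -/
theorem L_iterate_bound : ∃ K : ℝ, 1 ≤ K ∧ ∀ n : ℕ, (L^[n] 1).natDegree ≤ n ∧
    tauNorm n (L^[n] 1) ≤ n.factorial * K ^ n * tauNorm 0 1 := by
  set B := tauNorm 1 Polynomial.X with hB
  have hB0 : 0 ≤ B := tauNorm_nonneg _ _
  have hm := one_le_mulK
  have hK : 0 ≤ mulK * B := by positivity
  refine ⟨mulK * B + 1, by linarith, fun n => ?_⟩
  induction n with
  | zero => simp
  | succ n ih =>
    obtain ⟨h1, h2⟩ := ih
    rw [Function.iterate_succ_apply', L, ← DL_apply]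
    have h3 := natDegree_DL_pow_le h1 1
    rw [pow_one] at h3
    refine ⟨(Polynomial.natDegree_sub_le _ _).trans (max_le h3 ?_), ?_⟩
    · exact Polynomial.natDegree_mul_le.trans (by rw [Polynomial.natDegree_X]; omega)
    · have h4 := tauNorm_DL_pow_le (L^[n] 1) n 1
      have h5 := tauNorm_mul_le (m := 1) (n := n) Polynomial.natDegree_X.le h1
      rw [pow_one, show n.ascFactorial 1 = n by simp [Nat.ascFactorial]] at h4
      rw [add_comm 1 n] at h5
      set t := tauNorm n (L^[n] 1) with ht
      have ht0 : 0 ≤ t := tauNorm_nonneg _ _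
      have h6 : tauNorm (n + 1) (DL (L^[n] 1) - Polynomial.X * L^[n] 1) ≤ n * t + mulK * B * t := by
        rw [sub_eq_add_neg]
        refine (tauNorm_add_le _ _ _).trans ?_
        rw [tauNorm_neg]
        exact add_le_add h4 h5
      have hn : (0 : ℝ) ≤ n := n.cast_nonneg
      calc _ ≤ (n + mulK * B) * t := by linarith
        _ ≤ ((n + 1) * (mulK * B + 1)) * t := by
            gcongr
            nlinarith
        _ ≤ ((n + 1) * (mulK * B + 1)) * (n.factorial * (mulK * B + 1) ^ n * tauNorm 0 1) := by
            gcongr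
        _ = _ := by rw [Nat.factorial_succ, pow_succ]; push_cast; ring

/-- `∑ I_{2n-1} d^{2n-1}`. -/
def sepDiv : PSeries := PowerSeries.mk fun m => PowerSeries.coeff (m + 1) sepSeries

theorem sepSeries_eq : sepSeries = d * sepDiv := by
  ext1 n
  rcases n with _ | n
  · rw [coeff_zero_d_mul, sepSeries, PowerSeries.coeff_mk]; simp
  · rw [coeff_d_mul, sepDiv, PowerSeries.coeff_mk]

theorem geo_sepDiv : Geo sepDiv := by
  obtain ⟨K, hK, h⟩ := L_iterate_bound
  have ht : 0 ≤ tauNorm 0 1 := tauNorm_nonneg _ _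
  have hc : ∀ n, PowerSeries.coeff n sepDiv = 0 ∨
      PowerSeries.coeff n sepDiv = (-4 / ((n + 1).factorial : ℂ)) • L^[n] 1 := by
    intro n
    rw [sepDiv, PowerSeries.coeff_mk, sepSeries, PowerSeries.coeff_mk]
    split_ifs
    · right
      rw [sepPoly, Polynomial.smul_eq_C_mul, Nat.add_sub_cancel]
    · left; rfl
  refine ⟨fun n => ?_, 4 * tauNorm 0 1 + 1, K, by linarith, hK, fun n => ?_⟩
  · rcases hc n with h1 | h1 <;> rw [h1]
    · simp
    · exact (Polynomial.natDegree_smul_le _ _).trans (h n).1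
  · rcases hc n with h1 | h1 <;> rw [nu, h1]
    · rw [tauNorm_zero]; positivity
    · rw [tauNorm_smul, norm_div, norm_neg, Complex.norm_natCast]
      have h2 : (0 : ℝ) < (n + 1).factorial := by exact_mod_cast Nat.factorial_pos _
      have h3 : (n.factorial : ℝ) ≤ (n + 1).factorial := by
        exact_mod_cast Nat.factorial_le (Nat.le_succ n)
      rw [div_mul_eq_mul_div, div_le_iff₀ h2]
      have h4 : ‖(4 : ℂ)‖ = 4 := by norm_num
      rw [h4]
      have hKn : 0 ≤ K ^ n := by positivity
      calc _ ≤ 4 * (n.factorial * K ^ n * tauNorm 0 1) := by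
            have := (h n).2
            gcongr
        _ = 4 * tauNorm 0 1 * K ^ n * n.factorial := by ring
        _ ≤ 4 * tauNorm 0 1 * K ^ n * (n + 1).factorial := by gcongr
        _ ≤ _ := by
            gcongr
            linarith

/-- For the growth estimates only the geometric growth of the inhomogeneity matters, since it is
negligible against factorials. -/
theorem exists_residual_eq : ∃ R : PSeries, rhs U - linOp U = d * R ∧ Geo R := by
  refine ⟨epsSq * (d * nonlin) - sepDiv - DiscretePendulum.linOp UDiv, ?_,
    ((geo_epsSq.mul geo_d_mul_nonlin).sub geo_sepDiv).sub geo_UDiv.linOp⟩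
  have h := linOp_d_mul UDiv
  rw [← U_eq_d_mul] at h
  rw [h, rhs, eps_sq_eq, sepSeries_eq, nonlin]
  ring

/-! ### Dividing by `d` -/

/-- The degree bound 2n - 1 at d^{2n} leaves room for one division by d: A / d is still graded, and
with it all the quotients. -/
theorem exists_quotients {A : PSeries} (hA : IsFormalSolution A) :
    ∃ g φ σ : PSeries, G A = d * g ∧ F A = d * φ ∧ sinRem A = d * σ ∧ φ = Q * g ∧
      Gr g ∧ Gr φ ∧ Gr σ ∧ Gr (cosRem A) := by
  set A' : PSeries := PowerSeries.mk fun n => PowerSeries.coeff (n + 1) A with hA'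
  have hA1 : A = d * A' := by
    ext1 n
    rcases n with _ | n
    · rw [coeff_zero_d_mul, hA.coeff_zero]
    · rw [coeff_d_mul, hA', PowerSeries.coeff_mk]
  have hgr : Gr A' := by
    intro n
    rw [hA', PowerSeries.coeff_mk]
    rcases Nat.even_or_odd' n with ⟨m, rfl | rfl⟩
    · rw [hA.coeff_odd]; simp
    · have := hA.natDegree_le (m + 1) (by omega)
      rw [show 2 * m + 1 + 1 = 2 * (m + 1) by ring]
      omega
  have hφ : Gr (A' - UDiv) := hgr.sub geo_UDiv.1
  have hF : F A = d * (A' - UDiv) := by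
    conv_lhs => rw [F, hA1, U_eq_d_mul]
    ring
  have hiQ : Geo (inv Q) := geo_inv geo_Q constantCoeff_Q
  refine ⟨(A' - UDiv) * inv Q, A' - UDiv,
    cosA (d * UDiv) * sinD A' - sinD UDiv * cosA (d * A') - (A' - UDiv), ?_, hF, ?_, ?_,
    hφ.mul hiQ.1, hφ, ?_, ?_⟩
  · rw [G, hF, mul_assoc]
  · rw [sinRem, sinDiff, hF, U_eq_d_mul]
    conv_lhs => rw [hA1]
    rw [← d_mul_sinD, ← d_mul_sinD]
    ring
  · rw [mul_left_comm, mul_inv Q constantCoeff_Q, mul_one]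
  · exact ((geo_UDiv.trig.1.1.mul hgr.trig.2).sub (geo_UDiv.trig.2.1.mul hgr.trig.1)).sub hφ
  · have e : cosRem A = cosA (d * UDiv) * cosA (d * A')
        + (1 - u ^ 2) * d ^ 2 * (sinD UDiv * sinD A') - 1 := by
      rw [cosRem, cosDiff, U_eq_d_mul]
      conv_lhs => rw [hA1]
      rw [← d_mul_sinD, ← d_mul_sinD]
      ring
    rw [e]
    exact ((geo_UDiv.trig.1.1.mul hgr.trig.1).add
      (geo_omega.1.mul (geo_UDiv.trig.2.1.mul hgr.trig.2))).sub geo_one.1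

theorem S_d_mul (Z : PSeries) : S (d * Z) = d * S Z := by
  rw [S_eq, S_eq, op_d_mul]

theorem Q₁_S_d_mul (Z : PSeries) : S (Q₁ * S (d * Z)) = d * S (Q₁ * S Z) := by
  rw [S_d_mul, mul_left_comm, S_d_mul]

theorem four_mul_S_mul_S_quotient {A g σ R : PSeries} (hA : IsFormalSolution A) (hg : G A = d * g)
    (hσ : sinRem A = d * σ) (hR : rhs U - linOp U = d * R) :
    4 * S (Q₁ * S g) = delta 1 * op (ex 1) g + delta (-1) * op (ex (-1)) g - lambda * g
      - weight * R - weight * (epsSq * (d * nonlin)) * cosRem A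
      - weight * (epsSq * (d ^ 2 * nonlinDeriv)) * σ := by
  refine mul_left_cancel₀ d_ne_zero ?_
  have h := four_mul_S_mul_S_G hA
  rw [hg, hσ, hR, op_d_mul, op_d_mul, Q₁_S_d_mul, eps_sq_eq] at h
  rw [weight]
  linear_combination h


/-! ### Scaled norms -/

/-- `(2π) ^ n ‖Z‖_n`. -/
def sc (n : ℕ) (Z : PSeries) : ℝ := (2 * Real.pi) ^ n * nu n Z

theorem two_pi_pos_real : 0 < 2 * Real.pi := by positivity

theorem one_le_two_pi : 1 ≤ 2 * Real.pi := by linarith [Real.pi_gt_three]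

theorem sc_nonneg (n : ℕ) (Z : PSeries) : 0 ≤ sc n Z :=
  mul_nonneg (by positivity) (nu_nonneg _ _)

theorem sc_add_le (n : ℕ) (Y Z : PSeries) : sc n (Y + Z) ≤ sc n Y + sc n Z := by
  rw [sc, sc, sc, ← mul_add]
  exact mul_le_mul_of_nonneg_left (nu_add_le _ _ _) (by positivity)

theorem sc_sub_le (n : ℕ) (Y Z : PSeries) : sc n (Y - Z) ≤ sc n Y + sc n Z := by
  rw [sc, sc, sc, ← mul_add]
  exact mul_le_mul_of_nonneg_left (nu_sub_le _ _ _) (by positivity)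

theorem mul_sum_antidiagonal_pow (w : ℝ) (a b : ℕ → ℝ) (n : ℕ) :
    w ^ n * ∑ y ∈ antidiagonal n, a y.1 * b y.2
      = ∑ y ∈ antidiagonal n, (w ^ y.1 * a y.1) * (w ^ y.2 * b y.2) := by
  rw [Finset.mul_sum]
  refine Finset.sum_congr rfl fun y hy => ?_
  rw [Finset.HasAntidiagonal.mem_antidiagonal] at hy
  rw [← hy, pow_add]; ring

theorem sc_mul_le {Y Z : PSeries} (hY : Gr Y) (hZ : Gr Z) (n : ℕ) :
    sc n (Y * Z) ≤ mulK * ∑ y ∈ antidiagonal n, sc y.1 Y * sc y.2 Z := by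
  have h := mul_le_mul_of_nonneg_left (nu_mul_le hY hZ n) (show 0 ≤ (2 * Real.pi) ^ n by positivity)
  rw [mul_left_comm, mul_sum_antidiagonal_pow (2 * Real.pi) (fun k => nu k Y) (fun k => nu k Z)] at h
  exact h

/-- Multiplication by `B`, a series of order at least `r`, is bounded by convolution with a
geometric sequence. -/
def ConvBound (r : ℕ) (B : PSeries) (K ρ : ℝ) : Prop :=
  ∀ Z : PSeries, Gr Z → ∀ n,
    sc n (B * Z) ≤ K * ∑ y ∈ antidiagonal n, (if r ≤ y.1 then ρ ^ y.1 else 0) * sc y.2 Z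

theorem ConvBound.mono {r : ℕ} {B : PSeries} {K K' ρ ρ' : ℝ} (h : ConvBound r B K ρ)
    (hK0 : 0 ≤ K) (hρ0 : 0 ≤ ρ) (hK : K ≤ K') (hρ : ρ ≤ ρ') : ConvBound r B K' ρ' := by
  intro Z hZ n
  refine (h Z hZ n).trans ?_
  have h1 : ∀ y ∈ antidiagonal n, (if r ≤ y.1 then ρ ^ y.1 else 0) * sc y.2 Z
      ≤ (if r ≤ y.1 then ρ' ^ y.1 else 0) * sc y.2 Z := by
    intro y _
    have := sc_nonneg y.2 Z
    split_ifs
    · gcongr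
    · exact le_rfl
  refine mul_le_mul hK (Finset.sum_le_sum h1) (Finset.sum_nonneg fun y _ => ?_) (by linarith)
  have := sc_nonneg y.2 Z
  split_ifs <;> positivity

theorem Geo.exists_sc_le {B : PSeries} (hB : Geo B) :
    ∃ K ρ : ℝ, 1 ≤ K ∧ 1 ≤ ρ ∧ ∀ n, sc n B ≤ K * ρ ^ n := by
  obtain ⟨_, K, ρ, hK, hρ, h⟩ := hB
  have h1 := one_le_two_pi
  refine ⟨K, 2 * Real.pi * ρ, hK, by nlinarith, fun n => ?_⟩
  calc _ ≤ (2 * Real.pi) ^ n * (K * ρ ^ n) := mul_le_mul_of_nonneg_left (h n) (by positivity)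
    _ = _ := by rw [mul_pow]; ring

theorem Geo.exists_convBound {B : PSeries} (hB : Geo B) {r : ℕ}
    (hr : ∀ k < r, PowerSeries.coeff k B = 0) :
    ∃ K ρ : ℝ, 1 ≤ K ∧ 1 ≤ ρ ∧ ConvBound r B K ρ := by
  obtain ⟨K, ρ, hK, hρ, h⟩ := hB.exists_sc_le
  have hm := one_le_mulK
  refine ⟨mulK * K, ρ, one_le_mul_of_one_le_of_one_le hm hK, hρ, fun Z hZ n => ?_⟩
  refine (sc_mul_le hB.1 hZ n).trans ?_
  rw [mul_assoc]
  refine mul_le_mul_of_nonneg_left ?_ (by linarith)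
  rw [Finset.mul_sum]
  refine Finset.sum_le_sum fun y _ => ?_
  have hz := sc_nonneg y.2 Z
  split_ifs with hy
  · calc _ ≤ (K * ρ ^ y.1) * sc y.2 Z := mul_le_mul_of_nonneg_right (h _) hz
      _ = _ := by ring
  · have : sc y.1 B = 0 := by
      rw [sc, nu, hr _ (by omega), tauNorm_zero, mul_zero]
    rw [this]; simp

theorem sc_op_ex_le {θ : ℂ} (hθ : ‖θ‖ = 1) {ρ : ℝ} (hρ : 2 * Real.pi ≤ ρ) (Z : PSeries) (n : ℕ) :
    sc n (op (ex θ) Z) ≤ ∑ y ∈ antidiagonal n,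
      ρ ^ y.1 / y.1.factorial * (y.2.ascFactorial y.1 * sc y.2 Z) := by
  have h := mul_le_mul_of_nonneg_left (nu_op_le (ex θ) Z n) (show 0 ≤ (2 * Real.pi) ^ n by positivity)
  refine h.trans ?_
  rw [Finset.mul_sum]
  refine Finset.sum_le_sum fun y hy => ?_
  rw [Finset.HasAntidiagonal.mem_antidiagonal] at hy
  rw [coeff_ex, norm_div, norm_pow, hθ, one_pow, Complex.norm_natCast, sc, ← hy, pow_add]
  have hn := nu_nonneg y.2 Z
  calc _ = (2 * Real.pi) ^ y.1 / y.1.factorial *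
        (y.2.ascFactorial y.1 * ((2 * Real.pi) ^ y.2 * nu y.2 Z)) := by ring
    _ ≤ _ := by gcongr

theorem exists_sc_le_sc_S : ∃ K : ℝ, 1 ≤ K ∧ ∀ Z : PSeries, Gr Z →
    (∀ n, tauBasis.repr (PowerSeries.coeff n Z) 0 = 0) → ∀ n, sc n Z ≤ K * (sc (n + 1) (S Z)
      + ∑ k ∈ Finset.range n, (n - 1).descFactorial k * sc (n - k) (S Z)) := by
  obtain ⟨K, hK, h⟩ := exists_nu_le_nu_S
  have h2 := one_le_two_pi
  have h0 := two_pi_pos_real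
  refine ⟨K + 1, by linarith, fun Z hZ h1 n => ?_⟩
  have hS : 0 ≤ sc (n + 1) (S Z) + ∑ k ∈ Finset.range n, (n - 1).descFactorial k * sc (n - k) (S Z) :=
    add_nonneg (sc_nonneg _ _) (Finset.sum_nonneg fun k _ => mul_nonneg (by positivity) (sc_nonneg _ _))
  refine le_trans ?_ (mul_le_mul_of_nonneg_right (by linarith : K ≤ K + 1) hS)
  have h3 := mul_le_mul_of_nonneg_left (h Z hZ h1 n) (show 0 ≤ (2 * Real.pi) ^ n by positivity)
  refine h3.trans ?_
  rw [mul_left_comm]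
  refine mul_le_mul_of_nonneg_left ?_ hK.le
  rw [mul_add, Finset.mul_sum]
  refine add_le_add ?_ (Finset.sum_le_sum fun k hk => ?_)
  · rw [sc, pow_succ]
    refine mul_le_mul_of_nonneg_right ?_ (nu_nonneg _ _)
    exact le_mul_of_one_le_right (by positivity) h2
  · have hk' : k < n := by simpa using hk
    -- The scaling by (2π)^n absorbs exactly the decay of the coefficients of x / (2 sinh(x/2)).
    have h4 : (2 * Real.pi) ^ n * ((2 * Real.pi) ^ (k + 1))⁻¹ ≤ (2 * Real.pi) ^ (n - k) := by
      rw [← div_eq_mul_inv, div_le_iff₀ (by positivity), ← pow_add]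
      exact pow_le_pow_right₀ h2 (by omega)
    have h5 := nu_nonneg (n - k) (S Z)
    rw [sc]
    calc _ = ((2 * Real.pi) ^ n * ((2 * Real.pi) ^ (k + 1))⁻¹) *
          ((n - 1).descFactorial k * nu (n - k) (S Z)) := by ring
      _ ≤ (2 * Real.pi) ^ (n - k) * ((n - 1).descFactorial k * nu (n - k) (S Z)) := by gcongr
      _ = _ := by ring

/-- Odd polynomials satisfy p(1) + p(-1) = 0 and so have no τ_0-component, as needed for inverting
𝒮. -/
theorem repr_coeff_zero_of_reflect {Z : PSeries} (h : reflect Z = -Z) (n : ℕ) :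
    tauBasis.repr (PowerSeries.coeff n Z) 0 = 0 := by
  refine repr_zero_eq_zero ?_
  have h1 := congrArg (fun p => Polynomial.eval 1 p) (congrArg (PowerSeries.coeff n) h)
  simp only [coeff_reflect, map_neg, Polynomial.eval_comp, Polynomial.eval_neg, Polynomial.eval_X] at h1
  linear_combination h1

theorem repr_coeff_Q₁_mul (Z : PSeries) (n : ℕ) :
    tauBasis.repr (PowerSeries.coeff n (Q₁ * Z)) 0 = 0 := by
  refine repr_zero_eq_zero ?_
  have hu : (1 - u ^ 2 : PSeries) = pol (1 - Polynomial.X ^ 2) := by simp [u]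
  have h : Q₁ * Z = pol (1 - Polynomial.X ^ 2) * (-(d ^ 2 * Q₁Div * Z)) := by
    rw [Q₁_eq_mul, ← hu]; ring
  rw [h, PowerSeries.coeff_C_mul]
  simp

/-- The inequalities for the norms of the coefficients of the formal solution. -/
theorem exists_normRecursion {A : PSeries} (hA : IsFormalSolution A) :
    ∃ g : PSeries, G A = d * g ∧ Gr g ∧ ∃ (K ρ : ℝ) (x φ c σ h f : ℕ → ℝ),
      NormRecursion K ρ (fun n => sc n g) x φ c σ (fun n => sc n (S (Q₁ * S g))) h f := by
  obtain ⟨g, φ, σ, hG, hF, hσ, hφg, grg, grφ, grσ, grc⟩ := exists_quotients hA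
  obtain ⟨R, hR, geoR⟩ := exists_residual_eq
  refine ⟨g, hG, grg, ?_⟩
  have h4E := four_mul_S_mul_S_quotient hA hG hσ hR
  obtain ⟨K₁, ρ₁, hK₁, hρ₁, b₁⟩ := (geo_delta 1).exists_convBound (coeff_delta (Or.inl rfl))
  obtain ⟨K₂, ρ₂, hK₂, hρ₂, b₂⟩ := (geo_delta (-1)).exists_convBound (coeff_delta (Or.inr rfl))
  obtain ⟨K₃, ρ₃, hK₃, hρ₃, b₃⟩ := geo_lambda.exists_convBound coeff_lambda
  obtain ⟨K₄, ρ₄, hK₄, hρ₄, b₄⟩ := (geo_weight.mul geoR).exists_sc_le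
  obtain ⟨K₅, ρ₅, hK₅, hρ₅, b₅⟩ := (geo_weight.mul (geo_epsSq.mul geo_d_mul_nonlin)).exists_convBound
    (r := 3) (d_pow_dvd_iff.mp (by
      rw [pow_succ]
      exact mul_dvd_mul (Dvd.intro _ rfl) ((Dvd.intro _ rfl : d ∣ d * nonlin).mul_left _)))
  obtain ⟨K₆, ρ₆, hK₆, hρ₆, b₆⟩ :=
    (geo_weight.mul (geo_epsSq.mul geo_d_sq_mul_nonlinDeriv)).exists_convBound
    (r := 4) (d_pow_dvd_iff.mp (by
      rw [show 4 = 2 + 2 by rfl, pow_add]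
      exact mul_dvd_mul (Dvd.intro _ rfl) ((Dvd.intro _ rfl : d ^ 2 ∣ d ^ 2 * nonlinDeriv).mul_left _)))
  obtain ⟨K₇, ρ₇, hK₇, hρ₇, b₇⟩ := geo_Q.exists_convBound (r := 0) (by simp)
  obtain ⟨K₈, ρ₈, hK₈, hρ₈, b₈⟩ := (geo_inv geo_Q₁Div constantCoeff_Q₁Div).exists_convBound
    (r := 0) (by simp)
  obtain ⟨K₉, hK₉, b₉⟩ := exists_sc_le_sc_S
  have hpi := one_le_two_pi
  have hm := one_le_mulK
  set T := 3 * Real.exp Real.pi with hT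
  have hT1 : 1 ≤ T := by
    have := Real.one_le_exp Real.pi_pos.le
    linarith
  -- The factor (2π)² pays for the index n + 2 in the scaled estimate of the cosine remainder.
  set M := (2 * Real.pi) ^ 2 * mulK ^ 2 with hM
  have hM1 : 1 ≤ M := one_le_mul_of_one_le_of_one_le (one_le_pow₀ hpi) (one_le_pow₀ hm)
  set K := K₁ + K₂ + K₃ + K₄ + K₅ + K₆ + K₇ + K₈ * T + K₉ + M + mulK + 2 with hK
  set ρ := ρ₁ + ρ₂ + ρ₃ + ρ₄ + ρ₅ + ρ₆ + ρ₇ + ρ₈ + 2 * Real.pi with hρ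
  have hKT : 1 ≤ K₈ * T := one_le_mul_of_one_le_of_one_le hK₈ hT1
  have hE4 : ∀ n, sc n (S (Q₁ * S g)) ≤ sc n (4 * S (Q₁ * S g)) := by
    intro n
    have h1 : (4 : PSeries) = num 4 := by
      have : (num 4 : PSeries) = num 1 + num 1 + num 1 + num 1 := by
        rw [num_add, num_add, num_add]; norm_num
      rw [this, num_one]; norm_num
    rw [h1, sc, sc, nu_num_mul]
    have h2 := nu_nonneg n (S (Q₁ * S g))
    have h3 : ‖(4 : ℂ)‖ = 4 := by norm_num
    rw [h3]
    gcongr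
    linarith
  refine ⟨K, ρ, fun n => sc n (op (ex 1) g) + sc n (op (ex (-1)) g), fun n => sc n φ,
    fun n => sc n (cosRem A), fun n => sc n σ, fun n => sc n (Q₁ * S g), fun n => sc n (S g), ?_⟩
  have hder : der (cosRem A) = -((1 - u ^ 2) * (d * (φ + σ)) * der (d * φ)) := by
    rw [der_cosRem hA, hσ, hF]; ring
  constructor
  · linarith
  · linarith
  · exact fun n => sc_nonneg _ _
  · exact fun n => add_nonneg (sc_nonneg _ _) (sc_nonneg _ _)
  · exact fun n => sc_nonneg _ _
  · exact fun n => sc_nonneg _ _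
  · exact fun n => sc_nonneg _ _
  · exact fun n => sc_nonneg _ _
  · intro n hn
    have h1 : d ^ 8 ∣ d * g := by
      rw [← hG, G]
      exact (d_pow_dvd_F hA).mul_right _
    have h2 := d_pow_dvd_iff.mp h1 (n + 1) (by omega)
    rw [coeff_d_mul] at h2
    show sc n g = 0
    rw [sc, nu, h2, tauNorm_zero, mul_zero]
  · show sc 0 (cosRem A) = 0
    rw [sc, nu, PowerSeries.coeff_zero_eq_constantCoeff_apply, constantCoeff_cosRem hA, tauNorm_zero,
      mul_zero]
  · show sc 1 (cosRem A) = 0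
    rw [sc, nu, coeff_one_of_der_eq hder, tauNorm_zero, mul_zero]
  · intro n
    have h1 := sc_op_ex_le (θ := 1) (by simp) (show 2 * Real.pi ≤ ρ by linarith) g n
    have h2 := sc_op_ex_le (θ := -1) (by simp) (show 2 * Real.pi ≤ ρ by linarith) g n
    set s := ∑ y ∈ antidiagonal n, ρ ^ y.1 / y.1.factorial * (y.2.ascFactorial y.1 * sc y.2 g) with hs
    have hs0 : 0 ≤ s := (sc_nonneg _ _).trans h1
    calc _ ≤ 2 * s := by linarith
      _ ≤ K * s := mul_le_mul_of_nonneg_right (by linarith) hs0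
  · intro n
    have h1 := (b₇.mono (K' := K) (ρ' := ρ) (by linarith) (by linarith) (by linarith) (by linarith)) g grg n
    simpa [hφg] using h1
  · intro n
    have h1 := mul_le_mul_of_nonneg_left (nu_add_two_le_of_der_eq grφ (grφ.add grσ) hder n)
      (show 0 ≤ (2 * Real.pi) ^ (n + 2) by positivity)
    have h2 : (2 * Real.pi) ^ (n + 2) * (mulK ^ 2 * ∑ y ∈ antidiagonal n, nu y.1 (φ + σ) * nu y.2 φ)
        = M * ∑ y ∈ antidiagonal n, sc y.1 (φ + σ) * sc y.2 φ := by
      have := mul_sum_antidiagonal_pow (2 * Real.pi) (fun k => nu k (φ + σ)) (fun k => nu k φ) n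
      simp only [sc]
      rw [← this, hM]; ring
    rw [h2] at h1
    refine h1.trans ?_
    have h3 : ∑ y ∈ antidiagonal n, sc y.1 (φ + σ) * sc y.2 φ
        ≤ ∑ y ∈ antidiagonal n, (sc y.1 φ + sc y.1 σ) * sc y.2 φ :=
      Finset.sum_le_sum fun y _ => mul_le_mul_of_nonneg_right (sc_add_le _ _ _) (sc_nonneg _ _)
    refine mul_le_mul (by linarith) h3 (Finset.sum_nonneg fun y _ =>
      mul_nonneg (sc_nonneg _ _) (sc_nonneg _ _)) (by linarith)
  · intro n
    have h1 := mul_le_mul_of_nonneg_left (nu_le_of_der_eq' grφ grc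
      (by rw [← hσ, ← hF]; exact der_sinRem hA) n)
      (show 0 ≤ (2 * Real.pi) ^ n by positivity)
    rw [mul_left_comm, mul_sum_antidiagonal_pow (2 * Real.pi) (fun k => nu k (cosRem A))
      (fun k => nu k φ)] at h1
    refine h1.trans (mul_le_mul_of_nonneg_right (by linarith) (Finset.sum_nonneg fun y _ =>
      mul_nonneg (sc_nonneg _ _) (sc_nonneg _ _)))
  · intro n
    refine (hE4 n).trans ?_
    rw [h4E]
    have p := fun Y Z => sc_sub_le n Y Z
    have e1 := b₁.mono (ρ' := ρ) (by linarith) (by linarith) le_rfl (by linarith) _ (grg.op (ex 1)) n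
    have e2 := b₂.mono (ρ' := ρ) (by linarith) (by linarith) le_rfl (by linarith) _ (grg.op (ex (-1))) n
    have e3 := b₃.mono (ρ' := ρ) (by linarith) (by linarith) le_rfl (by linarith) _ grg n
    have e4 := b₄ n
    have e5 := b₅.mono (K' := K) (ρ' := ρ) (by linarith) (by linarith) (by linarith) (by linarith) _ grc n
    have e6 := b₆.mono (K' := K) (ρ' := ρ) (by linarith) (by linarith) (by linarith) (by linarith) _ grσ n
    have e4' : K₄ * ρ₄ ^ n ≤ K * ρ ^ n := by gcongr <;> linarith
    have hw : ∀ y : ℕ × ℕ, 0 ≤ (if 10 ≤ y.1 then ρ ^ y.1 else 0) := fun y => by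
      split_ifs
      · have : 0 ≤ ρ := by linarith
        positivity
      · exact le_rfl
    have e123 : K₁ * ∑ y ∈ antidiagonal n, (if 10 ≤ y.1 then ρ ^ y.1 else 0) * sc y.2 (op (ex 1) g)
        + K₂ * ∑ y ∈ antidiagonal n, (if 10 ≤ y.1 then ρ ^ y.1 else 0) * sc y.2 (op (ex (-1)) g)
        + K₃ * ∑ y ∈ antidiagonal n, (if 10 ≤ y.1 then ρ ^ y.1 else 0) * sc y.2 g
        ≤ K * ∑ y ∈ antidiagonal n, (if 10 ≤ y.1 then ρ ^ y.1 else 0) *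
          (sc y.2 (op (ex 1) g) + sc y.2 (op (ex (-1)) g) + sc y.2 g) := by
      rw [Finset.mul_sum, Finset.mul_sum, Finset.mul_sum, Finset.mul_sum, ← Finset.sum_add_distrib,
        ← Finset.sum_add_distrib]
      refine Finset.sum_le_sum fun y _ => ?_
      have q1 := mul_nonneg (hw y) (sc_nonneg y.2 (op (ex 1) g))
      have q2 := mul_nonneg (hw y) (sc_nonneg y.2 (op (ex (-1)) g))
      have q3 := mul_nonneg (hw y) (sc_nonneg y.2 g)
      have r1 := mul_le_mul_of_nonneg_right (by linarith : K₁ ≤ K) q1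
      have r2 := mul_le_mul_of_nonneg_right (by linarith : K₂ ≤ K) q2
      have r3 := mul_le_mul_of_nonneg_right (by linarith : K₃ ≤ K) q3
      rw [mul_add, mul_add]
      linarith
    have s1 := p (delta 1 * op (ex 1) g + delta (-1) * op (ex (-1)) g - lambda * g - weight * R
      - weight * (epsSq * (d * nonlin)) * cosRem A) (weight * (epsSq * (d ^ 2 * nonlinDeriv)) * σ)
    have s2 := p (delta 1 * op (ex 1) g + delta (-1) * op (ex (-1)) g - lambda * g - weight * R)
      (weight * (epsSq * (d * nonlin)) * cosRem A)
    have s3 := p (delta 1 * op (ex 1) g + delta (-1) * op (ex (-1)) g - lambda * g) (weight * R)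
    have s4 := p (delta 1 * op (ex 1) g + delta (-1) * op (ex (-1)) g) (lambda * g)
    have s5 := sc_add_le n (delta 1 * op (ex 1) g) (delta (-1) * op (ex (-1)) g)
    linarith
  · intro n
    refine (b₉ _ (geo_Q₁.1.mul grg.S) (repr_coeff_Q₁_mul _) n).trans ?_
    refine mul_le_mul_of_nonneg_right (by linarith) (add_nonneg (sc_nonneg _ _)
      (Finset.sum_nonneg fun k _ => mul_nonneg (by positivity) (sc_nonneg _ _)))
  · intro n
    -- Division by Q₁ = -(1 - u²) d² `Q₁Div` is done in two stages: by (1 - u²) d², which shifts the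
    -- index by 2, and by the invertible series `Q₁Div`.
    set Y := Q₁Div * S g with hY
    have grY : Gr Y := geo_Q₁Div.1.mul grg.S
    have hSg : S g = inv Q₁Div * Y := by
      rw [hY, ← mul_assoc, mul_comm (inv _), mul_inv _ constantCoeff_Q₁Div, one_mul]
    have hneg : -(Q₁ * S g) = (1 - u ^ 2) * d ^ 2 * Y := by rw [hY, Q₁_eq_mul]; ring
    have hYle : ∀ m, sc m Y ≤ T * sc (m + 2) (Q₁ * S g) := by
      intro m
      have h1 := nu_le_of_omega_mul grY hneg m
      rw [nu_neg] at h1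
      have h2 := nu_nonneg (m + 2) (Q₁ * S g)
      calc _ ≤ (2 * Real.pi) ^ m * (T * nu (m + 2) (Q₁ * S g)) :=
            mul_le_mul_of_nonneg_left h1 (by positivity)
        _ ≤ (2 * Real.pi) ^ (m + 2) * (T * nu (m + 2) (Q₁ * S g)) := by
            gcongr
            omega
        _ = _ := by rw [sc]; ring
    have h1 := b₈.mono (ρ' := ρ) (by linarith) (by linarith) le_rfl (by linarith) Y grY n
    rw [← hSg] at h1
    refine h1.trans ?_
    have hρ0 : 0 ≤ ρ := by linarith
    calc _ ≤ K₈ * ∑ y ∈ antidiagonal n, ρ ^ y.1 * (T * sc (y.2 + 2) (Q₁ * S g)) := by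
          refine mul_le_mul_of_nonneg_left (Finset.sum_le_sum fun y _ => ?_) (by linarith)
          rw [if_pos (Nat.zero_le _)]
          exact mul_le_mul_of_nonneg_left (hYle _) (by positivity)
      _ = K₈ * T * ∑ y ∈ antidiagonal n, ρ ^ y.1 * sc (y.2 + 2) (Q₁ * S g) := by
          rw [mul_assoc, Finset.mul_sum _ _ T]
          congr 1
          refine Finset.sum_congr rfl fun y _ => by ring
      _ ≤ _ := by
          refine mul_le_mul_of_nonneg_right (by linarith) (Finset.sum_nonneg fun y _ =>
            mul_nonneg (by positivity) (sc_nonneg _ _))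
  · intro n
    -- F is odd in u and Q is even, so g is odd and has no τ_0-component.
    have hgodd : reflect g = -g := by
      refine mul_left_cancel₀ d_ne_zero ?_
      have h1 : reflect (G A) = -G A := by
        rw [G, map_mul, reflect_F hA, reflect_inv_Q]; ring
      rw [hG, map_mul, reflect_d] at h1
      linear_combination h1
    refine (b₉ g grg (repr_coeff_zero_of_reflect hgodd) n).trans ?_
    refine mul_le_mul_of_nonneg_right (by linarith) (add_nonneg (sc_nonneg _ _)
      (Finset.sum_nonneg fun k _ => mul_nonneg (by positivity) (sc_nonneg _ _)))

end DiscretePendulum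

end

theorem lemma5p2 (A : DiscretePendulum.PSeries) (hA : DiscretePendulum.IsFormalSolution A) :
    ∃ E : DiscretePendulum.PSeries,
      DiscretePendulum.d * E =
        DiscretePendulum.S (DiscretePendulum.Q₁ * DiscretePendulum.S (DiscretePendulum.G A)) ∧
      (∀ n : ℕ, (PowerSeries.coeff n E).natDegree ≤ n) ∧
      (fun n : ℕ => DiscretePendulum.tauNorm n (PowerSeries.coeff n E)) =O[atTop]
        (fun n : ℕ => ((n - 8).factorial : ℝ) * ((2 * Real.pi) ^ n)⁻¹) := by
  obtain ⟨g, hG, hg, K, ρ, x, φ, c, σ, h, f, H⟩ := DiscretePendulum.exists_normRecursion hA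
  obtain ⟨M, hM⟩ := H.exists_e_le
  -- Multiplication by d commutes with 𝒮 and with multiplication by Q₁, so the quotient is the same
  -- expression in g = G / d.
  refine ⟨DiscretePendulum.S (DiscretePendulum.Q₁ * DiscretePendulum.S g), ?_,
    (DiscretePendulum.geo_Q₁.1.mul hg.S).S, ?_⟩
  · rw [hG, DiscretePendulum.Q₁_S_d_mul]
  · refine IsBigO.of_bound M (Eventually.of_forall fun n => ?_)
    have hpos : (0 : ℝ) < (2 * Real.pi) ^ n := by positivity
    rw [Real.norm_of_nonneg (DiscretePendulum.tauNorm_nonneg _ _),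
      Real.norm_of_nonneg (by positivity), ← mul_assoc, ← div_eq_mul_inv, le_div_iff₀ hpos, mul_comm]
    exact hM n
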